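/- Let $q$ be a nonzero complex number that is not a root of unity, fix a square root $q^{1/2}$ of $q$, and put $q^{m}=(q^{1/2})^{2m}$ for half-integers $m$ and $[m]_q=(q^m-q^{-m})/(q-q^{-1})$. Let $U_q(\mathfrak{sl}_2)$ be the unital associative $\mathbb C$-algebra generated by $E$, $F$ and the invertible element $q^H$ with relations $$q^HE=q\,Eq^H,\qquad q^HF=q^{-1}Fq^H,\qquad EF-FE=\frac{q^{2H}-q^{-2H}}{q-q^{-1}},$$ with comultiplication $\Delta(E)=E\otimes q^{-H}+q^H\otimes E$, $\Delta(F)=F\otimes q^{-H}+q^H\otimes F$, $\Delta(q^H)=q^H\otimes q^H$, put $\Delta^{(2)}=(\Delta\otimes\mathrm{id})\Delta$, and let $\Gamma=(q-q^{-1})^2FE+q\,q^{2H}+q^{-1}q^{-2H}$ be the Casimir element. For $j\in\{0,\tfrac12,1,\tfrac32,\dots\}$ let $\pi_j:U_q(\mathfrak{sl}_2)\to\mathrm{End}(M_j)$ be the spin-$j$ representation, of dimension $2j+1$, with basis $v_0,\dots,v_{2j}$ and $$q^Hv_i=q^{j-i}v_i,\qquad Ev_i=[2j-i+1]_q\,v_{i-1},\qquad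 Fv_i=[i+1]_q\,v_{i+1}\qquad(v_{-1}=v_{2j+1}=0).$$ For spins $j_1,j_2,j_3$ put $\pi=\pi_{j_1}\otimes\pi_{j_2}\otimes\pi_{j_3}$ and let $$\mathcal C_{j_1,j_2,j_3}=\{m\in\mathrm{End}(M_{j_1}\otimes M_{j_2}\otimes M_{j_3}) : [\pi(\Delta^{(2)}(x)),m]=0\ \text{for all } x\in U_q(\mathfrak{sl}_2)\}.$$ Let $C_1=\pi(\Gamma\otimes1\otimes1)$, $C_2=\pi(1\otimes\Gamma\otimes1)$, $C_3=\pi(1\otimes1\otimes\Gamma)$, $C_{12}=\pi(\Delta(\Gamma)\otimes1)$, $C_{23}=\pi(1\otimes\Delta(\Gamma))$ and $C_{123}=\pi(\Delta^{(2)}(\Gamma))$. The centrally extended Askey–Wilson algebra $AW(3)$ is the unital associative $\mathbb C$-algebra generated by $A,B,D$ and central elements $\alpha_1,\alpha_2,\alpha_3,K$ with relations $$A+\frac{[B,D]_q}{q^2-q^{-2}}=\frac{\alpha_1\alpha_2+\alpha_3K}{q+q^{-1}},\quad B+\frac{[D,A]_q}{q^2-q^{-2}}=\frac{\alpha_2\alpha_3+\alpha_1K}{q+q^{-1}},\quad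 D+\frac{[A,B]_q}{q^2-q^{-2}}=\frac{\alpha_1\alpha_3+\alpha_2K}{q+q^{-1}},$$ where $[X,Y]_q=qXY-q^{-1}YX$. Then, for all spins $j_1,j_2,j_3$, there is an algebra homomorphism $\phi:AW(3)\to\mathcal C_{j_1,j_2,j_3}$ with $\phi(\alpha_i)=C_i$ for $i=1,2,3$, $\phi(A)=C_{12}$, $\phi(B)=C_{23}$ and $\phi(K)=C_{123}$ (it is unique, because the third relation expresses $D$ through the other generators), and $\phi$ is surjective. In particular, $\mathcal C_{j_1,j_2,j_3}$ is generated as a unital $\mathbb C$-algebra by $C_{12}$, $C_{23}$ and $C_{123}$. -/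

import Mathlib

open scoped TensorProduct

noncomputable section

namespace AskeyWilson

/-- The `q`-number `[m]_q = (q ^ m - q ^ (-m)) / (q - q⁻¹)`, for an integer `m`. -/
def qnum (q : ℂˣ) (m : ℤ) : ℂ :=
  ((q : ℂ) ^ m - (q : ℂ) ^ (-m)) / ((q : ℂ) - (q : ℂ)⁻¹)

/-! ### The quantum algebra `U_q(sl₂)` -/

/-- Generators of `U_q(sl₂)`: `E`, `F`, `q^H` and `q^{-H}`. -/
inductive UqGen : Type
  | E : UqGen
  | F : UqGen
  | qH : UqGen
  | qHinv : UqGen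

section Relations

open FreeAlgebra UqGen

/-- Defining relations of `U_q(sl₂)`: `q^H` and `q^{-H}` are mutually inverse,
`q^H E = q E q^H`, `q^H F = q⁻¹ F q^H`, and
`[E, F] = [2H]_q = (q^{2H} - q^{-2H}) / (q - q⁻¹)`. -/
inductive UqRel (q : ℂˣ) : FreeAlgebra ℂ UqGen → FreeAlgebra ℂ UqGen → Prop
  | qH_mul_qHinv : UqRel q (ι ℂ qH * ι ℂ qHinv) 1
  | qHinv_mul_qH : UqRel q (ι ℂ qHinv * ι ℂ qH) 1
  | qH_mul_E : UqRel q (ι ℂ qH * ι ℂ E) ((q : ℂ) • (ι ℂ E * ι ℂ qH))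
  | qH_mul_F : UqRel q (ι ℂ qH * ι ℂ F) ((q : ℂ)⁻¹ • (ι ℂ F * ι ℂ qH))
  | comm_E_F : UqRel q (ι ℂ E * ι ℂ F - ι ℂ F * ι ℂ E)
      (((q : ℂ) - (q : ℂ)⁻¹)⁻¹ • (ι ℂ qH ^ 2 - ι ℂ qHinv ^ 2))

end Relations

/-- The quantum algebra `U_q(sl₂)`. -/
def Uq (q : ℂˣ) : Type := RingQuot (UqRel q)

instance (q : ℂˣ) : Ring (Uq q) := inferInstanceAs (Ring (RingQuot (UqRel q)))

instance (q : ℂˣ) : Algebra ℂ (Uq q) := inferInstanceAs (Algebra ℂ (RingQuot (UqRel q)))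

namespace Uq

variable (q : ℂˣ)

/-- The class of a generator in `U_q(sl₂)`. -/
def gen (g : UqGen) : Uq q := RingQuot.mkAlgHom ℂ (UqRel q) (FreeAlgebra.ι ℂ g)

/-- The generator `E`. -/
def E : Uq q := gen q UqGen.E

/-- The generator `F`. -/
def F : Uq q := gen q UqGen.F

/-- The generator `q^H`. -/
def qH : Uq q := gen q UqGen.qH

/-- The inverse `q^{-H}` of the generator `q^H`. -/
def qHinv : Uq q := gen q UqGen.qHinv

theorem qH_mul_qHinv : qH q * qHinv q = 1 := by
  have h := RingQuot.mkAlgHom_rel ℂ (UqRel.qH_mul_qHinv (q := q))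
  simp only [map_mul, map_one] at h
  exact h

theorem qHinv_mul_qH : qHinv q * qH q = 1 := by
  have h := RingQuot.mkAlgHom_rel ℂ (UqRel.qHinv_mul_qH (q := q))
  simp only [map_mul, map_one] at h
  exact h

theorem qH_mul_E : qH q * E q = (q : ℂ) • (E q * qH q) := by
  have h := RingQuot.mkAlgHom_rel ℂ (UqRel.qH_mul_E (q := q))
  simp only [map_mul, map_smul] at h
  exact h

theorem qH_mul_F : qH q * F q = (q : ℂ)⁻¹ • (F q * qH q) := by
  have h := RingQuot.mkAlgHom_rel ℂ (UqRel.qH_mul_F (q := q))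
  simp only [map_mul, map_smul] at h
  exact h

theorem comm_E_F : E q * F q - F q * E q =
    ((q : ℂ) - (q : ℂ)⁻¹)⁻¹ • (qH q ^ 2 - qHinv q ^ 2) := by
  have h := RingQuot.mkAlgHom_rel ℂ (UqRel.comm_E_F (q := q))
  simp only [map_mul, map_smul, map_sub, map_pow] at h
  exact h

theorem E_mul_qHinv : E q * qHinv q = (q : ℂ) • (qHinv q * E q) := by
  calc E q * qHinv q = qHinv q * (qH q * E q) * qHinv q := by
        rw [← mul_assoc, qHinv_mul_qH, one_mul]
    _ = (q : ℂ) • (qHinv q * E q) := by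
        rw [qH_mul_E, mul_smul_comm, smul_mul_assoc, mul_assoc, mul_assoc, qH_mul_qHinv, mul_one]

theorem F_mul_qHinv : F q * qHinv q = (q : ℂ)⁻¹ • (qHinv q * F q) := by
  calc F q * qHinv q = qHinv q * (qH q * F q) * qHinv q := by
        rw [← mul_assoc, qHinv_mul_qH, one_mul]
    _ = (q : ℂ)⁻¹ • (qHinv q * F q) := by
        rw [qH_mul_F, mul_smul_comm, smul_mul_assoc, mul_assoc, mul_assoc, qH_mul_qHinv, mul_one]

variable {q} in
/-- The homomorphism out of `U_q(sl₂)` determined by images of the generators that satisfy the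
defining relations. -/
def lift {R : Type*} [Ring R] [Algebra ℂ R] (e f k k' : R)
    (hk : k * k' = 1) (hk' : k' * k = 1)
    (he : k * e = (q : ℂ) • (e * k)) (hf : k * f = (q : ℂ)⁻¹ • (f * k))
    (hef : e * f - f * e = ((q : ℂ) - (q : ℂ)⁻¹)⁻¹ • (k ^ 2 - k' ^ 2)) : Uq q →ₐ[ℂ] R :=
  RingQuot.liftAlgHom ℂ
    ⟨FreeAlgebra.lift ℂ (fun g : UqGen => match g with
      | UqGen.E => e
      | UqGen.F => f
      | UqGen.qH => k
      | UqGen.qHinv => k'), by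
      intro x y h
      cases h <;> simp [hk, hk', he, hf, hef]⟩

/-- The Casimir element `Γ = (q - q⁻¹)² F E + q q^{2H} + q⁻¹ q^{-2H}`. -/
def casimir : Uq q :=
  ((q : ℂ) - (q : ℂ)⁻¹) ^ 2 • (F q * E q) + (q : ℂ) • qH q ^ 2 + (q : ℂ)⁻¹ • qHinv q ^ 2

/-- The comultiplication: `Δ(E) = E ⊗ q^{-H} + q^H ⊗ E`, `Δ(F) = F ⊗ q^{-H} + q^H ⊗ F`,
`Δ(q^H) = q^H ⊗ q^H`. -/
def comul : Uq q →ₐ[ℂ] Uq q ⊗[ℂ] Uq q :=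
  lift (E q ⊗ₜ[ℂ] qHinv q + qH q ⊗ₜ[ℂ] E q) (F q ⊗ₜ[ℂ] qHinv q + qH q ⊗ₜ[ℂ] F q)
    (qH q ⊗ₜ[ℂ] qH q) (qHinv q ⊗ₜ[ℂ] qHinv q)
    (by simp [qH_mul_qHinv, Algebra.TensorProduct.one_def])
    (by simp [qHinv_mul_qH, Algebra.TensorProduct.one_def])
    (by
      simp [mul_add, add_mul, qH_mul_qHinv, qHinv_mul_qH, qH_mul_E, TensorProduct.smul_tmul',
        TensorProduct.tmul_smul])
    (by
      simp [mul_add, add_mul, qH_mul_qHinv, qHinv_mul_qH, qH_mul_F, TensorProduct.smul_tmul',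
        TensorProduct.tmul_smul])
    (by
      have hq : (q : ℂ) ≠ 0 := q.ne_zero
      have h := comm_E_F q
      have h1 : E q * F q = F q * E q +
          ((q : ℂ) - (q : ℂ)⁻¹)⁻¹ • (qH q ^ 2 - qHinv q ^ 2) := by
        rw [← h]; abel
      simp only [mul_add, add_mul, Algebra.TensorProduct.tmul_mul_tmul, qH_mul_E, qH_mul_F,
        E_mul_qHinv, F_mul_qHinv, h1, pow_two, TensorProduct.add_tmul, TensorProduct.tmul_add,
        TensorProduct.sub_tmul, TensorProduct.tmul_sub, TensorProduct.tmul_smul,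
        ← TensorProduct.smul_tmul', smul_sub, smul_smul, mul_inv_cancel₀ hq,
        inv_mul_cancel₀ hq, one_smul]
      abel)

/-- The iterated comultiplication `Δ^{(2)} = (Δ ⊗ id) Δ`. -/
def comul₂ : Uq q →ₐ[ℂ] (Uq q ⊗[ℂ] Uq q) ⊗[ℂ] Uq q :=
  (Algebra.TensorProduct.map (comul q) (AlgHom.id ℂ (Uq q))).comp (comul q)

/-- `Γ₁ = Γ ⊗ 1 ⊗ 1`. -/
def casimir₁ : (Uq q ⊗[ℂ] Uq q) ⊗[ℂ] Uq q := (casimir q ⊗ₜ[ℂ] 1) ⊗ₜ[ℂ] 1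

/-- `Γ₂ = 1 ⊗ Γ ⊗ 1`. -/
def casimir₂ : (Uq q ⊗[ℂ] Uq q) ⊗[ℂ] Uq q := (1 ⊗ₜ[ℂ] casimir q) ⊗ₜ[ℂ] 1

/-- `Γ₃ = 1 ⊗ 1 ⊗ Γ`. -/
def casimir₃ : (Uq q ⊗[ℂ] Uq q) ⊗[ℂ] Uq q := (1 ⊗ₜ[ℂ] 1) ⊗ₜ[ℂ] casimir q

/-- The intermediate Casimir `Γ₁₂ = Δ(Γ) ⊗ 1`. -/
def casimir₁₂ : (Uq q ⊗[ℂ] Uq q) ⊗[ℂ] Uq q := comul q (casimir q) ⊗ₜ[ℂ] 1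

/-- The intermediate Casimir `Γ₂₃ = 1 ⊗ Δ(Γ)`. -/
def casimir₂₃ : (Uq q ⊗[ℂ] Uq q) ⊗[ℂ] Uq q :=
  (Algebra.TensorProduct.assoc ℂ ℂ ℂ (Uq q) (Uq q) (Uq q)).symm (1 ⊗ₜ[ℂ] comul q (casimir q))

/-- The total Casimir `Γ₁₂₃ = Δ^{(2)}(Γ)`. -/
def casimir₁₂₃ : (Uq q ⊗[ℂ] Uq q) ⊗[ℂ] Uq q := comul₂ q (casimir q)

end Uq

/-! ### The irreducible representations -/

/-- The underlying space of the spin-`j` representation `M_j`, where `n = 2j`; it has dimension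
`n + 1 = 2j + 1`. The standard basis vector `v_i`, `0 ≤ i ≤ n`, has weight `j - i`. -/
abbrev SpinModule (n : ℕ) : Type := Fin (n + 1) → ℂ

/-- The action of `E` on `M_j`: `E v_i = [2j - i + 1]_q v_{i-1}` and `E v_0 = 0`. -/
def spinE (q : ℂˣ) (n : ℕ) : Module.End ℂ (SpinModule n) where
  toFun v i := if h : (i : ℕ) < n then
    qnum q ((n : ℤ) - (i : ℕ)) * v ⟨i + 1, Nat.succ_lt_succ h⟩ else 0
  map_add' v w := by
    funext i
    by_cases h : (i : ℕ) < n
    · simp only [Pi.add_apply, dif_pos h, mul_add]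
    · simp only [Pi.add_apply, dif_neg h, add_zero]
  map_smul' c v := by
    funext i
    by_cases h : (i : ℕ) < n
    · simp only [Pi.smul_apply, dif_pos h, smul_eq_mul, mul_left_comm, RingHom.id_apply]
    · simp only [Pi.smul_apply, dif_neg h, smul_zero]

/-- The action of `F` on `M_j`: `F v_i = [i + 1]_q v_{i+1}` and `F v_{2j} = 0`. -/
def spinF (q : ℂˣ) (n : ℕ) : Module.End ℂ (SpinModule n) where
  toFun v i := if 0 < (i : ℕ) then
    qnum q (i : ℕ) * v ⟨i - 1, lt_of_le_of_lt (Nat.sub_le _ _) i.isLt⟩ else 0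
  map_add' v w := by
    funext i
    by_cases h : 0 < (i : ℕ)
    · simp only [Pi.add_apply, if_pos h, mul_add]
    · simp only [Pi.add_apply, if_neg h, add_zero]
  map_smul' c v := by
    funext i
    by_cases h : 0 < (i : ℕ)
    · simp only [Pi.smul_apply, if_pos h, smul_eq_mul, mul_left_comm, RingHom.id_apply]
    · simp only [Pi.smul_apply, if_neg h, smul_zero]

theorem spinE_apply_of_lt (q : ℂˣ) (n : ℕ) (v : SpinModule n) (i : Fin (n + 1))
    (h : (i : ℕ) < n) :
    spinE q n v i = qnum q ((n : ℤ) - (i : ℕ)) * v ⟨i + 1, Nat.succ_lt_succ h⟩ :=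
  dif_pos h

theorem spinE_apply_of_not_lt (q : ℂˣ) (n : ℕ) (v : SpinModule n) (i : Fin (n + 1))
    (h : ¬ (i : ℕ) < n) : spinE q n v i = 0 :=
  dif_neg h

theorem spinF_apply_of_pos (q : ℂˣ) (n : ℕ) (v : SpinModule n) (i : Fin (n + 1))
    (h : 0 < (i : ℕ)) : spinF q n v i =
      qnum q (i : ℕ) * v ⟨i - 1, lt_of_le_of_lt (Nat.sub_le _ _) i.isLt⟩ :=
  if_pos h

theorem spinF_apply_of_not_pos (q : ℂˣ) (n : ℕ) (v : SpinModule n) (i : Fin (n + 1))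
    (h : ¬ 0 < (i : ℕ)) : spinF q n v i = 0 :=
  if_neg h

/-- The diagonal operator `v_i ↦ s^{n - 2i} v_i` on `M_j`. With `s² = q` and `n = 2j`, this is
the action `v_i ↦ q^{j - i} v_i` of `q^H`. -/
def spinK (s : ℂˣ) (n : ℕ) : Module.End ℂ (SpinModule n) where
  toFun v i := (s : ℂ) ^ ((n : ℤ) - 2 * (i : ℕ)) * v i
  map_add' v w := by
    funext i
    simp [mul_add]
  map_smul' c v := by
    funext i
    simp [mul_left_comm]

theorem spinK_apply (s : ℂˣ) (n : ℕ) (v : SpinModule n) (i : Fin (n + 1)) :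
    spinK s n v i = (s : ℂ) ^ ((n : ℤ) - 2 * (i : ℕ)) * v i :=
  rfl

theorem spinK_mul_inv (s : ℂˣ) (n : ℕ) : spinK s n * spinK s⁻¹ n = 1 := by
  refine LinearMap.ext fun v => funext fun i => ?_
  have hs : (s : ℂ) ≠ 0 := s.ne_zero
  simp only [spinK_apply, Module.End.mul_apply, Units.val_inv_eq_inv_val,
    Module.End.one_apply, inv_zpow]
  rw [← mul_assoc, mul_inv_cancel₀ (zpow_ne_zero _ hs), one_mul]

theorem spinK_mul_spinE (q s : ℂˣ) (hs : s ^ 2 = q) (n : ℕ) :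
    spinK s n * spinE q n = (q : ℂ) • (spinE q n * spinK s n) := by
  have hq : (q : ℂ) = (s : ℂ) ^ (2 : ℤ) := by rw [← hs]; norm_cast
  refine LinearMap.ext fun v => funext fun i => ?_
  have h0 : (s : ℂ) ≠ 0 := s.ne_zero
  simp only [Module.End.mul_apply, LinearMap.smul_apply, Pi.smul_apply, smul_eq_mul, spinK_apply]
  by_cases h : (i : ℕ) < n
  · have e : (n : ℤ) - 2 * (i : ℕ) = 2 + ((n : ℤ) - 2 * ((i : ℕ) + 1 : ℕ)) := by push_cast; ring
    rw [spinE_apply_of_lt _ _ _ _ h, spinE_apply_of_lt _ _ _ _ h, spinK_apply, hq, e,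
      zpow_add₀ h0]
    ring
  · rw [spinE_apply_of_not_lt _ _ _ _ h, spinE_apply_of_not_lt _ _ _ _ h, mul_zero, mul_zero]

theorem spinK_mul_spinF (q s : ℂˣ) (hs : s ^ 2 = q) (n : ℕ) :
    spinK s n * spinF q n = (q : ℂ)⁻¹ • (spinF q n * spinK s n) := by
  have hq : (q : ℂ) = (s : ℂ) ^ (2 : ℤ) := by rw [← hs]; norm_cast
  refine LinearMap.ext fun v => funext fun i => ?_
  have h0 : (s : ℂ) ≠ 0 := s.ne_zero
  simp only [Module.End.mul_apply, LinearMap.smul_apply, Pi.smul_apply, smul_eq_mul, spinK_apply]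
  by_cases h : 0 < (i : ℕ)
  · have e : (n : ℤ) - 2 * (i : ℕ) = -2 + ((n : ℤ) - 2 * ((i : ℕ) - 1 : ℕ)) := by omega
    rw [spinF_apply_of_pos _ _ _ _ h, spinF_apply_of_pos _ _ _ _ h, spinK_apply, hq, e,
      zpow_add₀ h0, zpow_neg]
    ring
  · rw [spinF_apply_of_not_pos _ _ _ _ h, spinF_apply_of_not_pos _ _ _ _ h, mul_zero, mul_zero]

theorem qnum_zero (q : ℂˣ) : qnum q 0 = 0 := by simp [qnum]

theorem qnum_mul_sub (q : ℂˣ) (n i : ℤ) :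
    qnum q (n - i) * qnum q (i + 1) - qnum q i * qnum q (n - i + 1) =
      ((q : ℂ) - (q : ℂ)⁻¹)⁻¹ * ((q : ℂ) ^ (n - 2 * i) - ((q : ℂ) ^ (n - 2 * i))⁻¹) := by
  have hq : (q : ℂ) ≠ 0 := q.ne_zero
  by_cases h : (q : ℂ) - (q : ℂ)⁻¹ = 0
  · simp [qnum, h]
  · have key : ((q : ℂ) ^ (n - i) - (q : ℂ) ^ (-(n - i))) *
        ((q : ℂ) ^ (i + 1) - (q : ℂ) ^ (-(i + 1))) -
        ((q : ℂ) ^ i - (q : ℂ) ^ (-i)) * ((q : ℂ) ^ (n - i + 1) - (q : ℂ) ^ (-(n - i + 1))) =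
        ((q : ℂ) - (q : ℂ)⁻¹) * ((q : ℂ) ^ (n - 2 * i) - ((q : ℂ) ^ (n - 2 * i))⁻¹) := by
      have e : n - 2 * i = (n - i) - i := by ring
      rw [e]
      simp only [zpow_neg, zpow_add₀ hq, zpow_sub₀ hq, zpow_one]
      have h1 : (q : ℂ) ^ n ≠ 0 := zpow_ne_zero _ hq
      have h2 : (q : ℂ) ^ i ≠ 0 := zpow_ne_zero _ hq
      field_simp
      ring
    simp only [qnum, div_mul_div_comm]
    rw [← sub_div, key]
    field_simp

theorem spinE_mul_spinF (q s : ℂˣ) (hs : s ^ 2 = q) (n : ℕ) :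
    spinE q n * spinF q n - spinF q n * spinE q n =
      ((q : ℂ) - (q : ℂ)⁻¹)⁻¹ • (spinK s n ^ 2 - spinK s⁻¹ n ^ 2) := by
  refine LinearMap.ext fun v => funext fun i => ?_
  have hk : ((s : ℂ) ^ ((n : ℤ) - 2 * (i : ℕ))) * ((s : ℂ) ^ ((n : ℤ) - 2 * (i : ℕ))) =
      (q : ℂ) ^ ((n : ℤ) - 2 * (i : ℕ)) := by
    rw [← mul_zpow, ← hs, Units.val_pow_eq_pow_val, pow_two]
  have hR : (((q : ℂ) - (q : ℂ)⁻¹)⁻¹ • (spinK s n ^ 2 - spinK s⁻¹ n ^ 2)) v i =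
      (qnum q ((n : ℤ) - (i : ℕ)) * qnum q ((i : ℕ) + 1) -
        qnum q (i : ℕ) * qnum q ((n : ℤ) - (i : ℕ) + 1)) * v i := by
    rw [qnum_mul_sub, ← hk]
    simp only [spinK_apply, pow_two, LinearMap.smul_apply, LinearMap.sub_apply,
      Module.End.mul_apply, Pi.smul_apply, Pi.sub_apply, smul_eq_mul,
      Units.val_inv_eq_inv_val, inv_zpow, mul_inv]
    ring
  have h1 : (spinE q n * spinF q n) v i =
      qnum q ((n : ℤ) - (i : ℕ)) * qnum q ((i : ℕ) + 1) * v i := by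
    rw [Module.End.mul_apply]
    by_cases h : (i : ℕ) < n
    · rw [spinE_apply_of_lt _ _ _ _ h, spinF_apply_of_pos _ _ _ _ (Nat.succ_pos _)]
      simp [mul_assoc]
    · have e : (n : ℤ) - (i : ℕ) = 0 := by have := i.isLt; omega
      rw [spinE_apply_of_not_lt _ _ _ _ h, e, qnum_zero, zero_mul, zero_mul]
  have h2 : (spinF q n * spinE q n) v i =
      qnum q (i : ℕ) * qnum q ((n : ℤ) - (i : ℕ) + 1) * v i := by
    rw [Module.End.mul_apply]
    by_cases h : 0 < (i : ℕ)
    · have e : (i : ℕ) - 1 + 1 = i := by omega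
      have e' : (n : ℤ) - ((i : ℕ) - 1 : ℕ) = (n : ℤ) - (i : ℕ) + 1 := by omega
      have hlt : (i : ℕ) - 1 < n := by have := i.isLt; omega
      rw [spinF_apply_of_pos _ _ _ _ h, spinE_apply_of_lt _ _ _ _ hlt]
      simp only [e, e', mul_assoc]
    · have e : (i : ℕ) = 0 := by omega
      rw [spinF_apply_of_not_pos _ _ _ _ h, e, Nat.cast_zero, qnum_zero, zero_mul, zero_mul]
  rw [hR, LinearMap.sub_apply, Pi.sub_apply, h1, h2]
  ring

/-- The spin-`j` representation `π_j : U_q(sl₂) → End(M_j)`, where `n = 2j` and `s` is a square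
root of `q`, so that `q^m` stands for `s^{2m}` when `m` is a half-integer. -/
def spinRep (q s : ℂˣ) (hs : s ^ 2 = q) (n : ℕ) : Uq q →ₐ[ℂ] Module.End ℂ (SpinModule n) :=
  Uq.lift (spinE q n) (spinF q n) (spinK s n) (spinK s⁻¹ n)
    (spinK_mul_inv s n) (by simpa using spinK_mul_inv s⁻¹ n)
    (spinK_mul_spinE q s hs n) (spinK_mul_spinF q s hs n) (spinE_mul_spinF q s hs n)

/-- The space `M_{j₁} ⊗ M_{j₂} ⊗ M_{j₃}`, where `nᵢ = 2jᵢ`. -/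
abbrev SpinModule₃ (n₁ n₂ n₃ : ℕ) : Type :=
  (SpinModule n₁ ⊗[ℂ] SpinModule n₂) ⊗[ℂ] SpinModule n₃

/-- The representation `π_{j₁,j₂,j₃} = π_{j₁} ⊗ π_{j₂} ⊗ π_{j₃}` of `U_q(sl₂)^{⊗3}` on
`M_{j₁} ⊗ M_{j₂} ⊗ M_{j₃}`, where `nᵢ = 2jᵢ`. -/
def spinRep₃ (q s : ℂˣ) (hs : s ^ 2 = q) (n₁ n₂ n₃ : ℕ) :
    (Uq q ⊗[ℂ] Uq q) ⊗[ℂ] Uq q →ₐ[ℂ] Module.End ℂ (SpinModule₃ n₁ n₂ n₃) :=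
  (Module.endTensorEndAlgHom (R := ℂ) (S := ℂ) (A := ℂ)).comp
    (Algebra.TensorProduct.map
      ((Module.endTensorEndAlgHom (R := ℂ) (S := ℂ) (A := ℂ)).comp
        (Algebra.TensorProduct.map (spinRep q s hs n₁) (spinRep q s hs n₂)))
      (spinRep q s hs n₃))

/-- The centralizer `C_{j₁,j₂,j₃}` of the image of the diagonal embedding of `U_q(sl₂)` in
`End(M_{j₁} ⊗ M_{j₂} ⊗ M_{j₃})`, where `nᵢ = 2jᵢ`. -/
def spinCentralizer (q s : ℂˣ) (hs : s ^ 2 = q) (n₁ n₂ n₃ : ℕ) :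
    Subalgebra ℂ (Module.End ℂ (SpinModule₃ n₁ n₂ n₃)) :=
  Subalgebra.centralizer ℂ
    (Set.range fun x : Uq q => spinRep₃ q s hs n₁ n₂ n₃ (Uq.comul₂ q x))

/-! ### The centrally extended Askey–Wilson algebra -/

/-- Generators of `AW(3)`: `A`, `B`, `D`, `α₁`, `α₂`, `α₃` and `K`. -/
inductive AWGen : Type
  | A : AWGen
  | B : AWGen
  | D : AWGen
  | α₁ : AWGen
  | α₂ : AWGen
  | α₃ : AWGen
  | K : AWGen

/-- The `q`-commutator `[X, Y]_q = q X Y - q⁻¹ Y X`. -/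
def qcomm (q : ℂˣ) {R : Type*} [Ring R] [Algebra ℂ R] (X Y : R) : R :=
  (q : ℂ) • (X * Y) - (q : ℂ)⁻¹ • (Y * X)

section Relations

open FreeAlgebra AWGen

/-- Defining relations of `AW(3)`: the generators `α₁`, `α₂`, `α₃`, `K` are central, and
`A + [B, D]_q / (q² - q⁻²) = (α₁ α₂ + α₃ K) / (q + q⁻¹)`,
`B + [D, A]_q / (q² - q⁻²) = (α₂ α₃ + α₁ K) / (q + q⁻¹)`,
`D + [A, B]_q / (q² - q⁻²) = (α₁ α₃ + α₂ K) / (q + q⁻¹)`. -/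
inductive AWRel (q : ℂˣ) : FreeAlgebra ℂ AWGen → FreeAlgebra ℂ AWGen → Prop
  | central_α₁ (g : AWGen) : AWRel q (ι ℂ α₁ * ι ℂ g) (ι ℂ g * ι ℂ α₁)
  | central_α₂ (g : AWGen) : AWRel q (ι ℂ α₂ * ι ℂ g) (ι ℂ g * ι ℂ α₂)
  | central_α₃ (g : AWGen) : AWRel q (ι ℂ α₃ * ι ℂ g) (ι ℂ g * ι ℂ α₃)
  | central_K (g : AWGen) : AWRel q (ι ℂ K * ι ℂ g) (ι ℂ g * ι ℂ K)
  | rel_BD : AWRel q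
      (ι ℂ A + ((q : ℂ) ^ 2 - ((q : ℂ) ^ 2)⁻¹)⁻¹ • qcomm q (ι ℂ B) (ι ℂ D))
      (((q : ℂ) + (q : ℂ)⁻¹)⁻¹ • (ι ℂ α₁ * ι ℂ α₂ + ι ℂ α₃ * ι ℂ K))
  | rel_DA : AWRel q
      (ι ℂ B + ((q : ℂ) ^ 2 - ((q : ℂ) ^ 2)⁻¹)⁻¹ • qcomm q (ι ℂ D) (ι ℂ A))
      (((q : ℂ) + (q : ℂ)⁻¹)⁻¹ • (ι ℂ α₂ * ι ℂ α₃ + ι ℂ α₁ * ι ℂ K))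
  | rel_AB : AWRel q
      (ι ℂ D + ((q : ℂ) ^ 2 - ((q : ℂ) ^ 2)⁻¹)⁻¹ • qcomm q (ι ℂ A) (ι ℂ B))
      (((q : ℂ) + (q : ℂ)⁻¹)⁻¹ • (ι ℂ α₁ * ι ℂ α₃ + ι ℂ α₂ * ι ℂ K))

end Relations

/-- The centrally extended Askey–Wilson algebra `AW(3)`. -/
def AW (q : ℂˣ) : Type := RingQuot (AWRel q)

instance (q : ℂˣ) : Ring (AW q) := inferInstanceAs (Ring (RingQuot (AWRel q)))

instance (q : ℂˣ) : Algebra ℂ (AW q) := inferInstanceAs (Algebra ℂ (RingQuot (AWRel q)))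

/-- The class of a generator in `AW(3)`. -/
def AW.gen (q : ℂˣ) (g : AWGen) : AW q :=
  RingQuot.mkAlgHom ℂ (AWRel q) (FreeAlgebra.ι ℂ g)

end AskeyWilson

end

/-! Homomorphism. Each `C_i` acts by a scalar, and the third relation of `AW(3)` forces the image of
`D`. Substituting it into the other two relations leaves two cubic relations between `C₁₂` and
`C₂₃`, with `C₁₂₃` in the coefficients (`cubic_relation₁`, `cubic_relation₂`). Evaluated on `v_i ⊗
v_j ⊗ v_l` they are identities between rational functions of `q`, the `q^{j_a}` and `q^i`, `q^j`,
`q^l`.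

Surjectivity means that the algebra `𝒜` generated by `C₁₂`, `C₂₃`, `C₁₂₃` is the whole centralizer
`𝒞`. Complete reducibility is not invoked. Fix a level `k`, let `wt k` be spanned by the `v_i ⊗ v_j
⊗ v_l` with `i + j + l = k`, let `hw k` be its highest weight vectors and `G k = F (wt (k - 1))`. A
polynomial `T k` in `C₁₂₃` maps `wt k` into `hw k`, kills `G k`, and is a nonzero scalar on `hw k`
when `2k ≤ n₁ + n₂ + n₃` (`hwProj_mem`, `hwProj_of_mem_map`, `hwScalar_ne_zero`); for larger `k`
there are no highest weight vectors. So computations modulo `G k` transfer to `hw k`.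

Modulo `G k` the weight space is spanned by the vectors `v_0 ⊗ v_{k-l} ⊗ v_l`. On these `C₁₂` is
triangular with distinct relevant eigenvalues, while `C₂₃` is tridiagonal and its coefficient
towards smaller `l` does not vanish. Hence the image `x₁` of the vector with the largest `l` is an
eigenvector of `C₁₂` that generates `hw k` under `𝒜` (`exists_apply_topHw`), and the product `P` of
the linear factors of `C₁₂` at the other eigenvalues sends `hw k` into the line of `x₁`
(`exists_aeval_tailPoly`).

The contravariant form `β`, for which `E` and `F` are adjoint, makes the three generators
self-adjoint, so `𝒜` is closed under adjoints. For `y = f x₁` and `z = g x₁`, the element `g P f*`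
of `𝒜` is, after rescaling, the rank one operator `β(y, ·) z` on `hw k` (`exists_rankOne`). Sums of
these reproduce any element of `𝒞` on `hw k`, the operators `T k` combine the levels, and an element
of `𝒞` that kills all highest weight vectors is zero (`centralizer_eq_zero`).

That `q` is not a root of unity enters through `[m]_q ≠ 0` for `m ≠ 0` and through the fact that
`q^a + q^{-a}` determines `a` up to sign. -/

noncomputable section

namespace AskeyWilson

/-! ### The basis vectors with integer indices -/

/-- The basis vector `v_i` of the spin module, equal to zero when `i` is out of range. -/
def basisVec (n : ℕ) (i : ℤ) : SpinModule n := fun t => if ((t : ℕ) : ℤ) = i then 1 else 0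

theorem basisVec_eq_zero (n : ℕ) (i : ℤ) (h : i < 0 ∨ (n : ℤ) < i) : basisVec n i = 0 := by
  funext t
  have := t.isLt
  rw [basisVec, if_neg (by omega), Pi.zero_apply]

theorem basisVec_natCast (n : ℕ) (t : Fin (n + 1)) :
    basisVec n ((t : ℕ) : ℤ) = Pi.single t (1 : ℂ) := by
  funext t'
  simp [basisVec, Pi.single_apply, Fin.ext_iff]

/-- Since `[0]_q = 0` and vectors out of range vanish, one formula serves all integer indices. Later
computations therefore have no boundary cases. -/
theorem spinE_basisVec (q : ℂˣ) (n : ℕ) (i : ℤ) :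
    spinE q n (basisVec n i) = qnum q (n - i + 1) • basisVec n (i - 1) := by
  funext t
  rw [Pi.smul_apply, smul_eq_mul]
  by_cases h : (t : ℕ) < n
  · rw [spinE_apply_of_lt _ _ _ _ h]
    simp only [basisVec]
    by_cases h' : ((t : ℕ) : ℤ) = i - 1
    · rw [if_pos (by push_cast; omega), if_pos h', h']
      ring_nf
    · rw [if_neg (by push_cast; omega), if_neg h', mul_zero, mul_zero]
  · rw [spinE_apply_of_not_lt _ _ _ _ h]
    simp only [basisVec]
    split_ifs with h'
    · have : (n : ℤ) - i + 1 = 0 := by have := t.isLt; omega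
      rw [this, qnum_zero, zero_mul]
    · rw [mul_zero]

theorem spinF_basisVec (q : ℂˣ) (n : ℕ) (i : ℤ) :
    spinF q n (basisVec n i) = qnum q (i + 1) • basisVec n (i + 1) := by
  funext t
  rw [Pi.smul_apply, smul_eq_mul]
  by_cases h : 0 < (t : ℕ)
  · rw [spinF_apply_of_pos _ _ _ _ h]
    simp only [basisVec]
    by_cases h' : ((t : ℕ) : ℤ) = i + 1
    · rw [if_pos (by omega), if_pos h', h']
    · rw [if_neg (by omega), if_neg h', mul_zero, mul_zero]
  · rw [spinF_apply_of_not_pos _ _ _ _ h]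
    simp only [basisVec]
    split_ifs with h'
    · have : i + 1 = 0 := by omega
      rw [this, qnum_zero, zero_mul]
    · rw [mul_zero]

theorem spinK_basisVec (s : ℂˣ) (n : ℕ) (i : ℤ) :
    spinK s n (basisVec n i) = (s : ℂ) ^ ((n : ℤ) - 2 * i) • basisVec n i := by
  funext t
  rw [Pi.smul_apply, smul_eq_mul, spinK_apply]
  simp only [basisVec]
  split_ifs with h
  · rw [h]
  · rw [mul_zero, mul_zero]

theorem span_basisVec (n : ℕ) : Submodule.span ℂ (Set.range (basisVec n)) = ⊤ := by
  rw [eq_top_iff, ← (Pi.basisFun ℂ (Fin (n + 1))).span_eq, Submodule.span_le]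
  rintro _ ⟨t, rfl⟩
  refine Submodule.subset_span ⟨((t : ℕ) : ℤ), ?_⟩
  rw [basisVec_natCast, Pi.basisFun_apply]

/-- The vector `v_i ⊗ v_j ⊗ v_l`, equal to zero when an index is out of range. -/
def tensorVec (n₁ n₂ n₃ : ℕ) (i j l : ℤ) : SpinModule₃ n₁ n₂ n₃ :=
  (basisVec n₁ i ⊗ₜ basisVec n₂ j) ⊗ₜ basisVec n₃ l

section

variable {n₁ n₂ n₃ : ℕ}

theorem tensorVec_eq_zero₁ {i : ℤ} (h : i < 0 ∨ (n₁ : ℤ) < i) (j l : ℤ) :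
    tensorVec n₁ n₂ n₃ i j l = 0 := by
  rw [tensorVec, basisVec_eq_zero _ _ h, TensorProduct.zero_tmul, TensorProduct.zero_tmul]

theorem tensorVec_eq_zero₂ {j : ℤ} (h : j < 0 ∨ (n₂ : ℤ) < j) (i l : ℤ) :
    tensorVec n₁ n₂ n₃ i j l = 0 := by
  rw [tensorVec, basisVec_eq_zero _ _ h, TensorProduct.tmul_zero, TensorProduct.zero_tmul]

theorem tensorVec_eq_zero₃ {l : ℤ} (h : l < 0 ∨ (n₃ : ℤ) < l) (i j : ℤ) :
    tensorVec n₁ n₂ n₃ i j l = 0 := by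
  rw [tensorVec, basisVec_eq_zero _ _ h, TensorProduct.tmul_zero]

theorem span_tensorVec :
    Submodule.span ℂ {x | ∃ i j l, x = tensorVec n₁ n₂ n₃ i j l} = ⊤ := by
  rw [eq_top_iff]
  rintro x -
  induction x using TensorProduct.induction_on with
  | zero => exact zero_mem _
  | add x y hx hy => exact add_mem hx hy
  | tmul x z =>
    have hz : z ∈ Submodule.span ℂ (Set.range (basisVec n₃)) := by
      rw [span_basisVec]; trivial
    induction x using TensorProduct.induction_on with
    | zero => rw [TensorProduct.zero_tmul]; exact zero_mem _
    | add x y hx hy => rw [TensorProduct.add_tmul]; exact add_mem hx hy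
    | tmul x y =>
      have hx : x ∈ Submodule.span ℂ (Set.range (basisVec n₁)) := by
        rw [span_basisVec]; trivial
      have hy : y ∈ Submodule.span ℂ (Set.range (basisVec n₂)) := by
        rw [span_basisVec]; trivial
      have hxy := Submodule.apply_mem_map₂ (TensorProduct.mk ℂ _ _) hx hy
      rw [Submodule.map₂_span_span] at hxy
      have hxyz := Submodule.apply_mem_map₂ (TensorProduct.mk ℂ _ _) hxy hz
      rw [Submodule.map₂_span_span] at hxyz
      refine Submodule.span_mono ?_ hxyz
      rintro _ ⟨_, ⟨_, ⟨i, rfl⟩, _, ⟨j, rfl⟩, rfl⟩, _, ⟨l, rfl⟩, rfl⟩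
      exact ⟨i, j, l, rfl⟩

theorem end_ext_tensorVec {V : Type*} [AddCommGroup V] [Module ℂ V]
    {S T : SpinModule₃ n₁ n₂ n₃ →ₗ[ℂ] V}
    (h : ∀ i j l, S (tensorVec n₁ n₂ n₃ i j l) = T (tensorVec n₁ n₂ n₃ i j l)) : S = T := by
  refine LinearMap.ext_on span_tensorVec ?_
  rintro _ ⟨i, j, l, rfl⟩
  exact h i j l

end

/-! ### The embeddings of `U_q(sl₂)` -/

section Embeddings

variable (q s : ℂˣ) (hs : s ^ 2 = q) (n₁ n₂ n₃ : ℕ)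

/-- `x ↦ π(x ⊗ 1 ⊗ 1)`. -/
def rep₁ : Uq q →ₐ[ℂ] Module.End ℂ (SpinModule₃ n₁ n₂ n₃) :=
  (spinRep₃ q s hs n₁ n₂ n₃).comp
    (Algebra.TensorProduct.includeLeft.comp Algebra.TensorProduct.includeLeft)

/-- `x ↦ π(1 ⊗ x ⊗ 1)`. -/
def rep₂ : Uq q →ₐ[ℂ] Module.End ℂ (SpinModule₃ n₁ n₂ n₃) :=
  (spinRep₃ q s hs n₁ n₂ n₃).comp
    (Algebra.TensorProduct.includeLeft.comp Algebra.TensorProduct.includeRight)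

/-- `x ↦ π(1 ⊗ 1 ⊗ x)`. -/
def rep₃ : Uq q →ₐ[ℂ] Module.End ℂ (SpinModule₃ n₁ n₂ n₃) :=
  (spinRep₃ q s hs n₁ n₂ n₃).comp Algebra.TensorProduct.includeRight

/-- `x ↦ π(Δ(x) ⊗ 1)`. -/
def rep₁₂ : Uq q →ₐ[ℂ] Module.End ℂ (SpinModule₃ n₁ n₂ n₃) :=
  (spinRep₃ q s hs n₁ n₂ n₃).comp
    ((Algebra.TensorProduct.includeLeft (S := ℂ)).comp (Uq.comul q))

/-- `x ↦ π(1 ⊗ Δ(x))`. -/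
def rep₂₃ : Uq q →ₐ[ℂ] Module.End ℂ (SpinModule₃ n₁ n₂ n₃) :=
  (spinRep₃ q s hs n₁ n₂ n₃).comp
    ((Algebra.TensorProduct.assoc ℂ ℂ ℂ (Uq q) (Uq q) (Uq q)).symm.toAlgHom.comp
      (Algebra.TensorProduct.includeRight.comp (Uq.comul q)))

/-- `x ↦ π(Δ^{(2)}(x))`. -/
def rep₁₂₃ : Uq q →ₐ[ℂ] Module.End ℂ (SpinModule₃ n₁ n₂ n₃) :=
  (spinRep₃ q s hs n₁ n₂ n₃).comp (Uq.comul₂ q)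

variable {q s hs n₁ n₂ n₃}

theorem spinRep₃_tmul (x y z : Uq q) (u : SpinModule n₁) (v : SpinModule n₂)
    (w : SpinModule n₃) :
    spinRep₃ q s hs n₁ n₂ n₃ ((x ⊗ₜ y) ⊗ₜ z) ((u ⊗ₜ v) ⊗ₜ w) =
      (spinRep q s hs n₁ x u ⊗ₜ spinRep q s hs n₂ y v) ⊗ₜ spinRep q s hs n₃ z w :=
  rfl

theorem Uq.lift_gen {R : Type*} [Ring R] [Algebra ℂ R] (e f k k' : R)
    (hk : k * k' = 1) (hk' : k' * k = 1)
    (he : k * e = (q : ℂ) • (e * k)) (hf : k * f = (q : ℂ)⁻¹ • (f * k))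
    (hef : e * f - f * e = ((q : ℂ) - (q : ℂ)⁻¹)⁻¹ • (k ^ 2 - k' ^ 2)) :
    Uq.lift e f k k' hk hk' he hf hef (Uq.E q) = e ∧
    Uq.lift e f k k' hk hk' he hf hef (Uq.F q) = f ∧
    Uq.lift e f k k' hk hk' he hf hef (Uq.qH q) = k ∧
    Uq.lift e f k k' hk hk' he hf hef (Uq.qHinv q) = k' := by
  refine ⟨?_, ?_, ?_, ?_⟩ <;>
  · refine (RingQuot.liftAlgHom_mkAlgHom_apply ℂ _ _ _).trans ?_
    rw [FreeAlgebra.lift_ι_apply]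

theorem comul_E : Uq.comul q (Uq.E q) = Uq.E q ⊗ₜ Uq.qHinv q + Uq.qH q ⊗ₜ Uq.E q :=
  (Uq.lift_gen ..).1

theorem comul_F : Uq.comul q (Uq.F q) = Uq.F q ⊗ₜ Uq.qHinv q + Uq.qH q ⊗ₜ Uq.F q :=
  (Uq.lift_gen ..).2.1

theorem comul_qH : Uq.comul q (Uq.qH q) = Uq.qH q ⊗ₜ Uq.qH q :=
  (Uq.lift_gen ..).2.2.1

theorem comul_qHinv : Uq.comul q (Uq.qHinv q) = Uq.qHinv q ⊗ₜ Uq.qHinv q :=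
  (Uq.lift_gen ..).2.2.2

theorem spinRep_E (n : ℕ) : spinRep q s hs n (Uq.E q) = spinE q n :=
  (Uq.lift_gen ..).1

theorem spinRep_F (n : ℕ) : spinRep q s hs n (Uq.F q) = spinF q n :=
  (Uq.lift_gen ..).2.1

theorem spinRep_qH (n : ℕ) : spinRep q s hs n (Uq.qH q) = spinK s n :=
  (Uq.lift_gen ..).2.2.1

theorem spinRep_qHinv (n : ℕ) : spinRep q s hs n (Uq.qHinv q) = spinK s⁻¹ n :=
  (Uq.lift_gen ..).2.2.2

local notation "ρ₁" => rep₁ q s hs n₁ n₂ n₃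
local notation "ρ₂" => rep₂ q s hs n₁ n₂ n₃
local notation "ρ₃" => rep₃ q s hs n₁ n₂ n₃
local notation "ρ₁₂" => rep₁₂ q s hs n₁ n₂ n₃
local notation "ρ₂₃" => rep₂₃ q s hs n₁ n₂ n₃
local notation "ρ" => rep₁₂₃ q s hs n₁ n₂ n₃
local notation "e" => tensorVec n₁ n₂ n₃

theorem commute_rep₁_rep₂ (x y : Uq q) : Commute (ρ₁ x) (ρ₂ y) := by
  simp [Commute, SemiconjBy, rep₁, rep₂, ← map_mul]

theorem commute_rep₂_rep₃ (x y : Uq q) : Commute (ρ₂ x) (ρ₃ y) := by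
  simp [Commute, SemiconjBy, rep₂, rep₃, ← map_mul]

theorem commute_rep₁₂_rep₃ (x y : Uq q) : Commute (ρ₁₂ x) (ρ₃ y) := by
  simp [Commute, SemiconjBy, rep₁₂, rep₃, ← map_mul]

theorem commute_rep₁_rep₂₃ (x y : Uq q) : Commute (ρ₁ x) (ρ₂₃ y) := by
  have h : (x ⊗ₜ[ℂ] (1 : Uq q)) ⊗ₜ[ℂ] (1 : Uq q) =
      (Algebra.TensorProduct.assoc ℂ ℂ ℂ (Uq q) (Uq q) (Uq q)).symm (x ⊗ₜ 1) := by
    simp [Algebra.TensorProduct.one_def]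
  simp [Commute, SemiconjBy, rep₁, rep₂₃, ← map_mul, h]

theorem rep₁₂_E : ρ₁₂ (Uq.E q) = ρ₁ (Uq.E q) * ρ₂ (Uq.qHinv q) + ρ₁ (Uq.qH q) * ρ₂ (Uq.E q) := by
  simp [rep₁₂, rep₁, rep₂, comul_E, TensorProduct.add_tmul, ← map_mul]

theorem rep₁₂_F : ρ₁₂ (Uq.F q) = ρ₁ (Uq.F q) * ρ₂ (Uq.qHinv q) + ρ₁ (Uq.qH q) * ρ₂ (Uq.F q) := by
  simp [rep₁₂, rep₁, rep₂, comul_F, TensorProduct.add_tmul, ← map_mul]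

theorem rep₁₂_qH : ρ₁₂ (Uq.qH q) = ρ₁ (Uq.qH q) * ρ₂ (Uq.qH q) := by
  simp [rep₁₂, rep₁, rep₂, comul_qH, ← map_mul]

theorem rep₁₂_qHinv : ρ₁₂ (Uq.qHinv q) = ρ₁ (Uq.qHinv q) * ρ₂ (Uq.qHinv q) := by
  simp [rep₁₂, rep₁, rep₂, comul_qHinv, ← map_mul]

theorem rep₂₃_E : ρ₂₃ (Uq.E q) = ρ₂ (Uq.E q) * ρ₃ (Uq.qHinv q) + ρ₂ (Uq.qH q) * ρ₃ (Uq.E q) := by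
  simp [rep₂₃, rep₂, rep₃, comul_E, TensorProduct.tmul_add, ← map_mul]

theorem rep₂₃_F : ρ₂₃ (Uq.F q) = ρ₂ (Uq.F q) * ρ₃ (Uq.qHinv q) + ρ₂ (Uq.qH q) * ρ₃ (Uq.F q) := by
  simp [rep₂₃, rep₂, rep₃, comul_F, TensorProduct.tmul_add, ← map_mul]

theorem rep₂₃_qH : ρ₂₃ (Uq.qH q) = ρ₂ (Uq.qH q) * ρ₃ (Uq.qH q) := by
  simp [rep₂₃, rep₂, rep₃, comul_qH, ← map_mul]

theorem rep₂₃_qHinv : ρ₂₃ (Uq.qHinv q) = ρ₂ (Uq.qHinv q) * ρ₃ (Uq.qHinv q) := by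
  simp [rep₂₃, rep₂, rep₃, comul_qHinv, ← map_mul]

theorem rep₁₂₃_E :
    ρ (Uq.E q) = ρ₁₂ (Uq.E q) * ρ₃ (Uq.qHinv q) + ρ₁₂ (Uq.qH q) * ρ₃ (Uq.E q) := by
  simp [rep₁₂₃, rep₁₂, rep₃, Uq.comul₂, comul_E, ← map_mul]

theorem rep₁₂₃_F :
    ρ (Uq.F q) = ρ₁₂ (Uq.F q) * ρ₃ (Uq.qHinv q) + ρ₁₂ (Uq.qH q) * ρ₃ (Uq.F q) := by
  simp [rep₁₂₃, rep₁₂, rep₃, Uq.comul₂, comul_F, ← map_mul]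

theorem rep₁₂₃_qH : ρ (Uq.qH q) = ρ₁₂ (Uq.qH q) * ρ₃ (Uq.qH q) := by
  simp [rep₁₂₃, rep₁₂, rep₃, Uq.comul₂, comul_qH, ← map_mul]

theorem rep₁₂₃_qHinv : ρ (Uq.qHinv q) = ρ₁₂ (Uq.qHinv q) * ρ₃ (Uq.qHinv q) := by
  simp [rep₁₂₃, rep₁₂, rep₃, Uq.comul₂, comul_qHinv, ← map_mul]

/-- Coassociativity: grouping the last two factors, instead of the first two, is what makes `C₂₃`
visibly commute with the diagonal action. -/
theorem rep₁₂₃_E' :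
    ρ (Uq.E q) = ρ₁ (Uq.E q) * ρ₂₃ (Uq.qHinv q) + ρ₁ (Uq.qH q) * ρ₂₃ (Uq.E q) := by
  simp only [rep₁₂₃_E, rep₁₂_E, rep₁₂_qH, rep₂₃_E, rep₂₃_qHinv, add_mul, mul_add, mul_assoc,
    add_assoc]

theorem rep₁₂₃_F' :
    ρ (Uq.F q) = ρ₁ (Uq.F q) * ρ₂₃ (Uq.qHinv q) + ρ₁ (Uq.qH q) * ρ₂₃ (Uq.F q) := by
  simp only [rep₁₂₃_F, rep₁₂_F, rep₁₂_qH, rep₂₃_F, rep₂₃_qHinv, add_mul, mul_add, mul_assoc,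
    add_assoc]

theorem rep₁₂₃_qH' : ρ (Uq.qH q) = ρ₁ (Uq.qH q) * ρ₂₃ (Uq.qH q) := by
  rw [rep₁₂₃_qH, rep₁₂_qH, rep₂₃_qH, mul_assoc]

theorem rep₁₂₃_qHinv' : ρ (Uq.qHinv q) = ρ₁ (Uq.qHinv q) * ρ₂₃ (Uq.qHinv q) := by
  rw [rep₁₂₃_qHinv, rep₁₂_qHinv, rep₂₃_qHinv, mul_assoc]

theorem rep₁_apply (x : Uq q) (u : SpinModule n₁) (v : SpinModule n₂) (w : SpinModule n₃) :
    ρ₁ x ((u ⊗ₜ v) ⊗ₜ w) = (spinRep q s hs n₁ x u ⊗ₜ v) ⊗ₜ w := by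
  refine (spinRep₃_tmul x 1 1 u v w).trans ?_
  simp

theorem rep₂_apply (x : Uq q) (u : SpinModule n₁) (v : SpinModule n₂) (w : SpinModule n₃) :
    ρ₂ x ((u ⊗ₜ v) ⊗ₜ w) = (u ⊗ₜ spinRep q s hs n₂ x v) ⊗ₜ w := by
  refine (spinRep₃_tmul 1 x 1 u v w).trans ?_
  simp

theorem rep₃_apply (x : Uq q) (u : SpinModule n₁) (v : SpinModule n₂) (w : SpinModule n₃) :
    ρ₃ x ((u ⊗ₜ v) ⊗ₜ w) = (u ⊗ₜ v) ⊗ₜ spinRep q s hs n₃ x w := by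
  refine (spinRep₃_tmul 1 1 x u v w).trans ?_
  simp

variable (i j l : ℤ)

theorem rep₁_E_apply : ρ₁ (Uq.E q) (e i j l) = qnum q (n₁ - i + 1) • e (i - 1) j l := by
  rw [tensorVec, rep₁_apply, spinRep_E, spinE_basisVec, ← TensorProduct.smul_tmul',
    ← TensorProduct.smul_tmul']
  rfl

theorem rep₁_F_apply : ρ₁ (Uq.F q) (e i j l) = qnum q (i + 1) • e (i + 1) j l := by
  rw [tensorVec, rep₁_apply, spinRep_F, spinF_basisVec, ← TensorProduct.smul_tmul',
    ← TensorProduct.smul_tmul']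
  rfl

theorem rep₁_qH_apply : ρ₁ (Uq.qH q) (e i j l) = (s : ℂ) ^ ((n₁ : ℤ) - 2 * i) • e i j l := by
  rw [tensorVec, rep₁_apply, spinRep_qH, spinK_basisVec, ← TensorProduct.smul_tmul',
    ← TensorProduct.smul_tmul']

theorem rep₁_qHinv_apply :
    ρ₁ (Uq.qHinv q) (e i j l) = ((s : ℂ) ^ ((n₁ : ℤ) - 2 * i))⁻¹ • e i j l := by
  rw [tensorVec, rep₁_apply, spinRep_qHinv, spinK_basisVec, ← TensorProduct.smul_tmul',
    ← TensorProduct.smul_tmul', Units.val_inv_eq_inv_val, inv_zpow]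

theorem rep₂_E_apply : ρ₂ (Uq.E q) (e i j l) = qnum q (n₂ - j + 1) • e i (j - 1) l := by
  rw [tensorVec, rep₂_apply, spinRep_E, spinE_basisVec, TensorProduct.tmul_smul,
    ← TensorProduct.smul_tmul']
  rfl

theorem rep₂_F_apply : ρ₂ (Uq.F q) (e i j l) = qnum q (j + 1) • e i (j + 1) l := by
  rw [tensorVec, rep₂_apply, spinRep_F, spinF_basisVec, TensorProduct.tmul_smul,
    ← TensorProduct.smul_tmul']
  rfl

theorem rep₂_qH_apply : ρ₂ (Uq.qH q) (e i j l) = (s : ℂ) ^ ((n₂ : ℤ) - 2 * j) • e i j l := by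
  rw [tensorVec, rep₂_apply, spinRep_qH, spinK_basisVec, TensorProduct.tmul_smul,
    ← TensorProduct.smul_tmul']

theorem rep₂_qHinv_apply :
    ρ₂ (Uq.qHinv q) (e i j l) = ((s : ℂ) ^ ((n₂ : ℤ) - 2 * j))⁻¹ • e i j l := by
  rw [tensorVec, rep₂_apply, spinRep_qHinv, spinK_basisVec, TensorProduct.tmul_smul,
    ← TensorProduct.smul_tmul', Units.val_inv_eq_inv_val, inv_zpow]

theorem rep₃_E_apply : ρ₃ (Uq.E q) (e i j l) = qnum q (n₃ - l + 1) • e i j (l - 1) := by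
  rw [tensorVec, rep₃_apply, spinRep_E, spinE_basisVec, TensorProduct.tmul_smul]
  rfl

theorem rep₃_F_apply : ρ₃ (Uq.F q) (e i j l) = qnum q (l + 1) • e i j (l + 1) := by
  rw [tensorVec, rep₃_apply, spinRep_F, spinF_basisVec, TensorProduct.tmul_smul]
  rfl

theorem rep₃_qH_apply : ρ₃ (Uq.qH q) (e i j l) = (s : ℂ) ^ ((n₃ : ℤ) - 2 * l) • e i j l := by
  rw [tensorVec, rep₃_apply, spinRep_qH, spinK_basisVec, TensorProduct.tmul_smul]

theorem rep₃_qHinv_apply :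
    ρ₃ (Uq.qHinv q) (e i j l) = ((s : ℂ) ^ ((n₃ : ℤ) - 2 * l))⁻¹ • e i j l := by
  rw [tensorVec, rep₃_apply, spinRep_qHinv, spinK_basisVec, TensorProduct.tmul_smul,
    Units.val_inv_eq_inv_val, inv_zpow]

end Embeddings

end AskeyWilson

end

noncomputable section

namespace AskeyWilson

/-! ### The action of the intermediate Casimir elements -/

section Action

/-- `[i + 1]_q (q - q⁻¹)` as a function of `x = q^i`. -/
def raiseCoeff (q x : ℂ) : ℂ := q * x - (q * x)⁻¹

/-- `[2j - i + 1]_q (q - q⁻¹)` as a function of `m = q^j` and `x = q^i`. -/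
def lowerCoeff (q m x : ℂ) : ℂ := q * m ^ 2 / x - x / (q * m ^ 2)

/-- The eigenvalue of the Casimir element on the spin-`j` representation as a function of
`m = q^j`. -/
def casimirScalar (q m : ℂ) : ℂ := q * m ^ 2 + (q * m ^ 2)⁻¹

/-- The diagonal coefficient of the intermediate Casimir element of two tensor factors. -/
def diagCoeff (q m m' x y : ℂ) : ℂ :=
  casimirScalar q m * (y / m') ^ 2 + casimirScalar q m' * (m / x) ^ 2 -
    (q + q⁻¹) * (m / x) ^ 2 * (y / m') ^ 2

/-- The coefficient of `v_{i+1} ⊗ v_{j-1}` in the image of `v_i ⊗ v_j` under the intermediate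
Casimir element. -/
def leftCoeff (q m m' x y : ℂ) : ℂ :=
  raiseCoeff q x * lowerCoeff q m' y * (m / x) * (y / m') * q⁻¹

/-- The coefficient of `v_{i-1} ⊗ v_{j+1}` in the image of `v_i ⊗ v_j` under the intermediate
Casimir element. -/
def rightCoeff (q m m' x y : ℂ) : ℂ :=
  lowerCoeff q m x * raiseCoeff q y * (m / x) * (y / m') * q

variable {q s : ℂˣ} {hs : s ^ 2 = q} {n₁ n₂ n₃ : ℕ}

local notation "ρ₁" => rep₁ q s hs n₁ n₂ n₃
local notation "ρ₂" => rep₂ q s hs n₁ n₂ n₃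
local notation "ρ₃" => rep₃ q s hs n₁ n₂ n₃
local notation "ρ₁₂" => rep₁₂ q s hs n₁ n₂ n₃
local notation "ρ₂₃" => rep₂₃ q s hs n₁ n₂ n₃
local notation "ρ" => rep₁₂₃ q s hs n₁ n₂ n₃
local notation "e" => tensorVec n₁ n₂ n₃

theorem map_casimir {R : Type*} [Semiring R] [Algebra ℂ R] (f : Uq q →ₐ[ℂ] R) :
    f (Uq.casimir q) = ((q : ℂ) - (q : ℂ)⁻¹) ^ 2 • (f (Uq.F q) * f (Uq.E q)) +
      (q : ℂ) • f (Uq.qH q) ^ 2 + (q : ℂ)⁻¹ • f (Uq.qHinv q) ^ 2 := by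
  simp only [Uq.casimir, map_add, map_smul, map_mul, map_pow]

theorem zpow_weight (hs : s ^ 2 = q) (n : ℕ) (i : ℤ) :
    (s : ℂ) ^ ((n : ℤ) - 2 * i) = (s : ℂ) ^ n / (q : ℂ) ^ i := by
  rw [zpow_sub₀ s.ne_zero, zpow_natCast, ← hs, zpow_mul]
  norm_cast

theorem qnum_raise (q : ℂˣ) (i : ℤ) :
    qnum q (i + 1) = raiseCoeff q ((q : ℂ) ^ i) / ((q : ℂ) - (q : ℂ)⁻¹) := by
  rw [qnum, raiseCoeff, zpow_neg, zpow_add_one₀ q.ne_zero, mul_comm]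

theorem qnum_lower (hs : s ^ 2 = q) (n : ℕ) (i : ℤ) :
    qnum q (n - i + 1) =
      lowerCoeff q ((s : ℂ) ^ n) ((q : ℂ) ^ i) / ((q : ℂ) - (q : ℂ)⁻¹) := by
  have h : ((s : ℂ) ^ n) ^ 2 = (q : ℂ) ^ n := by
    rw [← hs, ← pow_mul, mul_comm, pow_mul]; norm_cast
  have h1 := q.ne_zero
  rw [qnum, lowerCoeff, zpow_neg, zpow_add_one₀ q.ne_zero, zpow_sub₀ q.ne_zero, h, zpow_natCast]
  congr 2
  · ring
  · rw [div_mul_eq_mul_div, inv_div, mul_comm]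

/-- The weights `s^{n-2i}` equal `s^n / q^i` and the `q`-numbers are rational in the same
quantities, so each coefficient is an identity of rational functions. -/
theorem rep₁₂_casimir_apply (hq : (q : ℂ) ^ 2 - 1 ≠ 0) (i j l : ℤ) :
    ρ₁₂ (Uq.casimir q) (e i j l) =
      diagCoeff q ((s : ℂ) ^ n₁) ((s : ℂ) ^ n₂) ((q : ℂ) ^ i) ((q : ℂ) ^ j) • e i j l +
      leftCoeff q ((s : ℂ) ^ n₁) ((s : ℂ) ^ n₂) ((q : ℂ) ^ i) ((q : ℂ) ^ j) •
        e (i + 1) (j - 1) l +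
      rightCoeff q ((s : ℂ) ^ n₁) ((s : ℂ) ^ n₂) ((q : ℂ) ^ i) ((q : ℂ) ^ j) •
        e (i - 1) (j + 1) l := by
  have h0 := q.ne_zero
  have hN := pow_ne_zero n₁ s.ne_zero
  have hN' := pow_ne_zero n₂ s.ne_zero
  have hX := zpow_ne_zero i h0
  have hY := zpow_ne_zero j h0
  simp only [map_casimir, rep₁₂_E, rep₁₂_F, rep₁₂_qH, rep₁₂_qHinv, pow_two, LinearMap.add_apply,
    LinearMap.smul_apply, Module.End.mul_apply, map_add, map_smul, rep₁_E_apply, rep₁_F_apply,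
    rep₁_qH_apply, rep₁_qHinv_apply, rep₂_E_apply, rep₂_F_apply, rep₂_qH_apply, rep₂_qHinv_apply,
    zpow_weight hs, qnum_raise, qnum_lower hs]
  simp only [sub_add_cancel, zpow_sub_one₀ h0, diagCoeff,
    leftCoeff, rightCoeff, raiseCoeff, lowerCoeff, casimirScalar]
  -- The relations between these powers are no longer needed; they are treated as independent
  -- nonzero variables.
  generalize (s : ℂ) ^ n₁ = N at *
  generalize (s : ℂ) ^ n₂ = N' at *
  generalize (q : ℂ) ^ i = X at *
  generalize (q : ℂ) ^ j = Y at *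
  generalize (q : ℂ) = Q at *
  match_scalars <;> field_simp <;> ring

theorem rep₂₃_casimir_apply (hq : (q : ℂ) ^ 2 - 1 ≠ 0) (i j l : ℤ) :
    ρ₂₃ (Uq.casimir q) (e i j l) =
      diagCoeff q ((s : ℂ) ^ n₂) ((s : ℂ) ^ n₃) ((q : ℂ) ^ j) ((q : ℂ) ^ l) • e i j l +
      leftCoeff q ((s : ℂ) ^ n₂) ((s : ℂ) ^ n₃) ((q : ℂ) ^ j) ((q : ℂ) ^ l) •
        e i (j + 1) (l - 1) +
      rightCoeff q ((s : ℂ) ^ n₂) ((s : ℂ) ^ n₃) ((q : ℂ) ^ j) ((q : ℂ) ^ l) •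
        e i (j - 1) (l + 1) := by
  have h0 := q.ne_zero
  have hN := pow_ne_zero n₂ s.ne_zero
  have hN' := pow_ne_zero n₃ s.ne_zero
  have hX := zpow_ne_zero j h0
  have hY := zpow_ne_zero l h0
  simp only [map_casimir, rep₂₃_E, rep₂₃_F, rep₂₃_qH, rep₂₃_qHinv, pow_two, LinearMap.add_apply,
    LinearMap.smul_apply, Module.End.mul_apply, map_add, map_smul, rep₂_E_apply, rep₂_F_apply,
    rep₂_qH_apply, rep₂_qHinv_apply, rep₃_E_apply, rep₃_F_apply, rep₃_qH_apply, rep₃_qHinv_apply,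
    zpow_weight hs, qnum_raise, qnum_lower hs]
  simp only [sub_add_cancel, zpow_sub_one₀ h0, diagCoeff,
    leftCoeff, rightCoeff, raiseCoeff, lowerCoeff, casimirScalar]
  generalize (s : ℂ) ^ n₂ = N at *
  generalize (s : ℂ) ^ n₃ = N' at *
  generalize (q : ℂ) ^ j = X at *
  generalize (q : ℂ) ^ l = Y at *
  generalize (q : ℂ) = Q at *
  match_scalars <;> field_simp <;> ring

theorem rep₁_casimir (hq : (q : ℂ) ^ 2 - 1 ≠ 0) :
    ρ₁ (Uq.casimir q) = casimirScalar q ((s : ℂ) ^ n₁) • 1 := by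
  refine end_ext_tensorVec (V := SpinModule₃ n₁ n₂ n₃) fun i j l => ?_
  have h0 := q.ne_zero
  have hN := pow_ne_zero n₁ s.ne_zero
  have hX := zpow_ne_zero i h0
  simp only [map_casimir, pow_two, LinearMap.add_apply, LinearMap.smul_apply,
    Module.End.mul_apply, Module.End.one_apply, map_smul, rep₁_E_apply, rep₁_F_apply,
    rep₁_qH_apply, rep₁_qHinv_apply, zpow_weight hs, qnum_raise, qnum_lower hs]
  simp only [sub_add_cancel, zpow_sub_one₀ h0, raiseCoeff, lowerCoeff, casimirScalar]
  generalize (s : ℂ) ^ n₁ = N at *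
  generalize (q : ℂ) ^ i = X at *
  generalize (q : ℂ) = Q at *
  match_scalars
  field_simp
  ring

theorem rep₂_casimir (hq : (q : ℂ) ^ 2 - 1 ≠ 0) :
    ρ₂ (Uq.casimir q) = casimirScalar q ((s : ℂ) ^ n₂) • 1 := by
  refine end_ext_tensorVec (V := SpinModule₃ n₁ n₂ n₃) fun i j l => ?_
  have h0 := q.ne_zero
  have hN := pow_ne_zero n₂ s.ne_zero
  have hX := zpow_ne_zero j h0
  simp only [map_casimir, pow_two, LinearMap.add_apply, LinearMap.smul_apply,
    Module.End.mul_apply, Module.End.one_apply, map_smul, rep₂_E_apply, rep₂_F_apply,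
    rep₂_qH_apply, rep₂_qHinv_apply, zpow_weight hs, qnum_raise, qnum_lower hs]
  simp only [sub_add_cancel, zpow_sub_one₀ h0, raiseCoeff, lowerCoeff, casimirScalar]
  generalize (s : ℂ) ^ n₂ = N at *
  generalize (q : ℂ) ^ j = X at *
  generalize (q : ℂ) = Q at *
  match_scalars
  field_simp
  ring

theorem rep₃_casimir (hq : (q : ℂ) ^ 2 - 1 ≠ 0) :
    ρ₃ (Uq.casimir q) = casimirScalar q ((s : ℂ) ^ n₃) • 1 := by
  refine end_ext_tensorVec (V := SpinModule₃ n₁ n₂ n₃) fun i j l => ?_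
  have h0 := q.ne_zero
  have hN := pow_ne_zero n₃ s.ne_zero
  have hX := zpow_ne_zero l h0
  simp only [map_casimir, pow_two, LinearMap.add_apply, LinearMap.smul_apply,
    Module.End.mul_apply, Module.End.one_apply, map_smul, rep₃_E_apply, rep₃_F_apply,
    rep₃_qH_apply, rep₃_qHinv_apply, zpow_weight hs, qnum_raise, qnum_lower hs]
  simp only [sub_add_cancel, zpow_sub_one₀ h0, raiseCoeff, lowerCoeff, casimirScalar]
  generalize (s : ℂ) ^ n₃ = N at *
  generalize (q : ℂ) ^ l = X at *
  generalize (q : ℂ) = Q at *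
  match_scalars
  field_simp
  ring

/-- The diagonal coefficient of the total Casimir element of three tensor factors. -/
def totalDiagCoeff (q m₁ m₂ m₃ x y z : ℂ) : ℂ :=
  casimirScalar q m₁ * (y / m₂) ^ 2 * (z / m₃) ^ 2 +
    casimirScalar q m₂ * (m₁ / x) ^ 2 * (z / m₃) ^ 2 +
    casimirScalar q m₃ * (m₁ / x) ^ 2 * (m₂ / y) ^ 2 -
    (q + q⁻¹) * (m₁ / x) ^ 2 * (z / m₃) ^ 2 * ((m₂ / y) ^ 2 + (y / m₂) ^ 2)

theorem rep₁₂₃_casimir_apply (hq : (q : ℂ) ^ 2 - 1 ≠ 0) (i j l : ℤ) :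
    ρ (Uq.casimir q) (e i j l) =
      totalDiagCoeff q ((s : ℂ) ^ n₁) ((s : ℂ) ^ n₂) ((s : ℂ) ^ n₃) ((q : ℂ) ^ i) ((q : ℂ) ^ j)
        ((q : ℂ) ^ l) • e i j l +
      (leftCoeff q ((s : ℂ) ^ n₁) ((s : ℂ) ^ n₂) ((q : ℂ) ^ i) ((q : ℂ) ^ j) *
        ((q : ℂ) ^ l / (s : ℂ) ^ n₃) ^ 2) • e (i + 1) (j - 1) l +
      (rightCoeff q ((s : ℂ) ^ n₁) ((s : ℂ) ^ n₂) ((q : ℂ) ^ i) ((q : ℂ) ^ j) *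
        ((q : ℂ) ^ l / (s : ℂ) ^ n₃) ^ 2) • e (i - 1) (j + 1) l +
      (((s : ℂ) ^ n₁ / (q : ℂ) ^ i) ^ 2 *
        leftCoeff q ((s : ℂ) ^ n₂) ((s : ℂ) ^ n₃) ((q : ℂ) ^ j) ((q : ℂ) ^ l)) •
        e i (j + 1) (l - 1) +
      (((s : ℂ) ^ n₁ / (q : ℂ) ^ i) ^ 2 *
        rightCoeff q ((s : ℂ) ^ n₂) ((s : ℂ) ^ n₃) ((q : ℂ) ^ j) ((q : ℂ) ^ l)) •
        e i (j - 1) (l + 1) +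
      leftCoeff q ((s : ℂ) ^ n₁) ((s : ℂ) ^ n₃) ((q : ℂ) ^ i) ((q : ℂ) ^ l) •
        e (i + 1) j (l - 1) +
      rightCoeff q ((s : ℂ) ^ n₁) ((s : ℂ) ^ n₃) ((q : ℂ) ^ i) ((q : ℂ) ^ l) •
        e (i - 1) j (l + 1) := by
  have h0 := q.ne_zero
  have hN₁ := pow_ne_zero n₁ s.ne_zero
  have hN₂ := pow_ne_zero n₂ s.ne_zero
  have hN₃ := pow_ne_zero n₃ s.ne_zero
  have hX := zpow_ne_zero i h0
  have hY := zpow_ne_zero j h0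
  have hZ := zpow_ne_zero l h0
  simp only [map_casimir, rep₁₂₃_E, rep₁₂₃_F, rep₁₂₃_qH, rep₁₂₃_qHinv, rep₁₂_E, rep₁₂_F,
    rep₁₂_qH, rep₁₂_qHinv, pow_two, LinearMap.add_apply, LinearMap.smul_apply,
    Module.End.mul_apply, map_add, map_smul, rep₁_E_apply, rep₁_F_apply, rep₁_qH_apply,
    rep₁_qHinv_apply, rep₂_E_apply, rep₂_F_apply, rep₂_qH_apply, rep₂_qHinv_apply,
    rep₃_E_apply, rep₃_F_apply, rep₃_qH_apply, rep₃_qHinv_apply,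
    zpow_weight hs, qnum_raise, qnum_lower hs]
  simp only [sub_add_cancel, zpow_sub_one₀ h0, totalDiagCoeff,
    leftCoeff, rightCoeff, raiseCoeff, lowerCoeff, casimirScalar]
  generalize (s : ℂ) ^ n₁ = N₁ at *
  generalize (s : ℂ) ^ n₂ = N₂ at *
  generalize (s : ℂ) ^ n₃ = N₃ at *
  generalize (q : ℂ) ^ i = X at *
  generalize (q : ℂ) ^ j = Y at *
  generalize (q : ℂ) ^ l = Z at *
  generalize (q : ℂ) = Q at *
  match_scalars <;> field_simp <;> ring

end Action

end AskeyWilson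

end

noncomputable section

namespace AskeyWilson

set_option maxSynthPendingDepth 3
-- The cubic Askey–Wilson relations
section AWRelations
variable {q s : ℂˣ} {hs : s ^ 2 = q} {n₁ n₂ n₃ : ℕ}

local notation "ρ₁₂" => rep₁₂ q s hs n₁ n₂ n₃
local notation "ρ₂₃" => rep₂₃ q s hs n₁ n₂ n₃
local notation "ρ" => rep₁₂₃ q s hs n₁ n₂ n₃

-- What the first defining relation of `AW(3)` becomes once `D` is eliminated by the third;
-- `cubic_relation₂` plays the same role for the second. It is checked by comparing coefficients on
-- basis vectors.
set_option maxHeartbeats 4000000 in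
theorem cubic_relation₁ (hq : (q : ℂ) ^ 2 - 1 ≠ 0) (A B C : Module.End ℂ (SpinModule₃ n₁ n₂ n₃))
    (hA : A = ρ₁₂ (Uq.casimir q)) (hB : B = ρ₂₃ (Uq.casimir q)) (hC : C = ρ (Uq.casimir q)) :
    ((q : ℂ) ^ 2 + ((q : ℂ) ^ 2)⁻¹) • (B * (A * B)) - B * (B * A) - A * (B * B) =
      ((q : ℂ) ^ 2 - ((q : ℂ) ^ 2)⁻¹) ^ 2 • A +
      ((q : ℂ) - (q : ℂ)⁻¹) ^ 2 •
        ((casimirScalar q ((s : ℂ) ^ n₁) * casimirScalar q ((s : ℂ) ^ n₃)) • B +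
          casimirScalar q ((s : ℂ) ^ n₂) • (C * B)) -
      (((q : ℂ) - (q : ℂ)⁻¹) ^ 2 * ((q : ℂ) + (q : ℂ)⁻¹)) •
        ((casimirScalar q ((s : ℂ) ^ n₁) * casimirScalar q ((s : ℂ) ^ n₂)) • 1 +
          casimirScalar q ((s : ℂ) ^ n₃) • C) := by
  refine end_ext_tensorVec (V := SpinModule₃ n₁ n₂ n₃) fun i j l => ?_
  have h0 := q.ne_zero
  have hN₁ := pow_ne_zero n₁ s.ne_zero
  have hN₂ := pow_ne_zero n₂ s.ne_zero
  have hN₃ := pow_ne_zero n₃ s.ne_zero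
  have hX := zpow_ne_zero i h0
  have hY := zpow_ne_zero j h0
  have hZ := zpow_ne_zero l h0
  simp only [hA, hB, hC, LinearMap.add_apply, LinearMap.sub_apply, LinearMap.smul_apply,
    Module.End.mul_apply, Module.End.one_apply, map_add, map_smul, rep₁₂_casimir_apply hq,
    rep₂₃_casimir_apply hq, rep₁₂₃_casimir_apply hq]
  simp only [sub_add_cancel, add_sub_cancel_right, zpow_sub_one₀ h0, zpow_add_one₀ h0, diagCoeff,
    totalDiagCoeff, leftCoeff, rightCoeff, raiseCoeff, lowerCoeff, casimirScalar]
  generalize (s : ℂ) ^ n₁ = N₁ at *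
  generalize (s : ℂ) ^ n₂ = N₂ at *
  generalize (s : ℂ) ^ n₃ = N₃ at *
  generalize (q : ℂ) ^ i = X at *
  generalize (q : ℂ) ^ j = Y at *
  generalize (q : ℂ) ^ l = Z at *
  generalize (q : ℂ) = Q at *
  match_scalars
  all_goals field_simp
  all_goals ring
set_option maxHeartbeats 4000000 in
theorem cubic_relation₂ (hq : (q : ℂ) ^ 2 - 1 ≠ 0) (A B C : Module.End ℂ (SpinModule₃ n₁ n₂ n₃))
    (hA : A = ρ₁₂ (Uq.casimir q)) (hB : B = ρ₂₃ (Uq.casimir q)) (hC : C = ρ (Uq.casimir q)) :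
    ((q : ℂ) ^ 2 + ((q : ℂ) ^ 2)⁻¹) • (A * (B * A)) - A * (A * B) - B * (A * A) =
      ((q : ℂ) ^ 2 - ((q : ℂ) ^ 2)⁻¹) ^ 2 • B +
      ((q : ℂ) - (q : ℂ)⁻¹) ^ 2 •
        ((casimirScalar q ((s : ℂ) ^ n₁) * casimirScalar q ((s : ℂ) ^ n₃)) • A +
          casimirScalar q ((s : ℂ) ^ n₂) • (C * A)) -
      (((q : ℂ) - (q : ℂ)⁻¹) ^ 2 * ((q : ℂ) + (q : ℂ)⁻¹)) •
        ((casimirScalar q ((s : ℂ) ^ n₂) * casimirScalar q ((s : ℂ) ^ n₃)) • 1 +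
          casimirScalar q ((s : ℂ) ^ n₁) • C) := by
  refine end_ext_tensorVec (V := SpinModule₃ n₁ n₂ n₃) fun i j l => ?_
  have h0 := q.ne_zero
  have hN₁ := pow_ne_zero n₁ s.ne_zero
  have hN₂ := pow_ne_zero n₂ s.ne_zero
  have hN₃ := pow_ne_zero n₃ s.ne_zero
  have hX := zpow_ne_zero i h0
  have hY := zpow_ne_zero j h0
  have hZ := zpow_ne_zero l h0
  simp only [hA, hB, hC, LinearMap.add_apply, LinearMap.sub_apply, LinearMap.smul_apply,
    Module.End.mul_apply, Module.End.one_apply, map_add, map_smul, rep₁₂_casimir_apply hq,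
    rep₂₃_casimir_apply hq, rep₁₂₃_casimir_apply hq]
  simp only [sub_add_cancel, add_sub_cancel_right, zpow_sub_one₀ h0, zpow_add_one₀ h0, diagCoeff,
    totalDiagCoeff, leftCoeff, rightCoeff, raiseCoeff, lowerCoeff, casimirScalar]
  generalize (s : ℂ) ^ n₁ = N₁ at *
  generalize (s : ℂ) ^ n₂ = N₂ at *
  generalize (s : ℂ) ^ n₃ = N₃ at *
  generalize (q : ℂ) ^ i = X at *
  generalize (q : ℂ) ^ j = Y at *
  generalize (q : ℂ) ^ l = Z at *
  generalize (q : ℂ) = Q at *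
  match_scalars
  all_goals field_simp
  all_goals ring
end AWRelations
end AskeyWilson

end

noncomputable section

namespace AskeyWilson

/-! ### Centrality of the Casimir element -/

theorem Uq.adjoin_gen (q : ℂˣ) :
    Algebra.adjoin ℂ {Uq.E q, Uq.F q, Uq.qH q, Uq.qHinv q} = ⊤ := by
  have h1 : (RingQuot.mkAlgHom ℂ (UqRel q)).range = ⊤ :=
    (AlgHom.range_eq_top _).2 (RingQuot.mkAlgHom_surjective ℂ _)
  have h2 : Algebra.adjoin ℂ (Set.range (FreeAlgebra.ι ℂ (X := UqGen))) = ⊤ :=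
    FreeAlgebra.adjoin_range_ι ℂ UqGen
  rw [← Algebra.map_top, ← h2, AlgHom.map_adjoin] at h1
  refine top_le_iff.1 (h1.ge.trans (Algebra.adjoin_mono ?_))
  rintro _ ⟨_, ⟨g, rfl⟩, rfl⟩
  cases g
  · exact Or.inl rfl
  · exact Or.inr (Or.inl rfl)
  · exact Or.inr (Or.inr (Or.inl rfl))
  · exact Or.inr (Or.inr (Or.inr rfl))

theorem Uq.commute_of_generators {q : ℂˣ} {R : Type*} [Ring R] [Algebra ℂ R] (f : Uq q →ₐ[ℂ] R)
    {y : R} (hE : Commute y (f (Uq.E q))) (hF : Commute y (f (Uq.F q)))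
    (hK : Commute y (f (Uq.qH q))) (hK' : Commute y (f (Uq.qHinv q))) (x : Uq q) :
    Commute y (f x) := by
  have hx : x ∈ Algebra.adjoin ℂ {Uq.E q, Uq.F q, Uq.qH q, Uq.qHinv q} := by
    rw [Uq.adjoin_gen]; trivial
  induction hx using Algebra.adjoin_induction with
  | mem x hx =>
    rcases hx with rfl | rfl | rfl | rfl
    exacts [hE, hF, hK, hK']
  | algebraMap r => rw [AlgHom.commutes]; exact (Algebra.commutes r y).symm
  | add x y _ _ hx hy => rw [map_add]; exact hx.add_right hy
  | mul x y _ _ hx hy => rw [map_mul]; exact hx.mul_right hy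

theorem Uq.casimir_eq {q : ℂˣ} (hq : (q : ℂ) ^ 2 - 1 ≠ 0) :
    Uq.casimir q = ((q : ℂ) - (q : ℂ)⁻¹) ^ 2 • (Uq.E q * Uq.F q) +
      (q : ℂ)⁻¹ • Uq.qH q ^ 2 + (q : ℂ) • Uq.qHinv q ^ 2 := by
  have h : Uq.E q * Uq.F q = Uq.F q * Uq.E q +
      ((q : ℂ) - (q : ℂ)⁻¹)⁻¹ • (Uq.qH q ^ 2 - Uq.qHinv q ^ 2) := by
    rw [← Uq.comm_E_F]; abel
  have h0 := q.ne_zero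
  rw [h, Uq.casimir]
  match_scalars <;> field_simp <;> ring

/-- With the `EF` form of `Γ` on one side and the `FE` form on the other, the cubic terms in `Γ E =
E Γ` and `Γ F = F Γ` agree by associativity. Only the terms in `q^{±2H}` remain to be compared. -/
theorem Uq.casimir_commute {q : ℂˣ} (hq : (q : ℂ) ^ 2 - 1 ≠ 0) (x : Uq q) :
    Commute (Uq.casimir q) x := by
  have h0 := q.ne_zero
  have hKE := Uq.qH_mul_E q
  have hKF := Uq.qH_mul_F q
  have hEK' := Uq.E_mul_qHinv q
  have hFK' := Uq.F_mul_qHinv q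
  have hEK : Uq.E q * Uq.qH q = (q : ℂ)⁻¹ • (Uq.qH q * Uq.E q) := by
    rw [hKE, smul_smul, inv_mul_cancel₀ h0, one_smul]
  have hFK : Uq.F q * Uq.qH q = (q : ℂ) • (Uq.qH q * Uq.F q) := by
    rw [hKF, smul_smul, mul_inv_cancel₀ h0, one_smul]
  refine Uq.commute_of_generators (AlgHom.id ℂ (Uq q)) (y := Uq.casimir q) ?_ ?_ ?_ ?_ x
  · change Uq.casimir q * Uq.E q = Uq.E q * Uq.casimir q
    nth_rewrite 1 [Uq.casimir_eq hq]
    rw [Uq.casimir]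
    simp only [pow_two, add_mul, mul_add, smul_mul_assoc, mul_smul_comm, ← mul_assoc]
    simp only [mul_assoc, hEK']
    simp only [← mul_assoc, hEK, smul_mul_assoc]
    simp only [mul_assoc, hEK', hEK, mul_smul_comm]
    match_scalars <;> field_simp
  · change Uq.casimir q * Uq.F q = Uq.F q * Uq.casimir q
    nth_rewrite 2 [Uq.casimir_eq hq]
    rw [Uq.casimir]
    simp only [pow_two, add_mul, mul_add, smul_mul_assoc, mul_smul_comm, ← mul_assoc]
    simp only [← mul_assoc, hFK, hFK', smul_mul_assoc, mul_smul_comm]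
    simp only [mul_assoc, hFK', hFK, mul_smul_comm]
    match_scalars <;> field_simp
  · change Uq.casimir q * Uq.qH q = Uq.qH q * Uq.casimir q
    have h1 : Uq.F q * Uq.E q * Uq.qH q = Uq.qH q * (Uq.F q * Uq.E q) := by
      rw [mul_assoc, hEK, mul_smul_comm, ← mul_assoc, hFK, smul_mul_assoc, smul_smul,
        inv_mul_cancel₀ h0, one_smul, mul_assoc]
    simp only [Uq.casimir, add_mul, mul_add, smul_mul_assoc, mul_smul_comm, h1, pow_two,
      mul_assoc, Uq.qHinv_mul_qH]
    simp only [← mul_assoc, Uq.qH_mul_qHinv, one_mul, mul_one]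
  · change Uq.casimir q * Uq.qHinv q = Uq.qHinv q * Uq.casimir q
    have h1 : Uq.F q * Uq.E q * Uq.qHinv q = Uq.qHinv q * (Uq.F q * Uq.E q) := by
      rw [mul_assoc, hEK', mul_smul_comm, ← mul_assoc, hFK', smul_mul_assoc, smul_smul,
        mul_inv_cancel₀ h0, one_smul, mul_assoc]
    simp only [Uq.casimir, add_mul, mul_add, smul_mul_assoc, mul_smul_comm, h1, pow_two,
      mul_assoc, Uq.qH_mul_qHinv]
    simp only [← mul_assoc, Uq.qHinv_mul_qH, one_mul, mul_one]

set_option maxSynthPendingDepth 3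

/-! ### Casimir elements in the centralizer and maps out of `AW(3)` -/

section Homomorphism

variable {q s : ℂˣ} {hs : s ^ 2 = q} {n₁ n₂ n₃ : ℕ}

local notation "ρ₁" => rep₁ q s hs n₁ n₂ n₃
local notation "ρ₃" => rep₃ q s hs n₁ n₂ n₃
local notation "ρ₁₂" => rep₁₂ q s hs n₁ n₂ n₃
local notation "ρ₂₃" => rep₂₃ q s hs n₁ n₂ n₃
local notation "ρ" => rep₁₂₃ q s hs n₁ n₂ n₃

theorem mem_spinCentralizer_iff {y : Module.End ℂ (SpinModule₃ n₁ n₂ n₃)} :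
    y ∈ spinCentralizer q s hs n₁ n₂ n₃ ↔ ∀ x, Commute y (ρ x) := by
  rw [spinCentralizer, Subalgebra.mem_centralizer_iff]
  constructor
  · exact fun h x => (h _ ⟨x, rfl⟩).symm
  · rintro h _ ⟨x, rfl⟩
    exact (h x).symm

theorem commute_rep₁₂_casimir (hq : (q : ℂ) ^ 2 - 1 ≠ 0) (x : Uq q) :
    Commute (ρ₁₂ (Uq.casimir q)) (ρ x) := by
  have h (y : Uq q) : Commute (ρ₁₂ (Uq.casimir q)) (ρ₁₂ y) :=
    (Uq.casimir_commute hq y).map ρ₁₂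
  have h' (y : Uq q) : Commute (ρ₁₂ (Uq.casimir q)) (ρ₃ y) := commute_rep₁₂_rep₃ _ _
  refine Uq.commute_of_generators ρ ?_ ?_ ?_ ?_ x
  · rw [rep₁₂₃_E]
    exact ((h _).mul_right (h' _)).add_right ((h _).mul_right (h' _))
  · rw [rep₁₂₃_F]
    exact ((h _).mul_right (h' _)).add_right ((h _).mul_right (h' _))
  · rw [rep₁₂₃_qH]
    exact (h _).mul_right (h' _)
  · rw [rep₁₂₃_qHinv]
    exact (h _).mul_right (h' _)

theorem commute_rep₂₃_casimir (hq : (q : ℂ) ^ 2 - 1 ≠ 0) (x : Uq q) :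
    Commute (ρ₂₃ (Uq.casimir q)) (ρ x) := by
  have h (y : Uq q) : Commute (ρ₂₃ (Uq.casimir q)) (ρ₂₃ y) :=
    (Uq.casimir_commute hq y).map ρ₂₃
  have h' (y : Uq q) : Commute (ρ₂₃ (Uq.casimir q)) (ρ₁ y) := (commute_rep₁_rep₂₃ _ _).symm
  refine Uq.commute_of_generators ρ ?_ ?_ ?_ ?_ x
  · rw [rep₁₂₃_E']
    exact ((h' _).mul_right (h _)).add_right ((h' _).mul_right (h _))
  · rw [rep₁₂₃_F']
    exact ((h' _).mul_right (h _)).add_right ((h' _).mul_right (h _))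
  · rw [rep₁₂₃_qH']
    exact (h' _).mul_right (h _)
  · rw [rep₁₂₃_qHinv']
    exact (h' _).mul_right (h _)

theorem commute_rep₁₂₃_casimir (hq : (q : ℂ) ^ 2 - 1 ≠ 0) (x : Uq q) :
    Commute (ρ (Uq.casimir q)) (ρ x) :=
  (Uq.casimir_commute hq x).map ρ

theorem adjoin_le_spinCentralizer (hq : (q : ℂ) ^ 2 - 1 ≠ 0) :
    Algebra.adjoin ℂ {ρ₁₂ (Uq.casimir q), ρ₂₃ (Uq.casimir q), ρ (Uq.casimir q)} ≤
      spinCentralizer q s hs n₁ n₂ n₃ := by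
  rw [Algebra.adjoin_le_iff]
  rintro _ (rfl | rfl | rfl)
  · exact mem_spinCentralizer_iff.2 (commute_rep₁₂_casimir hq)
  · exact mem_spinCentralizer_iff.2 (commute_rep₂₃_casimir hq)
  · exact mem_spinCentralizer_iff.2 (commute_rep₁₂₃_casimir hq)

/-- Elements `A`, `B` and central elements of an algebra satisfying the cubic Askey–Wilson relations
define a homomorphism out of `AW(3)`. -/
theorem exists_AW_hom {R : Type*} [Ring R] [Algebra ℂ R] (hq : (q : ℂ) ^ 4 - 1 ≠ 0)
    (A B C : R) (c₁ c₂ c₃ : ℂ) (hA : Commute C A) (hB : Commute C B)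
    (h₁ : ((q : ℂ) ^ 2 + ((q : ℂ) ^ 2)⁻¹) • (B * (A * B)) - B * (B * A) - A * (B * B) =
      ((q : ℂ) ^ 2 - ((q : ℂ) ^ 2)⁻¹) ^ 2 • A +
      ((q : ℂ) - (q : ℂ)⁻¹) ^ 2 • ((c₁ * c₃) • B + c₂ • (C * B)) -
      (((q : ℂ) - (q : ℂ)⁻¹) ^ 2 * ((q : ℂ) + (q : ℂ)⁻¹)) • ((c₁ * c₂) • 1 + c₃ • C))
    (h₂ : ((q : ℂ) ^ 2 + ((q : ℂ) ^ 2)⁻¹) • (A * (B * A)) - A * (A * B) - B * (A * A) =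
      ((q : ℂ) ^ 2 - ((q : ℂ) ^ 2)⁻¹) ^ 2 • B +
      ((q : ℂ) - (q : ℂ)⁻¹) ^ 2 • ((c₁ * c₃) • A + c₂ • (C * A)) -
      (((q : ℂ) - (q : ℂ)⁻¹) ^ 2 * ((q : ℂ) + (q : ℂ)⁻¹)) • ((c₂ * c₃) • 1 + c₁ • C)) :
    ∃ φ : AW q →ₐ[ℂ] R, φ (AW.gen q .α₁) = c₁ • 1 ∧ φ (AW.gen q .α₂) = c₂ • 1 ∧
      φ (AW.gen q .α₃) = c₃ • 1 ∧ φ (AW.gen q .A) = A ∧ φ (AW.gen q .B) = B ∧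
      φ (AW.gen q .K) = C := by
  have h0 := q.ne_zero
  have e4 : (q : ℂ) ^ 4 - 1 = ((q : ℂ) ^ 2 - 1) * ((q : ℂ) ^ 2 + 1) := by ring
  have hq1 := left_ne_zero_of_mul (e4 ▸ hq)
  have hq2 := right_ne_zero_of_mul (e4 ▸ hq)
  have hq3 : (q : ℂ) ^ 2 - ((q : ℂ) ^ 2)⁻¹ ≠ 0 := by
    have : (q : ℂ) ^ 2 - ((q : ℂ) ^ 2)⁻¹ =
      ((q : ℂ) ^ 2 - 1) * ((q : ℂ) ^ 2 + 1) / (q : ℂ) ^ 2 := by field_simp; ring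
    rw [this]
    positivity
  have hq4 : (q : ℂ) + (q : ℂ)⁻¹ ≠ 0 := by
    have : (q : ℂ) + (q : ℂ)⁻¹ = ((q : ℂ) ^ 2 + 1) / (q : ℂ) := by field_simp
    rw [this]
    positivity
  -- The value forced by the third relation, which makes that relation automatic.
  set D : R := ((q : ℂ) + (q : ℂ)⁻¹)⁻¹ • ((c₁ * c₃) • 1 + c₂ • C) -
    ((q : ℂ) ^ 2 - ((q : ℂ) ^ 2)⁻¹)⁻¹ • qcomm q A B with hD
  have hCD : Commute C D := by
    refine (Commute.smul_right ?_ _).sub_right (Commute.smul_right ?_ _)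
    · exact ((Commute.one_right C).smul_right _).add_right ((Commute.refl C).smul_right _)
    · exact ((hA.mul_right hB).smul_right _).sub_right ((hB.mul_right hA).smul_right _)
  let f : FreeAlgebra ℂ AWGen →ₐ[ℂ] R := FreeAlgebra.lift ℂ fun g => match g with
    | .A => A
    | .B => B
    | .D => D
    | .α₁ => c₁ • 1
    | .α₂ => c₂ • 1
    | .α₃ => c₃ • 1
    | .K => C
  have hf : ∀ ⦃x y⦄, AWRel q x y → f x = f y := by
    rintro _ _ (g | g | g | g | _ | _ | _)
    · simp [f]
    · simp [f]
    · simp [f]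
    -- The images of the `α_i` are scalars, so among the central generators only `K` uses the
    -- commutation hypotheses.
    · simp only [f, map_mul, FreeAlgebra.lift_ι_apply]
      cases g
      · exact hA
      · exact hB
      · exact hCD
      · simp
      · simp
      · simp
      · rfl
    · simp only [f, qcomm, map_add, map_sub, map_mul, map_smul, FreeAlgebra.lift_ι_apply]
      have hBC : B * C = C * B := hB.eq.symm
      -- The cubic relation solved for one monomial serves as a rewrite rule. After expanding `D`,
      -- the remaining monomials are compared as if independent.
      have key : A * (B * B) = ((q : ℂ) ^ 2 + ((q : ℂ) ^ 2)⁻¹) • (B * (A * B)) - B * (B * A) -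
          (((q : ℂ) ^ 2 - ((q : ℂ) ^ 2)⁻¹) ^ 2 • A +
          ((q : ℂ) - (q : ℂ)⁻¹) ^ 2 • ((c₁ * c₃) • B + c₂ • (C * B)) -
          (((q : ℂ) - (q : ℂ)⁻¹) ^ 2 * ((q : ℂ) + (q : ℂ)⁻¹)) •
            ((c₁ * c₂) • 1 + c₃ • C)) := by
        rw [← h₁]; abel
      simp only [hD, qcomm, mul_sub, sub_mul, mul_add, add_mul, smul_mul_assoc, mul_smul_comm,
        mul_assoc, hBC, mul_one, one_mul, key]
      match_scalars <;> field_simp <;> ring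
    · simp only [f, qcomm, map_add, map_sub, map_mul, map_smul, FreeAlgebra.lift_ι_apply]
      have hAC : A * C = C * A := hA.eq.symm
      have key : B * (A * A) = ((q : ℂ) ^ 2 + ((q : ℂ) ^ 2)⁻¹) • (A * (B * A)) - A * (A * B) -
          (((q : ℂ) ^ 2 - ((q : ℂ) ^ 2)⁻¹) ^ 2 • B +
          ((q : ℂ) - (q : ℂ)⁻¹) ^ 2 • ((c₁ * c₃) • A + c₂ • (C * A)) -
          (((q : ℂ) - (q : ℂ)⁻¹) ^ 2 * ((q : ℂ) + (q : ℂ)⁻¹)) •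
            ((c₂ * c₃) • 1 + c₁ • C)) := by
        rw [← h₂]; abel
      simp only [hD, qcomm, mul_sub, sub_mul, mul_add, add_mul, smul_mul_assoc, mul_smul_comm,
        mul_assoc, hAC, mul_one, one_mul, key]
      match_scalars <;> field_simp <;> ring
    · simp only [f, qcomm, map_add, map_sub, map_mul, map_smul, FreeAlgebra.lift_ι_apply]
      rw [hD]
      simp [qcomm, smul_smul, mul_comm]
  refine ⟨RingQuot.liftAlgHom ℂ ⟨f, hf⟩, ?_, ?_, ?_, ?_, ?_, ?_⟩ <;>
  · refine (RingQuot.liftAlgHom_mkAlgHom_apply ℂ _ _ _).trans ?_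
    simp [f]

end Homomorphism

end AskeyWilson

end

noncomputable section

namespace AskeyWilson

set_option maxSynthPendingDepth 3

/-! ### The contravariant form -/

/-! ### Quantum integers and factorials when `q` is not a root of unity -/

theorem zpow_ne_one {q : ℂˣ} (hq : ∀ m : ℕ, 0 < m → q ^ m ≠ 1) {a : ℤ} (ha : a ≠ 0) :
    (q : ℂ) ^ a ≠ 1 := by
  intro h
  have h1 : q ^ a = 1 := Units.ext (by push_cast; exact h)
  refine hq a.natAbs (Int.natAbs_pos.2 ha) ?_
  rcases Int.natAbs_eq a with h' | h'
  · rw [h', zpow_natCast] at h1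
    exact h1
  · rw [h', zpow_neg, inv_eq_one, zpow_natCast] at h1
    exact h1

theorem sq_sub_one_ne_zero {q : ℂˣ} (hq : ∀ m : ℕ, 0 < m → q ^ m ≠ 1) : (q : ℂ) ^ 2 - 1 ≠ 0 := by
  have := zpow_ne_one hq (a := 2) (by norm_num)
  rw [sub_ne_zero]
  exact_mod_cast this

theorem pow_four_sub_one_ne_zero {q : ℂˣ} (hq : ∀ m : ℕ, 0 < m → q ^ m ≠ 1) :
    (q : ℂ) ^ 4 - 1 ≠ 0 := by
  have := zpow_ne_one hq (a := 4) (by norm_num)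
  rw [sub_ne_zero]
  exact_mod_cast this

theorem sub_inv_ne_zero {q : ℂˣ} (hq : ∀ m : ℕ, 0 < m → q ^ m ≠ 1) :
    (q : ℂ) - (q : ℂ)⁻¹ ≠ 0 := by
  have h := sq_sub_one_ne_zero hq
  have h0 := q.ne_zero
  have : (q : ℂ) - (q : ℂ)⁻¹ = ((q : ℂ) ^ 2 - 1) / q := by field_simp
  rw [this]
  exact div_ne_zero h h0

theorem qnum_ne_zero {q : ℂˣ} (hq : ∀ m : ℕ, 0 < m → q ^ m ≠ 1) {a : ℤ} (ha : a ≠ 0) :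
    qnum q a ≠ 0 := by
  refine div_ne_zero ?_ (sub_inv_ne_zero hq)
  have h0 := zpow_ne_zero a q.ne_zero
  have h := zpow_ne_one hq (a := a + a) (by omega)
  rw [zpow_add₀ q.ne_zero] at h
  rw [zpow_neg, sub_ne_zero]
  intro h'
  apply h
  nth_rewrite 1 [h']
  exact inv_mul_cancel₀ h0

/-- The `q`-factorial. -/
def qfact (q : ℂˣ) (m : ℕ) : ℂ := ∏ t ∈ Finset.range m, qnum q (t + 1)

theorem qfact_succ (q : ℂˣ) (m : ℕ) : qfact q (m + 1) = qfact q m * qnum q (m + 1) :=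
  Finset.prod_range_succ _ _

theorem qfact_ne_zero {q : ℂˣ} (hq : ∀ m : ℕ, 0 < m → q ^ m ≠ 1) (m : ℕ) : qfact q m ≠ 0 :=
  Finset.prod_ne_zero_iff.2 fun t _ => qnum_ne_zero hq (by omega)

/-- The squared norm of `v_i` under the contravariant form, equal to zero when `i` is out of
range. -/
def formWeight (q : ℂˣ) (n : ℕ) (i : ℤ) : ℂ :=
  if 0 ≤ i ∧ i ≤ n then (qfact q i.toNat * qfact q (n - i).toNat)⁻¹ else 0

theorem formWeight_eq_zero (q : ℂˣ) (n : ℕ) {i : ℤ} (h : i < 0 ∨ (n : ℤ) < i) :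
    formWeight q n i = 0 := if_neg (by omega)

theorem formWeight_ne_zero {q : ℂˣ} (hq : ∀ m : ℕ, 0 < m → q ^ m ≠ 1) (n : ℕ)
    (t : Fin (n + 1)) : formWeight q n ((t : ℕ) : ℤ) ≠ 0 := by
  have := t.isLt
  rw [formWeight, if_pos (by omega)]
  exact inv_ne_zero (mul_ne_zero (qfact_ne_zero hq _) (qfact_ne_zero hq _))

/-- Exactly the condition under which `E` and `F` are adjoint in one spin module: the two sides are
the values of `⟨E v_{i+1}, v_i⟩` and `⟨v_{i+1}, F v_i⟩`. -/
theorem formWeight_succ {q : ℂˣ} (hq : ∀ m : ℕ, 0 < m → q ^ m ≠ 1) (n : ℕ) (i : ℤ) :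
    qnum q (n - i) * formWeight q n i = qnum q (i + 1) * formWeight q n (i + 1) := by
  rcases lt_trichotomy i (-1) with h | rfl | h
  · rw [formWeight_eq_zero _ _ (by omega), formWeight_eq_zero _ _ (by omega), mul_zero, mul_zero]
  · rw [formWeight_eq_zero _ _ (by omega), neg_add_cancel, qnum_zero, zero_mul, mul_zero]
  rcases lt_trichotomy i n with h' | rfl | h'
  · obtain ⟨a, rfl⟩ : ∃ a : ℕ, i = a := ⟨i.toNat, by omega⟩
    obtain ⟨b, rfl⟩ : ∃ b : ℕ, n = a + 1 + b := ⟨n - (a + 1), by omega⟩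
    have e1 : (((a + 1 + b : ℕ) : ℤ) - (a : ℤ)).toNat = b + 1 := by omega
    have e2 : (((a + 1 + b : ℕ) : ℤ) - ((a : ℤ) + 1)).toNat = b := by omega
    have e3 : ((a : ℤ) + 1).toNat = a + 1 := by omega
    have e4 : ((a + 1 + b : ℕ) : ℤ) - (a : ℤ) = b + 1 := by omega
    rw [formWeight, if_pos (by omega), formWeight, if_pos (by omega), e1, e2, e3, e4,
      Int.toNat_natCast, qfact_succ, qfact_succ]
    have := qnum_ne_zero hq (a := (a : ℤ) + 1) (by omega)
    have := qnum_ne_zero hq (a := (b : ℤ) + 1) (by omega)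
    have := qfact_ne_zero hq a
    have := qfact_ne_zero hq b
    field_simp
  · rw [sub_self, qnum_zero, zero_mul, formWeight_eq_zero _ _ (by omega), mul_zero]
  · rw [formWeight_eq_zero _ _ (by omega), formWeight_eq_zero _ _ (by omega), mul_zero, mul_zero]

/-! ### The form on the triple tensor product and adjoint operators -/

section Form

variable (q : ℂˣ) (n₁ n₂ n₃ : ℕ)

/-- The standard basis of the triple tensor product. -/
def tensorBasis : Module.Basis ((Fin (n₁ + 1) × Fin (n₂ + 1)) × Fin (n₃ + 1)) ℂ
    (SpinModule₃ n₁ n₂ n₃) :=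
  ((Pi.basisFun ℂ (Fin (n₁ + 1))).tensorProduct (Pi.basisFun ℂ (Fin (n₂ + 1)))).tensorProduct
    (Pi.basisFun ℂ (Fin (n₃ + 1)))

theorem tensorBasis_apply (a : (Fin (n₁ + 1) × Fin (n₂ + 1)) × Fin (n₃ + 1)) :
    tensorBasis n₁ n₂ n₃ a = tensorVec n₁ n₂ n₃ (a.1.1 : ℕ) (a.1.2 : ℕ) (a.2 : ℕ) := by
  simp only [tensorBasis, Module.Basis.tensorProduct_apply', tensorVec, basisVec_natCast,
    Pi.basisFun_apply]

/-- The contravariant bilinear form on the triple tensor product. -/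
def tensorForm : LinearMap.BilinForm ℂ (SpinModule₃ n₁ n₂ n₃) :=
  Matrix.toBilin (tensorBasis n₁ n₂ n₃) (Matrix.diagonal fun a =>
    formWeight q n₁ (a.1.1 : ℕ) * formWeight q n₂ (a.1.2 : ℕ) * formWeight q n₃ (a.2 : ℕ))

variable {n₁ n₂ n₃}

theorem tensorForm_basis (a b : (Fin (n₁ + 1) × Fin (n₂ + 1)) × Fin (n₃ + 1)) :
    tensorForm q n₁ n₂ n₃ (tensorBasis n₁ n₂ n₃ a) (tensorBasis n₁ n₂ n₃ b) =
      if a = b then formWeight q n₁ (a.1.1 : ℕ) * formWeight q n₂ (a.1.2 : ℕ) *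
        formWeight q n₃ (a.2 : ℕ) else 0 := by
  simp only [tensorForm, Matrix.toBilin_apply, Matrix.diagonal_apply, Module.Basis.repr_self,
    Finsupp.single_apply]
  split_ifs with h
  · simp [h]
  · simp [h]

theorem exists_tensorBasis_or (i j l : ℤ) :
    (∃ a : (Fin (n₁ + 1) × Fin (n₂ + 1)) × Fin (n₃ + 1),
      i = (a.1.1 : ℕ) ∧ j = (a.1.2 : ℕ) ∧ l = (a.2 : ℕ)) ∨
    (i < 0 ∨ (n₁ : ℤ) < i) ∨ (j < 0 ∨ (n₂ : ℤ) < j) ∨ (l < 0 ∨ (n₃ : ℤ) < l) := by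
  by_cases h : (0 ≤ i ∧ i ≤ n₁) ∧ (0 ≤ j ∧ j ≤ n₂) ∧ (0 ≤ l ∧ l ≤ n₃)
  · refine Or.inl ⟨((⟨i.toNat, by omega⟩, ⟨j.toNat, by omega⟩), ⟨l.toNat, by omega⟩), ?_⟩
    dsimp only
    omega
  · exact Or.inr (by omega)

theorem tensorForm_tensorVec (i j l i' j' l' : ℤ) :
    tensorForm q n₁ n₂ n₃ (tensorVec n₁ n₂ n₃ i j l) (tensorVec n₁ n₂ n₃ i' j' l') =
      if i = i' ∧ j = j' ∧ l = l' then
        formWeight q n₁ i * formWeight q n₂ j * formWeight q n₃ l else 0 := by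
  rcases exists_tensorBasis_or (n₁ := n₁) (n₂ := n₂) (n₃ := n₃) i j l with
    ⟨a, rfl, rfl, rfl⟩ | h | h | h
  · rcases exists_tensorBasis_or (n₁ := n₁) (n₂ := n₂) (n₃ := n₃) i' j' l' with
      ⟨b, rfl, rfl, rfl⟩ | h | h | h
    · rw [← tensorBasis_apply, ← tensorBasis_apply, tensorForm_basis]
      simp [Prod.ext_iff, Fin.ext_iff, and_assoc]
    · have := a.1.1.isLt
      rw [tensorVec_eq_zero₁ h, map_zero, if_neg (by omega)]
    · have := a.1.2.isLt
      rw [tensorVec_eq_zero₂ h, map_zero, if_neg (by omega)]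
    · have := a.2.isLt
      rw [tensorVec_eq_zero₃ h, map_zero, if_neg (by omega)]
  · rw [tensorVec_eq_zero₁ h, formWeight_eq_zero _ _ h]
    simp
  · rw [tensorVec_eq_zero₂ h, formWeight_eq_zero _ _ h]
    simp
  · rw [tensorVec_eq_zero₃ h, formWeight_eq_zero _ _ h]
    simp

theorem tensorForm_symm (x y : SpinModule₃ n₁ n₂ n₃) :
    tensorForm q n₁ n₂ n₃ x y = tensorForm q n₁ n₂ n₃ y x := by
  have h : tensorForm q n₁ n₂ n₃ = (tensorForm q n₁ n₂ n₃).flip := by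
    refine end_ext_tensorVec fun i j l => end_ext_tensorVec fun i' j' l' => ?_
    change _ = tensorForm q n₁ n₂ n₃ (tensorVec n₁ n₂ n₃ i' j' l') (tensorVec n₁ n₂ n₃ i j l)
    rw [tensorForm_tensorVec, tensorForm_tensorVec]
    split_ifs with h1 h2 h2
    · obtain ⟨rfl, rfl, rfl⟩ := h1
      rfl
    · omega
    · omega
    · rfl
  conv_lhs => rw [h]
  rfl

/-- The form is diagonal with nonzero entries in the standard basis, so pairing with basis vectors
recovers the coordinates up to fixed factors. This is the only form of nondegeneracy used. -/
theorem tensorForm_expansion {q : ℂˣ} (hq : ∀ m : ℕ, 0 < m → q ^ m ≠ 1) :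
    ∃ c : (Fin (n₁ + 1) × Fin (n₂ + 1)) × Fin (n₃ + 1) → ℂ, ∀ x : SpinModule₃ n₁ n₂ n₃,
      x = ∑ a, (c a * tensorForm q n₁ n₂ n₃ (tensorBasis n₁ n₂ n₃ a) x) •
        tensorBasis n₁ n₂ n₃ a := by
  refine ⟨fun a => (formWeight q n₁ (a.1.1 : ℕ) * formWeight q n₂ (a.1.2 : ℕ) *
        formWeight q n₃ (a.2 : ℕ))⁻¹, fun x => ?_⟩
  conv_lhs => rw [← (tensorBasis n₁ n₂ n₃).sum_repr x]
  refine Finset.sum_congr rfl fun a _ => ?_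
  congr 1
  have h : tensorForm q n₁ n₂ n₃ (tensorBasis n₁ n₂ n₃ a) x =
      (tensorBasis n₁ n₂ n₃).repr x a * (formWeight q n₁ (a.1.1 : ℕ) *
        formWeight q n₂ (a.1.2 : ℕ) * formWeight q n₃ (a.2 : ℕ)) := by
    conv_lhs => rw [← (tensorBasis n₁ n₂ n₃).sum_repr x]
    simp only [map_sum, map_smul, smul_eq_mul, tensorForm_basis, mul_ite, mul_zero,
      Finset.sum_ite_eq, Finset.mem_univ, if_true]
  have h1 := formWeight_ne_zero hq n₁ a.1.1
  have h2 := formWeight_ne_zero hq n₂ a.1.2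
  have h3 := formWeight_ne_zero hq n₃ a.2
  rw [h]
  field_simp

/-- Adjointness of operators with respect to the contravariant form. -/
def IsFormAdjoint (S T : Module.End ℂ (SpinModule₃ n₁ n₂ n₃)) : Prop :=
  ∀ x y, tensorForm q n₁ n₂ n₃ (S x) y = tensorForm q n₁ n₂ n₃ x (T y)

variable {q}

theorem isFormAdjoint_of_tensorVec {S T : Module.End ℂ (SpinModule₃ n₁ n₂ n₃)}
    (h : ∀ i j l i' j' l',
      tensorForm q n₁ n₂ n₃ (S (tensorVec n₁ n₂ n₃ i j l)) (tensorVec n₁ n₂ n₃ i' j' l') =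
      tensorForm q n₁ n₂ n₃ (tensorVec n₁ n₂ n₃ i j l) (T (tensorVec n₁ n₂ n₃ i' j' l'))) :
    IsFormAdjoint q S T := by
  have h' : (tensorForm q n₁ n₂ n₃).comp S LinearMap.id =
      (tensorForm q n₁ n₂ n₃).comp LinearMap.id T :=
    end_ext_tensorVec fun i j l => end_ext_tensorVec fun i' j' l' => h i j l i' j' l'
  exact fun x y => LinearMap.congr_fun₂ h' x y

namespace IsFormAdjoint

variable {S T S' T' : Module.End ℂ (SpinModule₃ n₁ n₂ n₃)}

theorem symm (h : IsFormAdjoint q S T) : IsFormAdjoint q T S := fun x y => by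
  rw [tensorForm_symm, ← h, tensorForm_symm]

theorem add (h : IsFormAdjoint q S T) (h' : IsFormAdjoint q S' T') :
    IsFormAdjoint q (S + S') (T + T') := fun x y => by
  simp only [LinearMap.add_apply, map_add, h x y, h' x y]

theorem mul (h : IsFormAdjoint q S T) (h' : IsFormAdjoint q S' T') :
    IsFormAdjoint q (S * S') (T' * T) := fun x y => by
  simp only [Module.End.mul_apply, h (S' x) y, h' x (T y)]

theorem smul (c : ℂ) (h : IsFormAdjoint q S T) : IsFormAdjoint q (c • S) (c • T) := fun x y => by
  simp only [LinearMap.smul_apply, map_smul, h x y]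

theorem map_casimir {f : Uq q →ₐ[ℂ] Module.End ℂ (SpinModule₃ n₁ n₂ n₃)}
    (hE : IsFormAdjoint q (f (Uq.E q)) (f (Uq.F q)))
    (hK : IsFormAdjoint q (f (Uq.qH q)) (f (Uq.qH q)))
    (hK' : IsFormAdjoint q (f (Uq.qHinv q)) (f (Uq.qHinv q))) :
    IsFormAdjoint q (f (Uq.casimir q)) (f (Uq.casimir q)) := by
  rw [AskeyWilson.map_casimir, pow_two (f (Uq.qH q)), pow_two (f (Uq.qHinv q))]
  exact (((hE.symm.mul hE).smul _).add ((hK.mul hK).smul _)).add ((hK'.mul hK').smul _)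

end IsFormAdjoint

variable {s : ℂˣ} {hs : s ^ 2 = q}

local notation "ρ₁" => rep₁ q s hs n₁ n₂ n₃
local notation "ρ₂" => rep₂ q s hs n₁ n₂ n₃
local notation "ρ₃" => rep₃ q s hs n₁ n₂ n₃
local notation "ρ₁₂" => rep₁₂ q s hs n₁ n₂ n₃
local notation "ρ₂₃" => rep₂₃ q s hs n₁ n₂ n₃
local notation "ρ" => rep₁₂₃ q s hs n₁ n₂ n₃

theorem rep₁_E_adjoint (hq : ∀ m : ℕ, 0 < m → q ^ m ≠ 1) :
    IsFormAdjoint q (ρ₁ (Uq.E q)) (ρ₁ (Uq.F q)) := by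
  refine isFormAdjoint_of_tensorVec fun i j l i' j' l' => ?_
  simp only [rep₁_E_apply, rep₁_F_apply, map_smul, LinearMap.smul_apply, smul_eq_mul,
    tensorForm_tensorVec]
  split_ifs with h h' h'
  · obtain ⟨h1, rfl, rfl⟩ := h
    obtain rfl : i = i' + 1 := by omega
    have := formWeight_succ hq n₁ i'
    rw [add_sub_cancel_right, show (n₁ : ℤ) - (i' + 1) + 1 = n₁ - i' by ring]
    linear_combination this * formWeight q n₂ j * formWeight q n₃ l
  · omega
  · omega
  · simp

theorem rep₁_qH_adjoint : IsFormAdjoint q (ρ₁ (Uq.qH q)) (ρ₁ (Uq.qH q)) := by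
  refine isFormAdjoint_of_tensorVec fun i j l i' j' l' => ?_
  simp only [rep₁_qH_apply, map_smul, LinearMap.smul_apply, smul_eq_mul, tensorForm_tensorVec]
  split_ifs with h
  · rw [h.1]
  · simp

theorem rep₁_qHinv_adjoint : IsFormAdjoint q (ρ₁ (Uq.qHinv q)) (ρ₁ (Uq.qHinv q)) := by
  refine isFormAdjoint_of_tensorVec fun i j l i' j' l' => ?_
  simp only [rep₁_qHinv_apply, map_smul, LinearMap.smul_apply, smul_eq_mul, tensorForm_tensorVec]
  split_ifs with h
  · rw [h.1]
  · simp

theorem rep₂_E_adjoint (hq : ∀ m : ℕ, 0 < m → q ^ m ≠ 1) :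
    IsFormAdjoint q (ρ₂ (Uq.E q)) (ρ₂ (Uq.F q)) := by
  refine isFormAdjoint_of_tensorVec fun i j l i' j' l' => ?_
  simp only [rep₂_E_apply, rep₂_F_apply, map_smul, LinearMap.smul_apply, smul_eq_mul,
    tensorForm_tensorVec]
  split_ifs with h h' h'
  · obtain ⟨rfl, h1, rfl⟩ := h
    obtain rfl : j = j' + 1 := by omega
    have := formWeight_succ hq n₂ j'
    rw [add_sub_cancel_right, show (n₂ : ℤ) - (j' + 1) + 1 = n₂ - j' by ring]
    linear_combination this * formWeight q n₁ i * formWeight q n₃ l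
  · omega
  · omega
  · simp

theorem rep₂_qH_adjoint : IsFormAdjoint q (ρ₂ (Uq.qH q)) (ρ₂ (Uq.qH q)) := by
  refine isFormAdjoint_of_tensorVec fun i j l i' j' l' => ?_
  simp only [rep₂_qH_apply, map_smul, LinearMap.smul_apply, smul_eq_mul, tensorForm_tensorVec]
  split_ifs with h
  · rw [h.2.1]
  · simp

theorem rep₂_qHinv_adjoint : IsFormAdjoint q (ρ₂ (Uq.qHinv q)) (ρ₂ (Uq.qHinv q)) := by
  refine isFormAdjoint_of_tensorVec fun i j l i' j' l' => ?_
  simp only [rep₂_qHinv_apply, map_smul, LinearMap.smul_apply, smul_eq_mul, tensorForm_tensorVec]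
  split_ifs with h
  · rw [h.2.1]
  · simp

theorem rep₃_E_adjoint (hq : ∀ m : ℕ, 0 < m → q ^ m ≠ 1) :
    IsFormAdjoint q (ρ₃ (Uq.E q)) (ρ₃ (Uq.F q)) := by
  refine isFormAdjoint_of_tensorVec fun i j l i' j' l' => ?_
  simp only [rep₃_E_apply, rep₃_F_apply, map_smul, LinearMap.smul_apply, smul_eq_mul,
    tensorForm_tensorVec]
  split_ifs with h h' h'
  · obtain ⟨rfl, rfl, h1⟩ := h
    obtain rfl : l = l' + 1 := by omega
    have := formWeight_succ hq n₃ l'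
    rw [add_sub_cancel_right, show (n₃ : ℤ) - (l' + 1) + 1 = n₃ - l' by ring]
    linear_combination this * formWeight q n₁ i * formWeight q n₂ j
  · omega
  · omega
  · simp

theorem rep₃_qH_adjoint : IsFormAdjoint q (ρ₃ (Uq.qH q)) (ρ₃ (Uq.qH q)) := by
  refine isFormAdjoint_of_tensorVec fun i j l i' j' l' => ?_
  simp only [rep₃_qH_apply, map_smul, LinearMap.smul_apply, smul_eq_mul, tensorForm_tensorVec]
  split_ifs with h
  · rw [h.2.2]
  · simp

theorem rep₃_qHinv_adjoint : IsFormAdjoint q (ρ₃ (Uq.qHinv q)) (ρ₃ (Uq.qHinv q)) := by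
  refine isFormAdjoint_of_tensorVec fun i j l i' j' l' => ?_
  simp only [rep₃_qHinv_apply, map_smul, LinearMap.smul_apply, smul_eq_mul, tensorForm_tensorVec]
  split_ifs with h
  · rw [h.2.2]
  · simp

/-- Taking adjoints exchanges `E` and `F` and fixes `q^{±H}`, so it carries `Δ(E)` to `Δ(F)`. The
reversal of products is harmless because operators on different factors commute. -/
theorem rep₁₂_E_adjoint (hq : ∀ m : ℕ, 0 < m → q ^ m ≠ 1) :
    IsFormAdjoint q (ρ₁₂ (Uq.E q)) (ρ₁₂ (Uq.F q)) := by
  rw [rep₁₂_E, rep₁₂_F, (commute_rep₁_rep₂ _ _).eq, (commute_rep₁_rep₂ (Uq.qH q) _).eq]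
  exact (rep₂_qHinv_adjoint.mul (rep₁_E_adjoint hq)).add ((rep₂_E_adjoint hq).mul rep₁_qH_adjoint)

theorem rep₁₂_qH_adjoint : IsFormAdjoint q (ρ₁₂ (Uq.qH q)) (ρ₁₂ (Uq.qH q)) := by
  rw [rep₁₂_qH]
  nth_rewrite 1 [(commute_rep₁_rep₂ _ _).eq]
  exact rep₂_qH_adjoint.mul rep₁_qH_adjoint

theorem rep₁₂_qHinv_adjoint : IsFormAdjoint q (ρ₁₂ (Uq.qHinv q)) (ρ₁₂ (Uq.qHinv q)) := by
  rw [rep₁₂_qHinv]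
  nth_rewrite 1 [(commute_rep₁_rep₂ _ _).eq]
  exact rep₂_qHinv_adjoint.mul rep₁_qHinv_adjoint

theorem rep₂₃_E_adjoint (hq : ∀ m : ℕ, 0 < m → q ^ m ≠ 1) :
    IsFormAdjoint q (ρ₂₃ (Uq.E q)) (ρ₂₃ (Uq.F q)) := by
  rw [rep₂₃_E, rep₂₃_F, (commute_rep₂_rep₃ _ _).eq, (commute_rep₂_rep₃ (Uq.qH q) _).eq]
  exact (rep₃_qHinv_adjoint.mul (rep₂_E_adjoint hq)).add ((rep₃_E_adjoint hq).mul rep₂_qH_adjoint)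

theorem rep₂₃_qH_adjoint : IsFormAdjoint q (ρ₂₃ (Uq.qH q)) (ρ₂₃ (Uq.qH q)) := by
  rw [rep₂₃_qH]
  nth_rewrite 1 [(commute_rep₂_rep₃ _ _).eq]
  exact rep₃_qH_adjoint.mul rep₂_qH_adjoint

theorem rep₂₃_qHinv_adjoint : IsFormAdjoint q (ρ₂₃ (Uq.qHinv q)) (ρ₂₃ (Uq.qHinv q)) := by
  rw [rep₂₃_qHinv]
  nth_rewrite 1 [(commute_rep₂_rep₃ _ _).eq]
  exact rep₃_qHinv_adjoint.mul rep₂_qHinv_adjoint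

theorem rep₁₂₃_E_adjoint (hq : ∀ m : ℕ, 0 < m → q ^ m ≠ 1) :
    IsFormAdjoint q (ρ (Uq.E q)) (ρ (Uq.F q)) := by
  rw [rep₁₂₃_E, rep₁₂₃_F, (commute_rep₁₂_rep₃ _ _).eq, (commute_rep₁₂_rep₃ (Uq.qH q) _).eq]
  exact (rep₃_qHinv_adjoint.mul (rep₁₂_E_adjoint hq)).add ((rep₃_E_adjoint hq).mul rep₁₂_qH_adjoint)

theorem rep₁₂₃_qH_adjoint : IsFormAdjoint q (ρ (Uq.qH q)) (ρ (Uq.qH q)) := by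
  rw [rep₁₂₃_qH]
  nth_rewrite 1 [(commute_rep₁₂_rep₃ _ _).eq]
  exact rep₃_qH_adjoint.mul rep₁₂_qH_adjoint

theorem rep₁₂₃_qHinv_adjoint : IsFormAdjoint q (ρ (Uq.qHinv q)) (ρ (Uq.qHinv q)) := by
  rw [rep₁₂₃_qHinv]
  nth_rewrite 1 [(commute_rep₁₂_rep₃ _ _).eq]
  exact rep₃_qHinv_adjoint.mul rep₁₂_qHinv_adjoint

end Form

end AskeyWilson

end

noncomputable section

namespace AskeyWilson

set_option maxSynthPendingDepth 3

/-! ### Weight spaces and highest weight vectors -/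

section Weights

open Polynomial

/-- The eigenvalue of the Casimir element on highest weight vectors of weight `(a - 1) / 2`. -/
def casimirEig (q : ℂˣ) (a : ℤ) : ℂ := (q : ℂ) ^ a + ((q : ℂ) ^ a)⁻¹

/-- The difference `(q^a + q^{-a}) - (q^b + q^{-b})` is `(q^{a-b} - 1)(q^{a+b} - 1)` up to a nonzero
factor. -/
theorem eq_or_eq_neg_of_casimirEig_eq {q : ℂˣ} (hq : ∀ m : ℕ, 0 < m → q ^ m ≠ 1) {a b : ℤ}
    (h : casimirEig q a = casimirEig q b) : a = b ∨ a = -b := by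
  have ha := zpow_ne_zero a q.ne_zero
  have hb := zpow_ne_zero b q.ne_zero
  have h1 : ((q : ℂ) ^ (a - b) - 1) * ((q : ℂ) ^ (a + b) - 1) = 0 := by
    rw [casimirEig, casimirEig] at h
    rw [zpow_sub₀ q.ne_zero, zpow_add₀ q.ne_zero]
    field_simp at h ⊢
    linear_combination h
  by_contra! hab
  rcases mul_eq_zero.1 h1 with h2 | h2
  · exact zpow_ne_one hq (sub_ne_zero.2 hab.1) (sub_eq_zero.1 h2)
  · exact zpow_ne_one hq (a := a + b) (by omega) (sub_eq_zero.1 h2)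

theorem aeval_mem_of_forall_mem {V : Type*} [AddCommGroup V] [Module ℂ V]
    {S : Module.End ℂ V} {X : Submodule ℂ V} (h : ∀ x ∈ X, S x ∈ X) (p : ℂ[X]) {x : V}
    (hx : x ∈ X) : aeval S p x ∈ X := by
  induction p using Polynomial.induction_on' with
  | add p r hp hr => rw [map_add]; exact add_mem hp hr
  | monomial n a =>
    have hn : (S ^ n) x ∈ X := by
      induction n with
      | zero => exact hx
      | succ n ih => rw [pow_succ', Module.End.mul_apply]; exact h _ ih
    rw [aeval_monomial, Module.End.mul_apply, Module.algebraMap_end_apply]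
    exact X.smul_mem _ hn

variable (n₁ n₂ n₃ : ℕ)

/-- The span of the vectors `v_i ⊗ v_j ⊗ v_l` with `i + j + l = k`. -/
def weightSpace (k : ℤ) : Submodule ℂ (SpinModule₃ n₁ n₂ n₃) :=
  Submodule.span ℂ {x | ∃ i j l, i + j + l = k ∧ x = tensorVec n₁ n₂ n₃ i j l}

variable {n₁ n₂ n₃} {q s : ℂˣ} {hs : s ^ 2 = q}

local notation "ρ" => rep₁₂₃ q s hs n₁ n₂ n₃
local notation "e" => tensorVec n₁ n₂ n₃
local notation "M" => SpinModule₃ n₁ n₂ n₃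
local notation "wt" => weightSpace n₁ n₂ n₃
local notation "N" => ((n₁ : ℤ) + n₂ + n₃)

theorem tensorVec_mem_weightSpace {i j l k : ℤ} (h : i + j + l = k) : e i j l ∈ wt k :=
  Submodule.subset_span ⟨i, j, l, h, rfl⟩

theorem weightSpace_eq_bot {k : ℤ} (h : k < 0 ∨ N < k) : wt k = ⊥ := by
  rw [weightSpace, Submodule.span_eq_bot]
  rintro _ ⟨i, j, l, rfl, rfl⟩
  by_cases h1 : i < 0 ∨ (n₁ : ℤ) < i
  · exact tensorVec_eq_zero₁ h1 _ _
  by_cases h2 : j < 0 ∨ (n₂ : ℤ) < j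
  · exact tensorVec_eq_zero₂ h2 _ _
  · exact tensorVec_eq_zero₃ (by omega) _ _

theorem map_mem_of_weightSpace {S : Module.End ℂ M} {k : ℤ} {X : Submodule ℂ M}
    (h : ∀ i j l, i + j + l = k → S (e i j l) ∈ X) {x : M} (hx : x ∈ wt k) : S x ∈ X := by
  have : wt k ≤ X.comap S := Submodule.span_le.2 (by rintro _ ⟨i, j, l, hk, rfl⟩; exact h i j l hk)
  exact this hx

theorem rep₁₂₃_F_apply (i j l : ℤ) : ∃ a b c : ℂ, a ≠ 0 ∧ b ≠ 0 ∧ c ≠ 0 ∧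
    ρ (Uq.F q) (e i j l) = (a * qnum q (i + 1)) • e (i + 1) j l +
      (b * qnum q (j + 1)) • e i (j + 1) l + (c * qnum q (l + 1)) • e i j (l + 1) := by
  have h0 := s.ne_zero
  refine ⟨((s : ℂ) ^ ((n₂ : ℤ) - 2 * j))⁻¹ * ((s : ℂ) ^ ((n₃ : ℤ) - 2 * l))⁻¹,
    (s : ℂ) ^ ((n₁ : ℤ) - 2 * i) * ((s : ℂ) ^ ((n₃ : ℤ) - 2 * l))⁻¹,
    (s : ℂ) ^ ((n₁ : ℤ) - 2 * i) * (s : ℂ) ^ ((n₂ : ℤ) - 2 * j), ?_, ?_, ?_, ?_⟩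
  · exact mul_ne_zero (inv_ne_zero (zpow_ne_zero _ h0)) (inv_ne_zero (zpow_ne_zero _ h0))
  · exact mul_ne_zero (zpow_ne_zero _ h0) (inv_ne_zero (zpow_ne_zero _ h0))
  · exact mul_ne_zero (zpow_ne_zero _ h0) (zpow_ne_zero _ h0)
  · simp only [rep₁₂₃_F, rep₁₂_F, rep₁₂_qH, LinearMap.add_apply, Module.End.mul_apply, map_smul,
      rep₁_F_apply, rep₁_qH_apply, rep₂_F_apply, rep₂_qH_apply, rep₂_qHinv_apply, rep₃_F_apply,
      rep₃_qHinv_apply]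
    module

theorem rep₁₂₃_E_apply (i j l : ℤ) : ∃ a b c : ℂ,
    ρ (Uq.E q) (e i j l) = a • e (i - 1) j l + b • e i (j - 1) l + c • e i j (l - 1) := by
  simp only [rep₁₂₃_E, rep₁₂_E, rep₁₂_qH, LinearMap.add_apply, Module.End.mul_apply, map_smul,
      rep₁_E_apply, rep₁_qH_apply, rep₂_E_apply, rep₂_qH_apply, rep₂_qHinv_apply, rep₃_E_apply,
      rep₃_qHinv_apply, smul_smul, smul_add]
  exact ⟨_, _, _, rfl⟩

theorem rep₁₂₃_F_mem {k : ℤ} {x : M} (hx : x ∈ wt k) : ρ (Uq.F q) x ∈ wt (k + 1) := by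
  refine map_mem_of_weightSpace (fun i j l h => ?_) hx
  obtain ⟨a, b, c, -, -, -, h'⟩ := rep₁₂₃_F_apply (q := q) (hs := hs) (n₁ := n₁) (n₂ := n₂)
    (n₃ := n₃) i j l
  rw [h']
  exact add_mem (add_mem (Submodule.smul_mem _ _ (tensorVec_mem_weightSpace (by omega)))
    (Submodule.smul_mem _ _ (tensorVec_mem_weightSpace (by omega))))
    (Submodule.smul_mem _ _ (tensorVec_mem_weightSpace (by omega)))

theorem rep₁₂₃_E_mem {k : ℤ} {x : M} (hx : x ∈ wt k) : ρ (Uq.E q) x ∈ wt (k - 1) := by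
  refine map_mem_of_weightSpace (fun i j l h => ?_) hx
  obtain ⟨a, b, c, h'⟩ := rep₁₂₃_E_apply (q := q) (hs := hs) (n₁ := n₁) (n₂ := n₂)
    (n₃ := n₃) i j l
  rw [h']
  exact add_mem (add_mem (Submodule.smul_mem _ _ (tensorVec_mem_weightSpace (by omega)))
    (Submodule.smul_mem _ _ (tensorVec_mem_weightSpace (by omega))))
    (Submodule.smul_mem _ _ (tensorVec_mem_weightSpace (by omega)))

theorem rep₁₂₃_qH_apply {k : ℤ} {x : M} (hx : x ∈ wt k) :
    ρ (Uq.qH q) x = (s : ℂ) ^ (N - 2 * k) • x := by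
  rw [← sub_eq_zero]
  have := map_mem_of_weightSpace (S := ρ (Uq.qH q) - (s : ℂ) ^ (N - 2 * k) • 1) (X := ⊥)
    (fun i j l h => ?_) hx
  · simpa using this
  · subst h
    simp only [rep₁₂₃_qH, rep₁₂_qH, LinearMap.sub_apply, LinearMap.smul_apply, map_smul,
      Module.End.mul_apply, Module.End.one_apply, rep₁_qH_apply, rep₂_qH_apply, rep₃_qH_apply,
      Submodule.mem_bot, smul_smul, ← zpow_add₀ s.ne_zero]
    rw [sub_eq_zero]
    congr 2
    ring

theorem rep₁₂₃_qHinv_apply {k : ℤ} {x : M} (hx : x ∈ wt k) :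
    ρ (Uq.qHinv q) x = ((s : ℂ) ^ (N - 2 * k))⁻¹ • x := by
  have h : ρ (Uq.qHinv q) (ρ (Uq.qH q) x) = x := by
    rw [← Module.End.mul_apply, ← map_mul, Uq.qHinv_mul_qH, map_one, Module.End.one_apply]
  rw [rep₁₂₃_qH_apply hx, map_smul] at h
  nth_rewrite 2 [← h]
  rw [smul_smul, inv_mul_cancel₀ (zpow_ne_zero _ s.ne_zero), one_smul]

theorem casimir_apply_of_weight {V : Type*} [AddCommGroup V] [Module ℂ V]
    (f : Uq q →ₐ[ℂ] Module.End ℂ V) (hs : s ^ 2 = q) {a : ℤ} {x : V}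
    (hK : f (Uq.qH q) x = (s : ℂ) ^ a • x) (hK' : f (Uq.qHinv q) x = ((s : ℂ) ^ a)⁻¹ • x) :
    f (Uq.casimir q) x = ((q : ℂ) - (q : ℂ)⁻¹) ^ 2 • f (Uq.F q) (f (Uq.E q) x) +
      casimirEig q (a + 1) • x := by
  have h : (s : ℂ) ^ a * (s : ℂ) ^ a = (q : ℂ) ^ a := by
    rw [← mul_zpow, ← hs, Units.val_pow_eq_pow_val, pow_two]
  simp only [map_casimir, pow_two, LinearMap.add_apply, LinearMap.smul_apply,
    Module.End.mul_apply, hK, hK', map_smul, smul_smul]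
  rw [add_assoc, ← add_smul, casimirEig, zpow_add_one₀ q.ne_zero, ← h]
  congr 2
  rw [mul_inv, mul_inv]
  ring

theorem casimir_apply_of_weight' {V : Type*} [AddCommGroup V] [Module ℂ V]
    (f : Uq q →ₐ[ℂ] Module.End ℂ V) (hs : s ^ 2 = q) (hq : (q : ℂ) ^ 2 - 1 ≠ 0) {a : ℤ} {x : V}
    (hK : f (Uq.qH q) x = (s : ℂ) ^ a • x) (hK' : f (Uq.qHinv q) x = ((s : ℂ) ^ a)⁻¹ • x) :
    f (Uq.casimir q) x = ((q : ℂ) - (q : ℂ)⁻¹) ^ 2 • f (Uq.E q) (f (Uq.F q) x) +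
      casimirEig q (a - 1) • x := by
  have h : (s : ℂ) ^ a * (s : ℂ) ^ a = (q : ℂ) ^ a := by
    rw [← mul_zpow, ← hs, Units.val_pow_eq_pow_val, pow_two]
  simp only [Uq.casimir_eq hq, map_add, map_smul, map_mul, pow_two, LinearMap.add_apply,
    LinearMap.smul_apply, Module.End.mul_apply, hK, hK', map_smul, smul_smul]
  rw [add_assoc, ← add_smul, casimirEig, zpow_sub_one₀ q.ne_zero, ← h]
  congr 2
  rw [mul_inv, mul_inv, inv_inv]
  ring

theorem rep₁₂₃_casimir_of_mem {k : ℤ} {x : M} (hx : x ∈ wt k) :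
    ρ (Uq.casimir q) x = ((q : ℂ) - (q : ℂ)⁻¹) ^ 2 • ρ (Uq.F q) (ρ (Uq.E q) x) +
      casimirEig q (N + 1 - 2 * k) • x := by
  rw [casimir_apply_of_weight ρ hs (rep₁₂₃_qH_apply hx) (rep₁₂₃_qHinv_apply hx)]
  ring_nf

/-- This version reads off the Casimir eigenvalue on vectors killed by `F`, as the preceding one
does for vectors killed by `E`. -/
theorem rep₁₂₃_casimir_of_mem' (hq : (q : ℂ) ^ 2 - 1 ≠ 0) {k : ℤ} {x : M} (hx : x ∈ wt k) :
    ρ (Uq.casimir q) x = ((q : ℂ) - (q : ℂ)⁻¹) ^ 2 • ρ (Uq.E q) (ρ (Uq.F q) x) +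
      casimirEig q (N - 1 - 2 * k) • x := by
  rw [casimir_apply_of_weight' ρ hs hq (rep₁₂₃_qH_apply hx) (rep₁₂₃_qHinv_apply hx)]
  ring_nf

variable (q s hs n₁ n₂ n₃) in
/-- The space of highest weight vectors of weight `j₁ + j₂ + j₃ - k`. -/
def highestWeightSpace (k : ℤ) : Submodule ℂ M :=
  wt k ⊓ LinearMap.ker (ρ (Uq.E q))

local notation "hw" => highestWeightSpace n₁ n₂ n₃ q s hs

theorem rep₁₂₃_casimir_of_mem_highestWeightSpace {k : ℤ} {x : M} (hx : x ∈ hw k) :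
    ρ (Uq.casimir q) x = casimirEig q (N + 1 - 2 * k) • x := by
  rw [rep₁₂₃_casimir_of_mem hx.1, LinearMap.mem_ker.1 hx.2, map_zero, smul_zero, zero_add]

/-- Apply `F` to a nonzero `x` until the last nonzero vector `F^r x`. Its Casimir eigenvalue,
computed from `x` and from `F F^r x = 0`, gives `r = -1` or `n₁ + n₂ + n₃ = 2k + r`; both are
impossible. -/
theorem highestWeightSpace_eq_bot (hq : ∀ m : ℕ, 0 < m → q ^ m ≠ 1) {k : ℤ} (hk : N < 2 * k) :
    hw k = ⊥ := by
  rw [Submodule.eq_bot_iff]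
  intro x hx
  have hmem : ∀ r : ℕ, (ρ (Uq.F q) ^ r) x ∈ wt (k + r) := by
    intro r
    induction r with
    | zero => simpa using hx.1
    | succ r ih =>
      rw [pow_succ', Module.End.mul_apply]
      have := rep₁₂₃_F_mem (hs := hs) ih
      push_cast
      rwa [← add_assoc]
  have hex : ∃ r : ℕ, (ρ (Uq.F q) ^ r) x = 0 := by
    refine ⟨(N - k).toNat + 1, ?_⟩
    have := hmem ((N - k).toNat + 1)
    rwa [weightSpace_eq_bot (by omega), Submodule.mem_bot] at this
  classical
  by_contra hx0
  obtain ⟨r, hr⟩ : ∃ r, Nat.find hex = r + 1 :=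
    Nat.exists_eq_succ_of_ne_zero fun h => hx0 (by simpa [h] using Nat.find_spec hex)
  have h1 : ρ (Uq.F q) ((ρ (Uq.F q) ^ r) x) = 0 := by
    have := Nat.find_spec hex
    rwa [hr, pow_succ', Module.End.mul_apply] at this
  have h2 : (ρ (Uq.F q) ^ r) x ≠ 0 := Nat.find_min hex (by omega)
  have h3 := rep₁₂₃_casimir_of_mem' (hs := hs) (sq_sub_one_ne_zero hq) (hmem r)
  rw [h1, map_zero, smul_zero, zero_add] at h3
  have h4 : ρ (Uq.casimir q) ((ρ (Uq.F q) ^ r) x) =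
      casimirEig q (N + 1 - 2 * k) • (ρ (Uq.F q) ^ r) x := by
    rw [← map_pow, ← Module.End.mul_apply,
      (commute_rep₁₂₃_casimir (sq_sub_one_ne_zero hq) _).eq, Module.End.mul_apply,
      rep₁₂₃_casimir_of_mem_highestWeightSpace hx, map_smul]
  rw [h4] at h3
  rcases eq_or_eq_neg_of_casimirEig_eq hq (smul_left_injective ℂ h2 h3) with h | h <;> omega

/-! ### Projections onto highest weight vectors -/

variable (q n₁ n₂ n₃) in
/-- The polynomial vanishing at the eigenvalues of the total Casimir element on the highest
weight vectors of weight larger than `j₁ + j₂ + j₃ - k`. -/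
def projPoly (k : ℕ) : ℂ[X] :=
  ∏ i ∈ Finset.range k, (X - C (casimirEig q (N + 1 - 2 * (i : ℤ))))

variable (q s hs n₁ n₂ n₃) in
/-- A multiple of the projection of the weight space onto highest weight vectors. -/
def hwProj (k : ℕ) : Module.End ℂ M := aeval (ρ (Uq.casimir q)) (projPoly n₁ n₂ n₃ q k)

local notation "T" => hwProj n₁ n₂ n₃ q s hs

theorem hwProj_eq_map (k : ℕ) : T k = ρ (aeval (Uq.casimir q) (projPoly n₁ n₂ n₃ q k)) :=
  aeval_algHom_apply _ _ _

theorem hwProj_commute {y : Module.End ℂ M} (hy : y ∈ spinCentralizer q s hs n₁ n₂ n₃) (k : ℕ) :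
    Commute y (T k) := by
  rw [hwProj_eq_map]
  exact mem_spinCentralizer_iff.1 hy _

theorem aeval_commute {R : Type*} [Ring R] [Algebra ℂ R] {a x : R} (h : Commute a x) (p : ℂ[X]) :
    Commute (aeval a p) x := by
  have h1 : Algebra.adjoin ℂ {a} ≤ Subalgebra.centralizer ℂ {x} := by
    rw [Algebra.adjoin_le_iff, Set.singleton_subset_iff]
    exact (Subalgebra.mem_centralizer_iff ℂ).2 fun y hy => by
      rw [Set.mem_singleton_iff.1 hy, h.eq]
  exact ((Subalgebra.mem_centralizer_iff ℂ).1 (h1 (aeval_mem_adjoin_singleton ℂ a)) x rfl).symm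

theorem hwProj_commute_rep (hq : (q : ℂ) ^ 2 - 1 ≠ 0) (k : ℕ) (x : Uq q) :
    Commute (T k) (ρ x) :=
  aeval_commute (commute_rep₁₂₃_casimir hq x) _

theorem hwProj_succ (k : ℕ) :
    T (k + 1) = T k * (ρ (Uq.casimir q) - casimirEig q (N + 1 - 2 * (k : ℤ)) • 1) := by
  rw [hwProj, projPoly, Finset.prod_range_succ, map_mul, map_sub, aeval_X, aeval_C,
    Algebra.algebraMap_eq_smul_one]
  rfl

/-- On `wt k` the last factor of `T (k + 1)` is a multiple of `F E`. The remaining factor `T k`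
commutes with `F` and kills `E x`, which lies one level below. -/
theorem hwProj_succ_apply (hq : (q : ℂ) ^ 2 - 1 ≠ 0) (k : ℕ) {x : M} (hx : x ∈ wt (k : ℤ)) :
    T (k + 1) x = 0 := by
  induction k generalizing x with
  | zero =>
    have h := rep₁₂₃_E_mem (hs := hs) hx
    rw [weightSpace_eq_bot (by omega), Submodule.mem_bot] at h
    rw [hwProj_succ, Module.End.mul_apply, LinearMap.sub_apply, rep₁₂₃_casimir_of_mem hx, h]
    simp
  | succ k ih =>
    have h := rep₁₂₃_E_mem (hs := hs) hx
    rw [Nat.cast_succ, add_sub_cancel_right] at h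
    rw [hwProj_succ, Module.End.mul_apply, LinearMap.sub_apply, rep₁₂₃_casimir_of_mem hx,
      LinearMap.smul_apply, Module.End.one_apply, add_sub_cancel_right, map_smul,
      ← Module.End.mul_apply, (hwProj_commute_rep hq _ _).eq, Module.End.mul_apply, ih h,
      map_zero, smul_zero]

theorem hwProj_of_mem_pred (hq : (q : ℂ) ^ 2 - 1 ≠ 0) (k : ℕ) {x : M}
    (hx : x ∈ wt ((k : ℤ) - 1)) : T k x = 0 := by
  cases k with
  | zero =>
    rw [weightSpace_eq_bot (by omega), Submodule.mem_bot] at hx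
    rw [hx, map_zero]
  | succ k =>
    rw [Nat.cast_succ, add_sub_cancel_right] at hx
    exact hwProj_succ_apply hq k hx

theorem rep₁₂₃_casimir_mem {k : ℤ} {x : M} (hx : x ∈ wt k) : ρ (Uq.casimir q) x ∈ wt k := by
  rw [rep₁₂₃_casimir_of_mem hx]
  have := rep₁₂₃_F_mem (hs := hs) (rep₁₂₃_E_mem (hs := hs) hx)
  rw [sub_add_cancel] at this
  exact add_mem (Submodule.smul_mem _ _ this) (Submodule.smul_mem _ _ hx)

/-- `E T x = T E x`, and `T k` annihilates the level `k - 1` where `E x` lies. -/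
theorem hwProj_mem (hq : (q : ℂ) ^ 2 - 1 ≠ 0) (k : ℕ) {x : M} (hx : x ∈ wt (k : ℤ)) :
    T k x ∈ hw k := by
  refine ⟨aeval_mem_of_forall_mem (fun _ => rep₁₂₃_casimir_mem) _ hx, ?_⟩
  rw [SetLike.mem_coe, LinearMap.mem_ker, ← Module.End.mul_apply, ← (hwProj_commute_rep hq _ _).eq,
    Module.End.mul_apply, hwProj_of_mem_pred hq k (rep₁₂₃_E_mem hx)]

theorem hwProj_of_mem_map (hq : (q : ℂ) ^ 2 - 1 ≠ 0) (k : ℕ) {x : M}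
    (hx : x ∈ (wt ((k : ℤ) - 1)).map (ρ (Uq.F q))) : T k x = 0 := by
  obtain ⟨y, hy, rfl⟩ := hx
  rw [← Module.End.mul_apply, (hwProj_commute_rep hq _ _).eq, Module.End.mul_apply,
    hwProj_of_mem_pred hq k hy, map_zero]

variable (q n₁ n₂ n₃) in
/-- The scalar by which `hwProj` acts on highest weight vectors. -/
def hwScalar (k : ℕ) : ℂ := (projPoly n₁ n₂ n₃ q k).eval (casimirEig q (N + 1 - 2 * (k : ℤ)))

theorem hwProj_of_mem_highestWeightSpace (k : ℕ) {x : M} (hx : x ∈ hw (k : ℤ)) :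
    T k x = hwScalar n₁ n₂ n₃ q k • x :=
  Module.End.aeval_apply_of_mem_apply_eq_smul (rep₁₂₃_casimir_of_mem_highestWeightSpace hx)

theorem hwProj_of_mem_highestWeightSpace_of_lt {i k : ℕ} (hik : i < k) {x : M}
    (hx : x ∈ hw (i : ℤ)) : T k x = 0 := by
  rw [hwProj, Module.End.aeval_apply_of_mem_apply_eq_smul (rep₁₂₃_casimir_of_mem_highestWeightSpace hx), projPoly,
    eval_prod, Finset.prod_eq_zero (Finset.mem_range.2 hik) (by simp), zero_smul]

/-- For `i < k` and `2k ≤ n₁ + n₂ + n₃`, the exponents `N + 1 - 2i` and `N + 1 - 2k` are neither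
equal nor opposite. -/
theorem hwScalar_ne_zero (hq : ∀ m : ℕ, 0 < m → q ^ m ≠ 1) {k : ℕ} (hk : 2 * (k : ℤ) ≤ N) :
    hwScalar n₁ n₂ n₃ q k ≠ 0 := by
  rw [hwScalar, projPoly, eval_prod, Finset.prod_ne_zero_iff]
  intro i hi h
  rw [Finset.mem_range] at hi
  rw [eval_sub, eval_X, eval_C, sub_eq_zero] at h
  rcases eq_or_eq_neg_of_casimirEig_eq hq h with h | h <;> omega

end Weights

end AskeyWilson

end

noncomputable section

namespace AskeyWilson

set_option maxSynthPendingDepth 3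

/-! ### The tridiagonal action of the intermediate Casimir elements -/

section Filtration

open Polynomial

variable {n₁ n₂ n₃ : ℕ} {q s : ℂˣ} {hs : s ^ 2 = q}

local notation "ρ₁₂" => rep₁₂ q s hs n₁ n₂ n₃
local notation "ρ₂₃" => rep₂₃ q s hs n₁ n₂ n₃
local notation "ρ" => rep₁₂₃ q s hs n₁ n₂ n₃
local notation "e" => tensorVec n₁ n₂ n₃
local notation "M" => SpinModule₃ n₁ n₂ n₃
local notation "wt" => weightSpace n₁ n₂ n₃

theorem rep₁₂_casimir_mem (hq : (q : ℂ) ^ 2 - 1 ≠ 0) {k : ℤ} {x : M} (hx : x ∈ wt k) :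
    ρ₁₂ (Uq.casimir q) x ∈ wt k := by
  refine map_mem_of_weightSpace (fun i j l h => ?_) hx
  rw [rep₁₂_casimir_apply hq]
  exact add_mem (add_mem (Submodule.smul_mem _ _ (tensorVec_mem_weightSpace (by omega)))
    (Submodule.smul_mem _ _ (tensorVec_mem_weightSpace (by omega))))
    (Submodule.smul_mem _ _ (tensorVec_mem_weightSpace (by omega)))

variable (n₁ n₂ n₃ q s hs) in
/-- The image of the lowering operator in the weight space. -/
def loweredSpace (k : ℤ) : Submodule ℂ M := (wt (k - 1)).map (ρ (Uq.F q))

local notation "G" => loweredSpace n₁ n₂ n₃ q s hs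

theorem map_mem_loweredSpace {y : Module.End ℂ M} (hy : ∀ x, Commute y (ρ x)) {k : ℤ}
    (hk : ∀ x ∈ wt (k - 1), y x ∈ wt (k - 1)) {x : M} (hx : x ∈ G k) : y x ∈ G k := by
  obtain ⟨u, hu, rfl⟩ := hx
  rw [← Module.End.mul_apply, (hy _).eq, Module.End.mul_apply]
  exact ⟨_, hk u hu, rfl⟩

theorem rep₁₂₃_F_tensorVec_mem {i j l k : ℤ} (h : i + j + l + 1 = k) :
    ρ (Uq.F q) (e i j l) ∈ G k :=
  ⟨_, tensorVec_mem_weightSpace (by omega), rfl⟩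

/-- The lowered vectors together with the vectors `v_0 ⊗ v_j ⊗ v_{l'}` with `l' ≥ l`. -/
def tailSpace (n₁ n₂ n₃ : ℕ) (q s : ℂˣ) (hs : s ^ 2 = q) (k l : ℤ) :
    Submodule ℂ (SpinModule₃ n₁ n₂ n₃) :=
  loweredSpace n₁ n₂ n₃ q s hs k ⊔
    Submodule.span ℂ {x | ∃ l', l ≤ l' ∧ x = tensorVec n₁ n₂ n₃ 0 (k - l') l'}

local notation "Y" => tailSpace n₁ n₂ n₃ q s hs

theorem loweredSpace_le_tailSpace (k l : ℤ) : G k ≤ Y k l := le_sup_left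

theorem tailSpace_le_iff {k l : ℤ} {X : Submodule ℂ M} :
    Y k l ≤ X ↔ G k ≤ X ∧ ∀ l', l ≤ l' → e 0 (k - l') l' ∈ X := by
  rw [tailSpace, sup_le_iff, Submodule.span_le]
  refine and_congr_right fun _ => ⟨fun h l' hl' => h ⟨l', hl', rfl⟩, ?_⟩
  rintro h _ ⟨l', hl', rfl⟩
  exact h l' hl'

theorem mem_of_smul_add_add_mem {V : Type*} [AddCommGroup V] [Module ℂ V] {X : Submodule ℂ V}
    {a b c : ℂ} {x y z : V} (h : a • x + b • y + c • z ∈ X) (ha : a ≠ 0) (hy : y ∈ X)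
    (hz : z ∈ X) : x ∈ X := by
  have h1 := X.sub_mem (X.sub_mem h (X.smul_mem c hz)) (X.smul_mem b hy)
  rw [add_sub_cancel_right, add_sub_cancel_right] at h1
  exact (X.smul_mem_iff ha).1 h1

/-- Modulo the image of `F`, the vector `F (v_i ⊗ v_j ⊗ v_l)` vanishes. This trades the index `i +
1` for smaller first indices without lowering the third, until the first index is `0`. -/
theorem tensorVec_mem_tailSpace (hq : ∀ m : ℕ, 0 < m → q ^ m ≠ 1) {i j l l' k : ℤ} (hl : l ≤ l')
    (h : i + j + l' = k) : e i j l' ∈ Y k l := by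
  rcases lt_or_ge i 0 with hi | hi
  · rw [tensorVec_eq_zero₁ (Or.inl hi)]
    exact zero_mem _
  obtain ⟨t, rfl⟩ := Int.eq_ofNat_of_zero_le hi
  clear hi
  induction t generalizing j l' with
  | zero =>
    have h' : e 0 (k - l') l' ∈ Y k l := (tailSpace_le_iff.1 le_rfl).2 l' hl
    rw [show k - l' = j by push_cast at h; omega] at h'
    simpa using h'
  | succ t ih =>
    obtain ⟨a, b, c, ha, hb, hc, h'⟩ := rep₁₂₃_F_apply (q := q) (hs := hs) (n₁ := n₁) (n₂ := n₂)
      (n₃ := n₃) t j l'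
    have hmem : ρ (Uq.F q) (e t j l') ∈ Y k l :=
      loweredSpace_le_tailSpace _ _ (rep₁₂₃_F_tensorVec_mem (by push_cast at h; omega))
    rw [h'] at hmem
    rw [Nat.cast_succ]
    exact mem_of_smul_add_add_mem hmem (mul_ne_zero ha (qnum_ne_zero hq (by omega)))
      (ih hl (by push_cast at h; omega)) (ih (by omega) (by push_cast at h; omega))

theorem tailSpace_antitone (k : ℤ) {l l' : ℤ} (h : l ≤ l') : Y k l' ≤ Y k l :=
  tailSpace_le_iff.2 ⟨loweredSpace_le_tailSpace _ _, fun m hm =>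
    (tailSpace_le_iff.1 le_rfl).2 m (h.trans hm)⟩

/-- Modulo the image of `F` and larger third indices, `v_i ⊗ v_{j+1} ⊗ v_l` is proportional to
`v_{i+1} ⊗ v_j ⊗ v_l`. Moving all of `j` into the first factor ends at an index beyond `n₁`, hence
at zero. -/
theorem tensorVec_mem_tailSpace_succ (hq : ∀ m : ℕ, 0 < m → q ^ m ≠ 1) {i j l k : ℤ}
    (hij : (n₁ : ℤ) < i + j) (h : i + j + l = k) : e i j l ∈ Y k (l + 1) := by
  rcases lt_or_ge j 0 with hj | hj
  · rw [tensorVec_eq_zero₂ (Or.inl hj)]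
    exact zero_mem _
  obtain ⟨t, rfl⟩ := Int.eq_ofNat_of_zero_le hj
  clear hj
  induction t generalizing i with
  | zero =>
    rw [tensorVec_eq_zero₁ (Or.inr (by push_cast at hij; omega))]
    exact zero_mem _
  | succ t ih =>
    obtain ⟨a, b, c, ha, hb, hc, h'⟩ := rep₁₂₃_F_apply (q := q) (hs := hs) (n₁ := n₁) (n₂ := n₂)
      (n₃ := n₃) i t l
    have hmem : ρ (Uq.F q) (e i t l) ∈ Y k (l + 1) :=
      loweredSpace_le_tailSpace _ _ (rep₁₂₃_F_tensorVec_mem (by push_cast at h; omega))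
    rw [h', add_comm ((a * qnum q (i + 1)) • _)] at hmem
    rw [Nat.cast_succ]
    exact mem_of_smul_add_add_mem hmem (mul_ne_zero hb (qnum_ne_zero hq (by omega)))
      (ih (by push_cast at hij; omega) (by push_cast at h; omega))
      (tensorVec_mem_tailSpace hq le_rfl (by push_cast at h; omega))

/-- The filtration does not jump here: the new vector `v_0 ⊗ v_{k-l} ⊗ v_l` is zero if `k - l > n₂`,
and lies in the next step if `k - l > n₁`. -/
theorem tailSpace_le_succ (hq : ∀ m : ℕ, 0 < m → q ^ m ≠ 1) {k l : ℤ}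
    (h : min (n₁ : ℤ) n₂ < k - l) : Y k l ≤ Y k (l + 1) := by
  refine tailSpace_le_iff.2 ⟨loweredSpace_le_tailSpace _ _, fun l' hl' => ?_⟩
  rcases hl'.eq_or_lt with rfl | hl'
  · rcases min_lt_iff.1 h with h | h
    · exact tensorVec_mem_tailSpace_succ hq (by omega) (by omega)
    · rw [tensorVec_eq_zero₂ (Or.inr h)]
      exact zero_mem _
  · exact tensorVec_mem_tailSpace hq hl' (by omega)

variable (n₁ n₂ q) in
/-- The eigenvalue of the intermediate Casimir element `C₁₂` on highest weight vectors of weight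
`j₁ + j₂ - p`. -/
def casimirEig₁₂ (p : ℤ) : ℂ := casimirEig q (n₁ + n₂ + 1 - 2 * p)

theorem rep₁₂_qH_tensorVec (i j l : ℤ) :
    ρ₁₂ (Uq.qH q) (e i j l) = (s : ℂ) ^ ((n₁ : ℤ) + n₂ - 2 * (i + j)) • e i j l := by
  rw [rep₁₂_qH, Module.End.mul_apply, rep₂_qH_apply, map_smul, rep₁_qH_apply, smul_smul,
    ← zpow_add₀ s.ne_zero]
  congr 2
  ring

theorem rep₁₂_qHinv_tensorVec (i j l : ℤ) :
    ρ₁₂ (Uq.qHinv q) (e i j l) = ((s : ℂ) ^ ((n₁ : ℤ) + n₂ - 2 * (i + j)))⁻¹ • e i j l := by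
  rw [rep₁₂_qHinv, Module.End.mul_apply, rep₂_qHinv_apply, map_smul, rep₁_qHinv_apply, smul_smul,
    ← mul_inv, ← zpow_add₀ s.ne_zero]
  congr 3
  ring

/-- The total `F` is the `F` of the first two factors, up to a scalar on this vector, plus a term
raising the third index. Modulo the image of `F`, the former equals a vector further down the
filtration. -/
theorem rep₁₂_F_tensorVec_mem (hq : ∀ m : ℕ, 0 < m → q ^ m ≠ 1) {i j l k : ℤ}
    (h : i + j + l + 1 = k) : ρ₁₂ (Uq.F q) (e i j l) ∈ Y k (l + 1) := by
  have h1 : ρ (Uq.F q) (e i j l) ∈ Y k (l + 1) :=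
    loweredSpace_le_tailSpace _ _ (rep₁₂₃_F_tensorVec_mem h)
  rw [rep₁₂₃_F, LinearMap.add_apply, Module.End.mul_apply, Module.End.mul_apply,
    rep₃_qHinv_apply, rep₃_F_apply, map_smul, map_smul, rep₁₂_qH_tensorVec] at h1
  rw [Submodule.add_mem_iff_left] at h1
  · exact (Submodule.smul_mem_iff _ (inv_ne_zero (zpow_ne_zero _ s.ne_zero))).1 h1
  · exact Submodule.smul_mem _ _ (Submodule.smul_mem _ _
      (tensorVec_mem_tailSpace hq le_rfl (by omega)))

/-- Triangularity of `C₁₂`: it is a multiple of `F E` on the first two factors plus a scalar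
depending only on `i + j = k - l`, and the `F E` term lands in the next step. -/
theorem rep₁₂_casimir_sub_tensorVec_mem (hq : ∀ m : ℕ, 0 < m → q ^ m ≠ 1) {i j l k : ℤ}
    (h : i + j + l = k) :
    ρ₁₂ (Uq.casimir q) (e i j l) - casimirEig₁₂ n₁ n₂ q (k - l) • e i j l ∈ Y k (l + 1) := by
  rw [casimir_apply_of_weight ρ₁₂ hs (rep₁₂_qH_tensorVec i j l) (rep₁₂_qHinv_tensorVec i j l),
    casimirEig₁₂, show (n₁ : ℤ) + n₂ - 2 * (i + j) + 1 = n₁ + n₂ + 1 - 2 * (k - l) by omega,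
    add_sub_cancel_right]
  refine Submodule.smul_mem _ _ ?_
  rw [rep₁₂_E, LinearMap.add_apply, Module.End.mul_apply, Module.End.mul_apply,
    rep₂_qHinv_apply, rep₂_E_apply, map_smul, map_smul, rep₁_E_apply, rep₁_qH_apply, map_add,
    map_smul, map_smul, map_smul, map_smul]
  exact add_mem
    (Submodule.smul_mem _ _ (Submodule.smul_mem _ _ (rep₁₂_F_tensorVec_mem hq (by omega))))
    (Submodule.smul_mem _ _ (Submodule.smul_mem _ _ (rep₁₂_F_tensorVec_mem hq (by omega))))

theorem rep₁₂_casimir_mem_tailSpace (hq : ∀ m : ℕ, 0 < m → q ^ m ≠ 1) {k l : ℤ} {x : M}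
    (hx : x ∈ Y k l) : ρ₁₂ (Uq.casimir q) x ∈ Y k l := by
  have hq' := sq_sub_one_ne_zero hq
  suffices h : Y k l ≤ (Y k l).comap (ρ₁₂ (Uq.casimir q)) from h hx
  refine tailSpace_le_iff.2 ⟨fun y hy => loweredSpace_le_tailSpace _ _ ?_, fun l' hl' => ?_⟩
  · exact map_mem_loweredSpace (commute_rep₁₂_casimir hq') (fun _ => rep₁₂_casimir_mem hq') hy
  · have h1 := tailSpace_antitone k (by omega : l ≤ l' + 1)
      (rep₁₂_casimir_sub_tensorVec_mem (hs := hs) (n₁ := n₁) (n₂ := n₂) (n₃ := n₃) hq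
      (show 0 + (k - l') + l' = k by ring))
    have h2 : e 0 (k - l') l' ∈ Y k l := tensorVec_mem_tailSpace hq hl' (by omega)
    exact ((Y k l).sub_mem_iff_left (Submodule.smul_mem _ _ h2)).1 h1

theorem rep₁₂_casimir_sub_mem_tailSpace (hq : ∀ m : ℕ, 0 < m → q ^ m ≠ 1) {k l : ℤ} {x : M}
    (hx : x ∈ Y k l) :
    (ρ₁₂ (Uq.casimir q) - casimirEig₁₂ n₁ n₂ q (k - l) • 1) x ∈ Y k (l + 1) := by
  have hq' := sq_sub_one_ne_zero hq
  suffices h : Y k l ≤ (Y k (l + 1)).comap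
    (ρ₁₂ (Uq.casimir q) - casimirEig₁₂ n₁ n₂ q (k - l) • 1) from h hx
  refine tailSpace_le_iff.2 ⟨fun y hy => loweredSpace_le_tailSpace _ _ ?_, fun l' hl' => ?_⟩
  · exact Submodule.sub_mem _ (map_mem_loweredSpace (commute_rep₁₂_casimir hq')
      (fun _ => rep₁₂_casimir_mem hq') hy) (Submodule.smul_mem _ _ hy)
  · rcases hl'.eq_or_lt with rfl | hl'
    · exact rep₁₂_casimir_sub_tensorVec_mem hq (by omega)
    · have h2 : e 0 (k - l') l' ∈ Y k (l + 1) := tensorVec_mem_tailSpace hq hl' (by omega)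
      exact Submodule.sub_mem _ (rep₁₂_casimir_mem_tailSpace hq h2) (Submodule.smul_mem _ _ h2)

variable (n₁ n₂ q) in
/-- The product of the linear factors of `C₁₂` at the eigenvalues on highest weight vectors of
weight `j₁ + j₂ - k + l` with `l < c`. -/
def tailPoly (k : ℤ) (c : ℕ) : ℂ[X] :=
  ∏ l ∈ Finset.range c,
    if k - (l : ℤ) ≤ min (n₁ : ℤ) n₂ then X - C (casimirEig₁₂ n₁ n₂ q (k - (l : ℤ))) else 1

/-- Each linear factor advances the filtration by one step. Where the polynomial has the factor `1`,
the two steps already coincide. -/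
theorem aeval_tailPoly_mem (hq : ∀ m : ℕ, 0 < m → q ^ m ≠ 1) {k : ℤ} (c : ℕ) {x : M}
    (hx : x ∈ Y k 0) : aeval (ρ₁₂ (Uq.casimir q)) (tailPoly n₁ n₂ q k c) x ∈ Y k c := by
  induction c with
  | zero => simpa [tailPoly] using hx
  | succ c ih =>
    rw [tailPoly, Finset.prod_range_succ, mul_comm, map_mul, Module.End.mul_apply, Nat.cast_succ]
    split_ifs with h
    · rw [map_sub, aeval_X, aeval_C, Algebra.algebraMap_eq_smul_one]
      exact rep₁₂_casimir_sub_mem_tailSpace hq ih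
    · rw [map_one, Module.End.one_apply]
      exact tailSpace_le_succ hq (not_le.1 h) ih

/-- The restriction to `k - l ≤ min n₁ n₂` in `tailPoly` keeps all exponents positive, which rules
out coincidences `a = -b` between eigenvalues. -/
theorem eval_tailPoly_ne_zero (hq : ∀ m : ℕ, 0 < m → q ^ m ≠ 1) {k : ℤ} (c : ℕ)
    (h : k - c ≤ min (n₁ : ℤ) n₂) :
    (tailPoly n₁ n₂ q k c).eval (casimirEig₁₂ n₁ n₂ q (k - c)) ≠ 0 := by
  rw [tailPoly, eval_prod, Finset.prod_ne_zero_iff]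
  intro l hl
  rw [Finset.mem_range] at hl
  split_ifs with h'
  · rw [eval_sub, eval_X, eval_C, sub_ne_zero]
    intro h2
    rcases eq_or_eq_neg_of_casimirEig_eq hq h2 with h3 | h3 <;> omega
  · simp

theorem weightSpace_le_tailSpace (hq : ∀ m : ℕ, 0 < m → q ^ m ≠ 1) (k : ℤ) : wt k ≤ Y k 0 := by
  refine Submodule.span_le.2 ?_
  rintro _ ⟨i, j, l, h, rfl⟩
  rcases lt_or_ge l 0 with hl | hl
  · rw [tensorVec_eq_zero₃ (Or.inl hl)]
    exact zero_mem _
  · exact tensorVec_mem_tailSpace hq hl h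

variable (n₃) in
/-- The largest index of the third factor in the weight space. -/
def topIndex (k : ℕ) : ℕ := min k n₃

variable (n₁ n₂ n₃) in
/-- The vector `v_0 ⊗ v_{k-c} ⊗ v_c` with `c` as large as possible. -/
def topVec (k : ℕ) : M := e 0 ((k : ℤ) - topIndex n₃ k) (topIndex n₃ k)

local notation "x₀" => topVec n₁ n₂ n₃

theorem tensorVec_eq_zero_of_topIndex_lt {k : ℕ} {l : ℤ} (h : (topIndex n₃ k : ℤ) < l) :
    e 0 ((k : ℤ) - l) l = 0 := by
  rw [topIndex] at h
  rcases min_lt_iff.1 (by exact_mod_cast h : min (k : ℤ) n₃ < l) with h | h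
  · exact tensorVec_eq_zero₂ (Or.inl (by omega)) _ _
  · exact tensorVec_eq_zero₃ (Or.inr h) _ _

theorem tailSpace_topIndex_le (k : ℕ) : Y k (topIndex n₃ k) ≤ G k ⊔ ℂ ∙ x₀ k := by
  refine tailSpace_le_iff.2 ⟨le_sup_left, fun l hl => ?_⟩
  rcases hl.eq_or_lt with rfl | hl
  · exact Submodule.mem_sup_right (Submodule.mem_span_singleton_self _)
  · rw [tensorVec_eq_zero_of_topIndex_lt hl]
    exact zero_mem _

theorem tailSpace_topIndex_succ_le (k : ℕ) : Y k (topIndex n₃ k + 1) ≤ G k := by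
  refine tailSpace_le_iff.2 ⟨le_rfl, fun l hl => ?_⟩
  rw [tensorVec_eq_zero_of_topIndex_lt hl]
  exact zero_mem _

theorem topVec_mem_tailSpace (hq : ∀ m : ℕ, 0 < m → q ^ m ≠ 1) (k : ℕ) :
    x₀ k ∈ Y k (topIndex n₃ k) := tensorVec_mem_tailSpace hq le_rfl (by omega)

/-- Cyclicity: `C₂₃` leaves the first index at `0` and its coefficient lowering the third index is
nonzero, so repeated application produces every `v_0 ⊗ v_{k-l} ⊗ v_l` from `topVec`. -/
theorem weightSpace_le_of_invariant (hq : ∀ m : ℕ, 0 < m → q ^ m ≠ 1) (k : ℕ)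
    {X : Submodule ℂ M} (hX : ∀ x ∈ X, ρ₂₃ (Uq.casimir q) x ∈ X) (hx : x₀ k ∈ X) :
    wt (k : ℤ) ≤ G k ⊔ X := by
  set c := topIndex n₃ k with hc
  have hcn : c ≤ n₃ := min_le_right _ _
  have hck : c ≤ k := min_le_left _ _
  -- The action has three terms, so two neighbouring vectors are carried along. At the start the
  -- upper neighbour has index `c + 1` and is zero.
  have key : ∀ t : ℕ, e 0 (k - (c - t)) (c - t) ∈ X ∧ e 0 (k - (c - t + 1)) (c - t + 1) ∈ X := by
    intro t
    induction t with
    | zero =>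
      refine ⟨by simpa [topVec] using hx, ?_⟩
      rw [tensorVec_eq_zero_of_topIndex_lt (by push_cast; omega)]
      exact zero_mem _
    | succ t ih =>
      have e1 : (c : ℤ) - (t + 1 : ℕ) + 1 = c - t := by push_cast; ring
      rw [e1]
      refine ⟨?_, ih.1⟩
      have h1 := hX _ ih.1
      rw [rep₂₃_casimir_apply (sq_sub_one_ne_zero hq),
        show (k : ℤ) - (c - t) + 1 = k - (c - (t + 1 : ℕ)) by push_cast; ring,
        show (k : ℤ) - (c - t) - 1 = k - (c - t + 1) by ring,
        show (c : ℤ) - t - 1 = c - (t + 1 : ℕ) by push_cast; ring,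
        add_comm (_ • e 0 (k - (c - t)) (c - t))] at h1
      refine mem_of_smul_add_add_mem h1 ?_ ih.1 ih.2
      have hκ := sub_inv_ne_zero hq
      -- The lowering coefficient contains `[j + 1]_q` and `[n₃ - l + 1]_q` with `l = c - t` and `j
      -- = k - l`. Both arguments are positive because `c ≤ k` and `c ≤ n₃`.
      have h2 := qnum_ne_zero hq (a := (k : ℤ) - (c - t) + 1) (by omega)
      have h3 := qnum_ne_zero hq (a := (n₃ : ℤ) - (c - t) + 1) (by omega)
      rw [qnum_raise] at h2
      rw [qnum_lower hs] at h3
      have h0 := q.ne_zero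
      have h0' := s.ne_zero
      exact mul_ne_zero (mul_ne_zero (mul_ne_zero (mul_ne_zero (div_ne_zero_iff.1 h2).1
        (div_ne_zero_iff.1 h3).1) (div_ne_zero (pow_ne_zero _ h0') (zpow_ne_zero _ h0)))
        (div_ne_zero (zpow_ne_zero _ h0) (pow_ne_zero _ h0'))) (inv_ne_zero h0)
  refine (weightSpace_le_tailSpace (hs := hs) hq k).trans
    (tailSpace_le_iff.2 ⟨le_sup_left, fun l hl => ?_⟩)
  rcases lt_or_ge (c : ℤ) l with h | h
  · rw [tensorVec_eq_zero_of_topIndex_lt h]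
    exact zero_mem _
  · have := (key (c - l).toNat).1
    rw [show (c : ℤ) - ((c - l).toNat : ℕ) = l by omega] at this
    exact Submodule.mem_sup_right this

end Filtration

end AskeyWilson

end

noncomputable section

namespace AskeyWilson

/-! ### Equality of the Casimir algebra and the centralizer -/

section Surjectivity

set_option maxSynthPendingDepth 3

open Polynomial

variable {n₁ n₂ n₃ : ℕ} {q s : ℂˣ} {hs : s ^ 2 = q}

local notation "ρ₁" => rep₁ q s hs n₁ n₂ n₃
local notation "ρ₂" => rep₂ q s hs n₁ n₂ n₃
local notation "ρ₃" => rep₃ q s hs n₁ n₂ n₃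
local notation "ρ₁₂" => rep₁₂ q s hs n₁ n₂ n₃
local notation "ρ₂₃" => rep₂₃ q s hs n₁ n₂ n₃
local notation "ρ" => rep₁₂₃ q s hs n₁ n₂ n₃
local notation "e" => tensorVec n₁ n₂ n₃
local notation "M" => SpinModule₃ n₁ n₂ n₃
local notation "wt" => weightSpace n₁ n₂ n₃
local notation "N" => ((n₁ : ℤ) + n₂ + n₃)
local notation "hw" => highestWeightSpace n₁ n₂ n₃ q s hs
local notation "T" => hwProj n₁ n₂ n₃ q s hs
local notation "G" => loweredSpace n₁ n₂ n₃ q s hs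
local notation "x₀" => topVec n₁ n₂ n₃
local notation "β" => tensorForm q n₁ n₂ n₃
local notation "t" => hwScalar n₁ n₂ n₃ q

variable (n₁ n₂ n₃ q s hs) in
/-- The algebra generated by the intermediate Casimir elements. -/
def casimirAlgebra : Subalgebra ℂ (Module.End ℂ M) :=
  Algebra.adjoin ℂ {ρ₁₂ (Uq.casimir q), ρ₂₃ (Uq.casimir q), ρ (Uq.casimir q)}

local notation "𝒜" => casimirAlgebra n₁ n₂ n₃ q s hs
local notation "𝒞" => spinCentralizer q s hs n₁ n₂ n₃

theorem rep₁₂_casimir_mem_casimirAlgebra : ρ₁₂ (Uq.casimir q) ∈ 𝒜 :=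
  Algebra.subset_adjoin (Or.inl rfl)

theorem rep₂₃_casimir_mem_casimirAlgebra : ρ₂₃ (Uq.casimir q) ∈ 𝒜 :=
  Algebra.subset_adjoin (Or.inr (Or.inl rfl))

theorem rep₁₂₃_casimir_mem_casimirAlgebra : ρ (Uq.casimir q) ∈ 𝒜 :=
  Algebra.subset_adjoin (Or.inr (Or.inr rfl))

theorem aeval_mem_casimirAlgebra {y : Module.End ℂ M} (hy : y ∈ 𝒜) (p : ℂ[X]) :
    aeval y p ∈ 𝒜 :=
  (Algebra.adjoin_le (Set.singleton_subset_iff.2 hy)) (aeval_mem_adjoin_singleton ℂ y)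

theorem isFormAdjoint_aeval {y : Module.End ℂ M} (hy : IsFormAdjoint q y y) (p : ℂ[X]) :
    IsFormAdjoint q (aeval y p) (aeval y p) := by
  induction p using Polynomial.induction_on' with
  | add p r hp hr => rw [map_add]; exact hp.add hr
  | monomial n a =>
    have hn : IsFormAdjoint q (y ^ n) (y ^ n) := by
      induction n with
      | zero => exact fun _ _ => rfl
      | succ n ih =>
        -- Adjunction reverses products, so the two copies of the power are unfolded from opposite
        -- ends.
        nth_rewrite 2 [pow_succ']
        rw [pow_succ]
        exact ih.mul hy
    rw [aeval_monomial, Algebra.algebraMap_eq_smul_one, smul_mul_assoc, one_mul]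
    exact hn.smul a

theorem rep₁₂_casimir_adjoint (hq : ∀ m : ℕ, 0 < m → q ^ m ≠ 1) :
    IsFormAdjoint q (ρ₁₂ (Uq.casimir q)) (ρ₁₂ (Uq.casimir q)) :=
  .map_casimir (rep₁₂_E_adjoint hq) rep₁₂_qH_adjoint rep₁₂_qHinv_adjoint

theorem rep₂₃_casimir_adjoint (hq : ∀ m : ℕ, 0 < m → q ^ m ≠ 1) :
    IsFormAdjoint q (ρ₂₃ (Uq.casimir q)) (ρ₂₃ (Uq.casimir q)) :=
  .map_casimir (rep₂₃_E_adjoint hq) rep₂₃_qH_adjoint rep₂₃_qHinv_adjoint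

theorem rep₁₂₃_casimir_adjoint (hq : ∀ m : ℕ, 0 < m → q ^ m ≠ 1) :
    IsFormAdjoint q (ρ (Uq.casimir q)) (ρ (Uq.casimir q)) :=
  .map_casimir (rep₁₂₃_E_adjoint hq) rep₁₂₃_qH_adjoint rep₁₂₃_qHinv_adjoint

theorem exists_adjoint_mem_casimirAlgebra (hq : ∀ m : ℕ, 0 < m → q ^ m ≠ 1)
    {y : Module.End ℂ M} (hy : y ∈ 𝒜) : ∃ y' ∈ 𝒜, IsFormAdjoint q y y' := by
  rw [casimirAlgebra] at hy
  induction hy using Algebra.adjoin_induction with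
  | mem y hy =>
    rcases hy with rfl | rfl | rfl
    · exact ⟨_, rep₁₂_casimir_mem_casimirAlgebra, rep₁₂_casimir_adjoint hq⟩
    · exact ⟨_, rep₂₃_casimir_mem_casimirAlgebra, rep₂₃_casimir_adjoint hq⟩
    · exact ⟨_, rep₁₂₃_casimir_mem_casimirAlgebra, rep₁₂₃_casimir_adjoint hq⟩
  | algebraMap c =>
    refine ⟨algebraMap ℂ _ c, Subalgebra.algebraMap_mem _ c, fun x z => ?_⟩
    simp only [Module.algebraMap_end_apply, map_smul, LinearMap.smul_apply]
  | add y z _ _ hy hz =>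
    obtain ⟨y', hy', hy⟩ := hy
    obtain ⟨z', hz', hz⟩ := hz
    exact ⟨_, add_mem hy' hz', hy.add hz⟩
  | mul y z _ _ hy hz =>
    obtain ⟨y', hy', hy⟩ := hy
    obtain ⟨z', hz', hz⟩ := hz
    exact ⟨_, mul_mem hz' hy', hy.mul hz⟩

theorem casimirAlgebra_le (hq : ∀ m : ℕ, 0 < m → q ^ m ≠ 1) : 𝒜 ≤ 𝒞 :=
  adjoin_le_spinCentralizer (sq_sub_one_ne_zero hq)

theorem tensorForm_eq_zero_of_weight (hq : ∀ m : ℕ, 0 < m → q ^ m ≠ 1) {k : ℤ} {x : M}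
    (hx : ρ (Uq.qH q) x = (s : ℂ) ^ (N - 2 * k) • x) {i j l : ℤ} (h : i + j + l ≠ k) :
    β (e i j l) x = 0 := by
  have h1 := rep₁₂₃_qH_adjoint (hs := hs) (e i j l) x
  rw [rep₁₂₃_qH_apply (tensorVec_mem_weightSpace rfl), hx, map_smul, map_smul,
    LinearMap.smul_apply, smul_eq_mul, smul_eq_mul, ← sub_eq_zero, ← sub_mul] at h1
  refine (mul_eq_zero.1 h1).resolve_left fun h2 => ?_
  refine zpow_ne_one hq (sub_ne_zero.2 h.symm) ?_
  have h3 : (q : ℂ) = (s : ℂ) ^ (2 : ℤ) := by rw [← hs]; norm_cast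
  rw [h3, ← zpow_mul, show 2 * (k - (i + j + l)) = (N - 2 * (i + j + l)) - (N - 2 * k) by ring,
    zpow_sub₀ s.ne_zero, sub_eq_zero.1 h2, div_self (zpow_ne_zero _ s.ne_zero)]

/-- By self-adjointness of `q^H`, an eigenvector pairs to zero with every basis vector of another
weight, so only basis vectors of level `k` occur in its expansion. Elements of the centralizer
therefore preserve weight spaces. -/
theorem mem_weightSpace_of_qH (hq : ∀ m : ℕ, 0 < m → q ^ m ≠ 1) {k : ℤ} {x : M}
    (hx : ρ (Uq.qH q) x = (s : ℂ) ^ (N - 2 * k) • x) : x ∈ wt k := by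
  obtain ⟨c, hc⟩ := tensorForm_expansion (n₁ := n₁) (n₂ := n₂) (n₃ := n₃) hq
  rw [hc x]
  refine Submodule.sum_mem _ fun a _ => ?_
  rw [tensorBasis_apply]
  by_cases h : ((a.1.1 : ℕ) + (a.1.2 : ℕ) + (a.2 : ℕ) : ℤ) = k
  · exact Submodule.smul_mem _ _ (tensorVec_mem_weightSpace h)
  · rw [tensorForm_eq_zero_of_weight hq hx h, mul_zero, zero_smul]
    exact zero_mem _

theorem centralizer_apply_mem (hq : ∀ m : ℕ, 0 < m → q ^ m ≠ 1) {y : Module.End ℂ M}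
    (hy : y ∈ 𝒞) {k : ℤ} {x : M} (hx : x ∈ hw k) : y x ∈ hw k := by
  have h := mem_spinCentralizer_iff.1 hy
  refine ⟨mem_weightSpace_of_qH (hs := hs) hq ?_, ?_⟩
  · rw [← Module.End.mul_apply, ← (h _).eq, Module.End.mul_apply, rep₁₂₃_qH_apply hx.1, map_smul]
  · rw [SetLike.mem_coe, LinearMap.mem_ker, ← Module.End.mul_apply, ← (h _).eq,
      Module.End.mul_apply, LinearMap.mem_ker.1 hx.2, map_zero]

/-- The projection of `topVec` onto highest weight vectors. -/
def topHw (n₁ n₂ n₃ : ℕ) (q s : ℂˣ) (hs : s ^ 2 = q) (k : ℕ) : SpinModule₃ n₁ n₂ n₃ :=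
  hwProj n₁ n₂ n₃ q s hs k (topVec n₁ n₂ n₃ k)

local notation "x₁" => topHw n₁ n₂ n₃ q s hs

theorem centralizer_hwProj_apply {y : Module.End ℂ M} (hy : y ∈ 𝒞) (k : ℕ) (x : M) :
    T k (y x) = y (T k x) := by
  rw [← Module.End.mul_apply, ← (hwProj_commute hy k).eq, Module.End.mul_apply]

/-- Write `w` as an element of `G k` plus `y x₀` with `y ∈ 𝒜`, and apply `T k`: it kills the first
term, commutes with `y`, and scales `w` by a nonzero number. -/
theorem exists_apply_topHw (hq : ∀ m : ℕ, 0 < m → q ^ m ≠ 1) {k : ℕ} (hk : 2 * (k : ℤ) ≤ N)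
    {w : M} (hw' : w ∈ hw (k : ℤ)) : ∃ y ∈ 𝒜, w = y (x₁ k) := by
  have hq' := sq_sub_one_ne_zero hq
  let X : Submodule ℂ M := (Subalgebra.toSubmodule 𝒜).map (LinearMap.applyₗ (x₀ k))
  have hX : wt (k : ℤ) ≤ G k ⊔ X := by
    refine weightSpace_le_of_invariant hq k ?_ ⟨1, Subalgebra.one_mem 𝒜, rfl⟩
    rintro _ ⟨y, hy, rfl⟩
    exact ⟨ρ₂₃ (Uq.casimir q) * y, Subalgebra.mul_mem 𝒜 rep₂₃_casimir_mem_casimirAlgebra hy, rfl⟩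
  obtain ⟨g, hg, _, ⟨y, hy, rfl⟩, h⟩ := Submodule.mem_sup.1 (hX hw'.1)
  have h1 : T k w = y (x₁ k) := by
    rw [← h, map_add, hwProj_of_mem_map hq' k hg, zero_add]
    exact centralizer_hwProj_apply (casimirAlgebra_le hq hy) k _
  rw [hwProj_of_mem_highestWeightSpace k hw'] at h1
  refine ⟨(t k)⁻¹ • y, Subalgebra.smul_mem _ hy _, ?_⟩
  rw [LinearMap.smul_apply, ← h1, smul_smul, inv_mul_cancel₀ (hwScalar_ne_zero hq hk), one_smul]

/-- At the last filtration step the error of triangularity lies in `G k`, and `T k` removes it. -/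
theorem rep₁₂_casimir_topHw (hq : ∀ m : ℕ, 0 < m → q ^ m ≠ 1) (k : ℕ) :
    ρ₁₂ (Uq.casimir q) (x₁ k) = casimirEig₁₂ n₁ n₂ q (k - topIndex n₃ k) • x₁ k := by
  have hq' := sq_sub_one_ne_zero hq
  have h := hwProj_of_mem_map (hs := hs) hq' k (tailSpace_topIndex_succ_le k
    (rep₁₂_casimir_sub_mem_tailSpace hq
      (topVec_mem_tailSpace (n₁ := n₁) (n₂ := n₂) (n₃ := n₃) hq k)))
  rw [LinearMap.sub_apply, map_sub, sub_eq_zero, LinearMap.smul_apply, Module.End.one_apply,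
    map_smul,
    centralizer_hwProj_apply (mem_spinCentralizer_iff.2 (commute_rep₁₂_casimir hq'))] at h
  exact h

/-- The polynomial in `C₁₂` pushes `wt k` to the last filtration step, which is `G k` plus the line
of `topVec`; `T k` turns this into the line of `topHw`. -/
theorem exists_aeval_tailPoly (hq : ∀ m : ℕ, 0 < m → q ^ m ≠ 1) {k : ℕ} (hk : 2 * (k : ℤ) ≤ N)
    {w : M} (hw' : w ∈ hw (k : ℤ)) :
    ∃ c : ℂ, aeval (ρ₁₂ (Uq.casimir q)) (tailPoly n₁ n₂ q k (topIndex n₃ k)) w = c • x₁ k := by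
  have hq' := sq_sub_one_ne_zero hq
  have h := tailSpace_topIndex_le (hs := hs) (n₁ := n₁) (n₂ := n₂) k (aeval_tailPoly_mem hq
    (topIndex n₃ k) (weightSpace_le_tailSpace (hs := hs) hq _ hw'.1))
  obtain ⟨g, hg, z, hz, h⟩ := Submodule.mem_sup.1 h
  obtain ⟨c, rfl⟩ := Submodule.mem_span_singleton.1 hz
  refine ⟨(t k)⁻¹ * c, ?_⟩
  have h1 := congrArg (T k) h
  rw [map_add, hwProj_of_mem_map hq' k hg, zero_add, map_smul, centralizer_hwProj_apply
    (casimirAlgebra_le hq (aeval_mem_casimirAlgebra rep₁₂_casimir_mem_casimirAlgebra _)),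
    hwProj_of_mem_highestWeightSpace k hw', map_smul] at h1
  rw [mul_smul]
  change _ = (t k)⁻¹ • c • T k (x₀ k)
  rw [h1, smul_smul, inv_mul_cancel₀ (hwScalar_ne_zero hq hk), one_smul]

/-- In this range the last filtration step is already contained in `G k`. Together with
`exists_apply_topHw` it forces the highest weight space to vanish when `2k ≤ n₁ + n₂ + n₃`. -/
theorem topHw_eq_zero (hq : ∀ m : ℕ, 0 < m → q ^ m ≠ 1) {k : ℕ}
    (h : min (n₁ : ℤ) n₂ < k - topIndex n₃ k) : x₁ k = 0 :=
  hwProj_of_mem_map (sq_sub_one_ne_zero hq) k (tailSpace_topIndex_succ_le k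
    (tailSpace_le_succ hq h (topVec_mem_tailSpace hq k)))

/-- On highest weight vectors, the algebra generated by the intermediate Casimir elements contains
every operator of rank one. -/
theorem exists_rankOne (hq : ∀ m : ℕ, 0 < m → q ^ m ≠ 1) {k : ℕ} (hk : 2 * (k : ℤ) ≤ N)
    {y z : M} (hy : y ∈ hw (k : ℤ)) (hz : z ∈ hw (k : ℤ)) :
    ∃ a ∈ 𝒜, ∀ w ∈ hw (k : ℤ), a w = β y w • z := by
  obtain ⟨f, hf, rfl⟩ := exists_apply_topHw hq hk hy
  obtain ⟨g, hg, rfl⟩ := exists_apply_topHw hq hk hz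
  rcases lt_or_ge (min (n₁ : ℤ) n₂) (k - topIndex n₃ k) with h | h
  · refine ⟨0, zero_mem _, fun w _ => ?_⟩
    simp only [topHw_eq_zero hq h, map_zero, LinearMap.zero_apply, zero_smul]
  obtain ⟨f', hf', hff'⟩ := exists_adjoint_mem_casimirAlgebra hq hf
  set P := aeval (ρ₁₂ (Uq.casimir q)) (tailPoly n₁ n₂ q k (topIndex n₃ k)) with hP
  set η := (tailPoly n₁ n₂ q k (topIndex n₃ k)).eval
    (casimirEig₁₂ n₁ n₂ q (k - topIndex n₃ k)) with hη
  have hη0 : η ≠ 0 := eval_tailPoly_ne_zero hq _ h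
  have hPx : P (x₁ k) = η • x₁ k :=
    Module.End.aeval_apply_of_mem_apply_eq_smul (rep₁₂_casimir_topHw hq k)
  -- If `P v = c x₁`, self-adjointness of `P` gives `c β(x₁, x₁) = η β(x₁, v)`. Keeping `β(x₁, x₁)`
  -- as a factor, and dividing only by `η`, avoids having to show that it is nonzero. With `v = f'
  -- w`, adjointness gives `β(x₁, f' w) = β(f x₁, w)`.
  refine ⟨(η⁻¹ * β (x₁ k) (x₁ k)) • (g * (P * f')), Subalgebra.smul_mem _ (mul_mem hg
    (mul_mem (aeval_mem_casimirAlgebra rep₁₂_casimir_mem_casimirAlgebra _) hf')) _,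
    fun w hw' => ?_⟩
  have hw'' : f' w ∈ hw (k : ℤ) := centralizer_apply_mem hq (casimirAlgebra_le hq hf') hw'
  obtain ⟨c, hc⟩ := exists_aeval_tailPoly hq hk hw''
  have h1 := isFormAdjoint_aeval (rep₁₂_casimir_adjoint (hs := hs) hq)
    (tailPoly n₁ n₂ q k (topIndex n₃ k)) (x₁ k) (f' w)
  rw [← hP] at h1 hc
  rw [hPx, hc, map_smul, map_smul, LinearMap.smul_apply, smul_eq_mul, smul_eq_mul] at h1
  rw [LinearMap.smul_apply, Module.End.mul_apply, Module.End.mul_apply, hc, map_smul, smul_smul,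
    hff']
  congr 1
  field_simp
  linear_combination -h1

/-- Applying `T k` to the expansion of `w` in the standard basis writes `t k • w` as a sum of terms
`β(b, w) T k b`. After applying `y`, each term is a rank one operator on `hw k` and lies in `𝒜`. -/
theorem exists_eq_on_highestWeightSpace (hq : ∀ m : ℕ, 0 < m → q ^ m ≠ 1) {k : ℕ}
    (hk : 2 * (k : ℤ) ≤ N) {y : Module.End ℂ M} (hy : y ∈ 𝒞) :
    ∃ a ∈ 𝒜, ∀ w ∈ hw (k : ℤ), a w = y w := by
  have hq' := sq_sub_one_ne_zero hq
  have ht := hwScalar_ne_zero (n₁ := n₁) (n₂ := n₂) (n₃ := n₃) hq hk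
  obtain ⟨c, hc⟩ := tensorForm_expansion (n₁ := n₁) (n₂ := n₂) (n₃ := n₃) hq
  have hT : IsFormAdjoint q (T k) (T k) := isFormAdjoint_aeval (rep₁₂₃_casimir_adjoint hq) _
  have h : ∀ b, ∃ a ∈ 𝒜, ∀ w ∈ hw (k : ℤ), a w =
      (c b * β (tensorBasis n₁ n₂ n₃ b) w) • y (T k (tensorBasis n₁ n₂ n₃ b)) := by
    intro b
    by_cases hb : ((b.1.1 : ℕ) + (b.1.2 : ℕ) + (b.2 : ℕ) : ℤ) = k
    · have hb' : tensorBasis n₁ n₂ n₃ b ∈ wt (k : ℤ) := by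
        rw [tensorBasis_apply]
        exact tensorVec_mem_weightSpace hb
      have hTb := hwProj_mem (hs := hs) hq' k hb'
      obtain ⟨a, ha, ha'⟩ := exists_rankOne hq hk hTb (centralizer_apply_mem hq hy hTb)
      -- The inverse cancels the scalar in `β(T b, w) = β(b, T w) = t β(b, w)`; the one used after
      -- the sum comes instead from `T w = t w`.
      refine ⟨(c b * (t k)⁻¹) • a, Subalgebra.smul_mem _ ha _, fun w hw' => ?_⟩
      rw [LinearMap.smul_apply, ha' w hw', smul_smul, hT,
        hwProj_of_mem_highestWeightSpace k hw', map_smul, smul_eq_mul]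
      congr 1
      field_simp
    · refine ⟨0, zero_mem _, fun w hw' => ?_⟩
      rw [tensorBasis_apply, tensorForm_eq_zero_of_weight hq (rep₁₂₃_qH_apply (hs := hs) hw'.1) hb,
        mul_zero, zero_smul, LinearMap.zero_apply]
  choose a ha ha' using h
  refine ⟨(t k)⁻¹ • ∑ b, a b, Subalgebra.smul_mem _ (sum_mem fun b _ => ha b) _,
    fun w hw' => ?_⟩
  have h1 : T k w = ∑ b, (c b * β (tensorBasis n₁ n₂ n₃ b) w) • T k (tensorBasis n₁ n₂ n₃ b) := by
    conv_lhs => rw [hc w]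
    simp only [map_sum, map_smul]
  rw [hwProj_of_mem_highestWeightSpace k hw'] at h1
  have h2 := congrArg y h1
  rw [map_smul, map_sum] at h2
  simp only [map_smul] at h2
  rw [LinearMap.smul_apply, LinearMap.sum_apply, Finset.sum_congr rfl fun b _ => ha' b w hw', ← h2,
    smul_smul, inv_mul_cancel₀ ht, one_smul]

/-- The levels are treated in increasing order, since `T K` kills the highest weight vectors of all
levels below `K`. The bound on `K` says that each level `k < K` satisfies `2k ≤ n₁ + n₂ + n₃`. -/
theorem exists_eq_on_highestWeightSpaces (hq : ∀ m : ℕ, 0 < m → q ^ m ≠ 1)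
    {y : Module.End ℂ M} (hy : y ∈ 𝒞) (K : ℕ) (hK : 2 * (K : ℤ) ≤ N + 2) :
    ∃ a ∈ 𝒜, ∀ k < K, ∀ w ∈ hw (k : ℤ), a w = y w := by
  induction K with
  | zero => exact ⟨0, zero_mem _, fun k hk => absurd hk (Nat.not_lt_zero k)⟩
  | succ K ih =>
    obtain ⟨a, ha, haw⟩ := ih (by push_cast at hK; omega)
    have hK' : 2 * (K : ℤ) ≤ N := by push_cast at hK; omega
    have ht := hwScalar_ne_zero (n₁ := n₁) (n₂ := n₂) (n₃ := n₃) hq hK'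
    obtain ⟨b, hb, hbw⟩ := exists_eq_on_highestWeightSpace hq hK'
      (sub_mem hy (casimirAlgebra_le hq ha))
    have hT : T K ∈ 𝒜 := aeval_mem_casimirAlgebra rep₁₂₃_casimir_mem_casimirAlgebra _
    -- The correction vanishes on the earlier levels and equals `b`, hence `y - a`, on level `K`.
    refine ⟨a + (t K)⁻¹ • (b * T K), add_mem ha (Subalgebra.smul_mem _ (mul_mem hb hT) _),
      fun k hk w hw' => ?_⟩
    rw [LinearMap.add_apply, LinearMap.smul_apply, Module.End.mul_apply]
    rcases Nat.lt_succ_iff_lt_or_eq.1 hk with hk | rfl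
    · rw [hwProj_of_mem_highestWeightSpace_of_lt hk hw', map_zero, smul_zero, add_zero,
        haw k hk w hw']
    · rw [hwProj_of_mem_highestWeightSpace k hw', map_smul, smul_smul, inv_mul_cancel₀ ht, one_smul,
        hbw w hw', LinearMap.sub_apply, add_sub_cancel]

/-- Induction on the level. If `y` kills `wt k` and `x ∈ wt (k + 1)`, then `E (y x) = y (E x) = 0`,
so `y x` is a highest weight vector; up to a nonzero scalar it equals `T (y x) = y (T x)`, which is
zero by hypothesis. Levels too high for the scalar to be controlled have no highest weight vectors.
-/
theorem centralizer_eq_zero (hq : ∀ m : ℕ, 0 < m → q ^ m ≠ 1) {y : Module.End ℂ M} (hy : y ∈ 𝒞)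
    (h : ∀ k : ℕ, 2 * (k : ℤ) ≤ N → ∀ w ∈ hw (k : ℤ), y w = 0) : y = 0 := by
  have hq' := sq_sub_one_ne_zero hq
  have hy' := mem_spinCentralizer_iff.1 hy
  have key : ∀ k : ℕ, ∀ x ∈ wt (k : ℤ), y x = 0 := by
    intro k
    induction k with
    | zero =>
      intro x hx
      refine h 0 (by positivity) x ⟨hx, ?_⟩
      have := rep₁₂₃_E_mem (hs := hs) hx
      rwa [weightSpace_eq_bot (by omega), Submodule.mem_bot] at this
    | succ k ih =>
      intro x hx
      have hEx := rep₁₂₃_E_mem (hs := hs) hx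
      rw [Nat.cast_succ, add_sub_cancel_right] at hEx
      have hyx : y x ∈ hw ((k + 1 : ℕ) : ℤ) := by
        refine ⟨mem_weightSpace_of_qH (hs := hs) hq ?_, ?_⟩
        · rw [← Module.End.mul_apply, ← (hy' _).eq, Module.End.mul_apply, rep₁₂₃_qH_apply hx,
            map_smul]
        · rw [SetLike.mem_coe, LinearMap.mem_ker, ← Module.End.mul_apply, ← (hy' _).eq,
            Module.End.mul_apply, ih _ hEx]
      rcases le_or_gt (2 * ((k + 1 : ℕ) : ℤ)) N with hk | hk
      · have h1 := hwProj_of_mem_highestWeightSpace (k + 1) hyx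
        rw [centralizer_hwProj_apply hy, h (k + 1) hk _ (hwProj_mem hq' (k + 1) hx)] at h1
        exact (smul_eq_zero.1 h1.symm).resolve_left (hwScalar_ne_zero hq hk)
      · rwa [highestWeightSpace_eq_bot hq hk, Submodule.mem_bot] at hyx
  refine end_ext_tensorVec (V := M) fun i j l => ?_
  rw [LinearMap.zero_apply]
  rcases lt_or_ge (i + j + l) 0 with hk | hk
  · have := tensorVec_mem_weightSpace (n₁ := n₁) (n₂ := n₂) (n₃ := n₃) (rfl : i + j + l = _)
    rw [weightSpace_eq_bot (Or.inl hk), Submodule.mem_bot] at this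
    rw [this, map_zero]
  · exact key (i + j + l).toNat _ (tensorVec_mem_weightSpace (by omega))

theorem spinCentralizer_le (hq : ∀ m : ℕ, 0 < m → q ^ m ≠ 1) : 𝒞 ≤ 𝒜 := by
  intro y hy
  -- This bound makes `k < K` equivalent to `2k ≤ n₁ + n₂ + n₃`, so every level needed by
  -- `centralizer_eq_zero` is covered.
  obtain ⟨a, ha, haw⟩ := exists_eq_on_highestWeightSpaces hq hy ((n₁ + n₂ + n₃) / 2 + 1) (by omega)
  have h : y - a = 0 := centralizer_eq_zero hq (sub_mem hy (casimirAlgebra_le hq ha))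
    fun k hk w hw' => by rw [LinearMap.sub_apply, haw k (by omega) w hw', sub_self]
  rwa [sub_eq_zero.1 h]

theorem casimirAlgebra_eq (hq : ∀ m : ℕ, 0 < m → q ^ m ≠ 1) : 𝒜 = 𝒞 :=
  le_antisymm (casimirAlgebra_le hq) (spinCentralizer_le hq)

/-! ### The homomorphism from `AW(3)` to the centralizer -/

theorem exists_AW_hom_spinCentralizer (hq : ∀ m : ℕ, 0 < m → q ^ m ≠ 1) :
    ∃ φ : AW q →ₐ[ℂ] 𝒞,
      (φ (AW.gen q .α₁) : Module.End ℂ M) = ρ₁ (Uq.casimir q) ∧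
      (φ (AW.gen q .α₂) : Module.End ℂ M) = ρ₂ (Uq.casimir q) ∧
      (φ (AW.gen q .α₃) : Module.End ℂ M) = ρ₃ (Uq.casimir q) ∧
      (φ (AW.gen q .A) : Module.End ℂ M) = ρ₁₂ (Uq.casimir q) ∧
      (φ (AW.gen q .B) : Module.End ℂ M) = ρ₂₃ (Uq.casimir q) ∧
      (φ (AW.gen q .K) : Module.End ℂ M) = ρ (Uq.casimir q) := by
  have hq' := sq_sub_one_ne_zero hq
  obtain ⟨φ, h₁, h₂, h₃, hA, hB, hK⟩ := exists_AW_hom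
    (pow_four_sub_one_ne_zero hq)
    (⟨ρ₁₂ (Uq.casimir q), casimirAlgebra_le hq rep₁₂_casimir_mem_casimirAlgebra⟩ : 𝒞)
    (⟨ρ₂₃ (Uq.casimir q), casimirAlgebra_le hq rep₂₃_casimir_mem_casimirAlgebra⟩ : 𝒞)
    (⟨ρ (Uq.casimir q), casimirAlgebra_le hq rep₁₂₃_casimir_mem_casimirAlgebra⟩ : 𝒞)
    (casimirScalar q ((s : ℂ) ^ n₁)) (casimirScalar q ((s : ℂ) ^ n₂))
    (casimirScalar q ((s : ℂ) ^ n₃))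
    (Subtype.ext (commute_rep₁₂_casimir hq' _).symm.eq)
    (Subtype.ext (commute_rep₂₃_casimir hq' _).symm.eq)
    (Subtype.ext (cubic_relation₁ hq' _ _ _ rfl rfl rfl))
    (Subtype.ext (cubic_relation₂ hq' _ _ _ rfl rfl rfl))
  refine ⟨φ, ?_, ?_, ?_, ?_, ?_, ?_⟩
  · rw [h₁, rep₁_casimir hq']
    rfl
  · rw [h₂, rep₂_casimir hq']
    rfl
  · rw [h₃, rep₃_casimir hq']
    rfl
  · rw [hA]
  · rw [hB]
  · rw [hK]

end Surjectivity

end AskeyWilson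

end

theorem proposition4p2 (q : ℂˣ) (hq : ∀ m : ℕ, 0 < m → q ^ m ≠ 1)
    (s : ℂˣ) (hs : s ^ 2 = q) (n₁ n₂ n₃ : ℕ) :
    (∃ φ : AskeyWilson.AW q →ₐ[ℂ] AskeyWilson.spinCentralizer q s hs n₁ n₂ n₃,
      ((φ (AskeyWilson.AW.gen q .α₁) : Module.End ℂ (AskeyWilson.SpinModule₃ n₁ n₂ n₃)) =
          AskeyWilson.spinRep₃ q s hs n₁ n₂ n₃ (AskeyWilson.Uq.casimir₁ q) ∧
        (φ (AskeyWilson.AW.gen q .α₂) : Module.End ℂ (AskeyWilson.SpinModule₃ n₁ n₂ n₃)) =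
          AskeyWilson.spinRep₃ q s hs n₁ n₂ n₃ (AskeyWilson.Uq.casimir₂ q) ∧
        (φ (AskeyWilson.AW.gen q .α₃) : Module.End ℂ (AskeyWilson.SpinModule₃ n₁ n₂ n₃)) =
          AskeyWilson.spinRep₃ q s hs n₁ n₂ n₃ (AskeyWilson.Uq.casimir₃ q) ∧
        (φ (AskeyWilson.AW.gen q .A) : Module.End ℂ (AskeyWilson.SpinModule₃ n₁ n₂ n₃)) =
          AskeyWilson.spinRep₃ q s hs n₁ n₂ n₃ (AskeyWilson.Uq.casimir₁₂ q) ∧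
        (φ (AskeyWilson.AW.gen q .B) : Module.End ℂ (AskeyWilson.SpinModule₃ n₁ n₂ n₃)) =
          AskeyWilson.spinRep₃ q s hs n₁ n₂ n₃ (AskeyWilson.Uq.casimir₂₃ q) ∧
        (φ (AskeyWilson.AW.gen q .K) : Module.End ℂ (AskeyWilson.SpinModule₃ n₁ n₂ n₃)) =
          AskeyWilson.spinRep₃ q s hs n₁ n₂ n₃ (AskeyWilson.Uq.casimir₁₂₃ q)) ∧
      Function.Surjective φ) ∧
    Algebra.adjoin ℂ
      {AskeyWilson.spinRep₃ q s hs n₁ n₂ n₃ (AskeyWilson.Uq.casimir₁₂ q),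
        AskeyWilson.spinRep₃ q s hs n₁ n₂ n₃ (AskeyWilson.Uq.casimir₂₃ q),
        AskeyWilson.spinRep₃ q s hs n₁ n₂ n₃ (AskeyWilson.Uq.casimir₁₂₃ q)} =
      AskeyWilson.spinCentralizer q s hs n₁ n₂ n₃ := by
  obtain ⟨φ, h₁, h₂, h₃, hA, hB, hK⟩ :=
    AskeyWilson.exists_AW_hom_spinCentralizer (hs := hs) (n₁ := n₁) (n₂ := n₂) (n₃ := n₃) hq
  refine ⟨⟨φ, ⟨h₁, h₂, h₃, hA, hB, hK⟩, fun y => ?_⟩, AskeyWilson.casimirAlgebra_eq hq⟩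
  have hy := AskeyWilson.spinCentralizer_le hq y.2
  -- The range of `φ`, viewed inside the endomorphism algebra, contains the three generators; hence
  -- it contains all of `𝒜 = 𝒞`.
  have hle : AskeyWilson.casimirAlgebra n₁ n₂ n₃ q s hs ≤
      ((AskeyWilson.spinCentralizer q s hs n₁ n₂ n₃).val.comp φ).range := by
    refine Algebra.adjoin_le ?_
    rintro _ (rfl | rfl | rfl)
    exacts [⟨_, hA⟩, ⟨_, hB⟩, ⟨_, hK⟩]
  obtain ⟨a, ha⟩ := hle hy
  exact ⟨a, Subtype.ext ha⟩
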